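/- Work in von Neumann–Gödel–Bernays class theory NGB without any choice principle. An \emph{inner model} is a transitive proper class $M$ satisfying ZF, in the sense that $M$ is closed under the Gödel operations and every set $x\subseteq M$ is included in some $y\in M$. For inner models $M,N$, an \emph{elementary embedding} $j:M\to N$ is a class function that is $\Delta_0$-elementary and cofinal (every $y\in N$ lies in $j(x)$ for some $x\in M$). For a formula $\varphi(x,y)$ of the language of set theory, an inner model $N$ and $b\in N$, put $A_\varphi^N=\{x\in N: N\models\varphi(x,b)\}$; classes of this form are called $b$-definable in $N$. $\mathrm{HOD}[b]^N$ is the class of all $x\in N$ such that $x$ and every member of the transitive closure of $x$ is definable in $N$ from $b$ and finitely many ordinals. \textbf{Theorem (scheme).} Let $j:M\to N$ be an elementary embedding of inner models $M\subseteq N$, let $b\in M$ with $j(b)=b$, and suppose that $M$ is $b$-definable in $N$. Let $\varphi(x,y)$ be a formula and let $A=A_\varphi^N$. Then: (1) the transitive closure of $A$ (the smallest transitive class including $A$) has a $b$-definable well-ordering in $N$, i.e. one given by $\{(x,y): N\models\chi(x,y,b)\}$ for some formula $\chi$, if and only if $A\subseteq\mathrm{HOD}[b]^N$; (2) if these equivalent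 conditions hold, then $A^M=A^N$, i.e. $\{x\in M: M\models\varphi(x,b)\}=\{x\in N: N\models\varphi(x,b)\}$. -/

import Mathlib

/-!
The statement is a theorem scheme of von Neumann-Goedel-Bernays class theory without any choice
principle.  It is rendered semantically: it is asserted about every model `(S, E, 𝒞)` of that
theory (`S` the sets, `E` the membership relation, `𝒞` the classes), which need not be well-founded
nor contain only standard natural numbers, and about every pair of first-order formulas.
-/

namespace ClassTheory

universe u v

/-- Relation symbols of the language of set theory expanded by one unary predicate symbol for
each `k : K`. -/
inductive SetRel (K : Type u) : ℕ → Type u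
  | mem : SetRel K 2
  | cls (k : K) : SetRel K 1

/-- The language of set theory with unary predicates indexed by `K`. -/
def setLangWith (K : Type u) : FirstOrder.Language.{0, u} := ⟨fun _ => Empty, SetRel K⟩

/-- The language `{∈}` of set theory. -/
abbrev setLang : FirstOrder.Language := setLangWith Empty

/-- Interpretation of membership by `E` and of the predicate symbols by `I`. -/
abbrev setStructureWith {X : Type v} {K : Type u} (E : X → X → Prop) (I : K → Set X) :
    (setLangWith K).Structure X where
  funMap := fun f => Empty.elim f
  RelMap := fun {_} r =>
    match r with
    | SetRel.mem => fun v => E (v 0) (v 1)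
    | SetRel.cls k => fun v => v 0 ∈ I k

section

variable {S : Type u} (E : S → S → Prop) (𝒞 : Set (Set S))

/-- The structure `(M, ∈)` for a class `M`. -/
abbrev inStructure (M : Set S) : setLang.Structure M :=
  setStructureWith (fun x y : M => E x y) (fun k : Empty => k.elim)

/-- `M ⊨ φ[v]`. -/
def Sat (M : Set S) {α : Type*} (φ : setLang.Formula α) (v : α → M) : Prop :=
  letI := inStructure E M
  φ.Realize v

/-- `p = {x, y}`. -/
def IsUPair (p x y : S) : Prop := ∀ z, E z p ↔ z = x ∨ z = y

/-- `p = (x, y) = {{x}, {x, y}}`. -/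
def IsPair (p x y : S) : Prop := ∀ z, E z p ↔ IsUPair E z x x ∨ IsUPair E z x y

/-- `t = (x, y, z) = ((x, y), z)`. -/
def IsTriple (t x y z : S) : Prop := ∃ p, IsPair E p x y ∧ IsPair E t p z

/-- The axioms of von Neumann-Goedel-Bernays class theory, without choice. Classes are identified
with their extensions, so extensionality for classes needs no axiom. -/
structure IsNGB : Prop where
  extensionality : ∀ x y : S, (∀ z, E z x ↔ E z y) → x = y
  pairing : ∀ x y : S, ∃ p, IsUPair E p x y
  union : ∀ x : S, ∃ u, ∀ z, E z u ↔ ∃ y, E y x ∧ E z y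
  powerset : ∀ x : S, ∃ p, ∀ z, E z p ↔ ∀ t, E t z → E t x
  infinity : ∃ w : S, (∃ e, E e w ∧ ∀ z, ¬ E z e) ∧
    ∀ x, E x w → ∃ s, E s w ∧ ∀ z, E z s ↔ E z x ∨ z = x
  /-- Every nonempty class has an `∈`-minimal element. -/
  foundation : ∀ C ∈ 𝒞, C.Nonempty → ∃ x ∈ C, ∀ y ∈ C, ¬ E y x
  /-- The image of a set under a class function is a set. -/
  replacement : ∀ F ∈ 𝒞,
    (∀ x y y' p p', p ∈ F → p' ∈ F → IsPair E p x y → IsPair E p' x y' → y = y') →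
    ∀ a : S, ∃ c, ∀ y, E y c ↔ ∃ x p, E x a ∧ p ∈ F ∧ IsPair E p x y
  /-- Predicative comprehension: whatever is defined by a formula that quantifies only over
  sets, with set and class parameters, is a class. -/
  comprehension : ∀ C : Set S,
    @Set.Definable₁ S Set.univ (setLangWith 𝒞) (setStructureWith E (fun k : 𝒞 => (k : Set S))) C →
    C ∈ 𝒞

/-- Transitivity of a class. -/
def IsTransClass (M : Set S) : Prop := ∀ x ∈ M, ∀ y, E y x → y ∈ M

/-- The transitive closure of a class: the smallest transitive class that includes it. -/
def tcl (A : Set S) : Set S := {x | ∀ T ∈ 𝒞, IsTransClass E T → A ⊆ T → x ∈ T}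

/-- Ordinals: transitive sets of transitive sets (in the presence of foundation). -/
def IsOrd (x : S) : Prop :=
  IsTransClass E {y | E y x} ∧ ∀ y, E y x → IsTransClass E {z | E z y}

/-- Closure of a class under the ten Goedel operations. -/
structure GodelClosed (M : Set S) : Prop where
  pair : ∀ x ∈ M, ∀ y ∈ M, ∀ r, IsUPair E r x y → r ∈ M
  prod : ∀ x ∈ M, ∀ y ∈ M, ∀ r,
    (∀ t, E t r ↔ ∃ u v, E u x ∧ E v y ∧ IsPair E t u v) → r ∈ M
  eps : ∀ x ∈ M, ∀ y ∈ M, ∀ r,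
    (∀ t, E t r ↔ ∃ u v, E u x ∧ E v y ∧ E u v ∧ IsPair E t u v) → r ∈ M
  diff : ∀ x ∈ M, ∀ y ∈ M, ∀ r, (∀ t, E t r ↔ E t x ∧ ¬ E t y) → r ∈ M
  inter : ∀ x ∈ M, ∀ y ∈ M, ∀ r, (∀ t, E t r ↔ E t x ∧ E t y) → r ∈ M
  sUnion : ∀ x ∈ M, ∀ r, (∀ t, E t r ↔ ∃ y, E y x ∧ E t y) → r ∈ M
  dom : ∀ x ∈ M, ∀ r, (∀ u, E u r ↔ ∃ v p, E p x ∧ IsPair E p u v) → r ∈ M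
  swap : ∀ x ∈ M, ∀ r,
    (∀ t, E t r ↔ ∃ u v p, E p x ∧ IsPair E p v u ∧ IsPair E t u v) → r ∈ M
  swapLast : ∀ x ∈ M, ∀ r,
    (∀ t, E t r ↔ ∃ u v w p, E p x ∧ IsTriple E p u w v ∧ IsTriple E t u v w) → r ∈ M
  rotate : ∀ x ∈ M, ∀ r,
    (∀ t, E t r ↔ ∃ u v w p, E p x ∧ IsTriple E p v w u ∧ IsTriple E t u v w) → r ∈ M

/-- Every set that is included in `M` is included in an element of `M`. -/
def AlmostUniversal (M : Set S) : Prop :=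
  ∀ x, (∀ z, E z x → z ∈ M) → ∃ y ∈ M, ∀ z, E z x → E z y

/-- Inner models of ZF: transitive proper classes that are closed under the Goedel operations
and almost universal (for transitive proper classes this amounts to satisfying ZF). -/
structure IsInnerModel (M : Set S) : Prop where
  isClass : M ∈ 𝒞
  proper : ¬ ∃ s : S, M = {x | E x s}
  trans : IsTransClass E M
  godel : GodelClosed E M
  almostUniversal : AlmostUniversal E M

/-- The formula `v ∈ w`, for variables `v`, `w`. -/
def memF {α : Type*} {n : ℕ} (v w : α ⊕ Fin n) : setLang.BoundedFormula α n :=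
  FirstOrder.Language.Relations.boundedFormula₂ (L := setLang) SetRel.mem
    (FirstOrder.Language.Term.var v) (FirstOrder.Language.Term.var w)

/-- The `Δ₀` formulas of set theory: the only quantifiers are `∀ x ∈ v` (and, through the
connectives, `∃ x ∈ v`). -/
inductive IsDelta0 {α : Type*} : ∀ {n : ℕ}, setLang.BoundedFormula α n → Prop
  | falsum {n : ℕ} : IsDelta0 (⊥ : setLang.BoundedFormula α n)
  | mem {n : ℕ} (v w : α ⊕ Fin n) : IsDelta0 (memF v w)
  | equal {n : ℕ} (v w : α ⊕ Fin n) :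
      IsDelta0 (FirstOrder.Language.Term.bdEqual (FirstOrder.Language.Term.var v) (FirstOrder.Language.Term.var w))
  | imp {n : ℕ} {φ χ : setLang.BoundedFormula α n} :
      IsDelta0 φ → IsDelta0 χ → IsDelta0 (φ.imp χ)
  | ball {n : ℕ} (v : α ⊕ Fin n) {φ : setLang.BoundedFormula α (n + 1)} :
      IsDelta0 φ →
      IsDelta0 ((memF (Sum.inr (Fin.last n)) (Sum.map id Fin.castSucc v)).imp φ).all

/-- Elementary embeddings `j : M → N` of inner models of ZF: class functions that are
`Δ₀`-elementary and cofinal (by Gaifman's theorem these are fully elementary). -/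
structure IsElementaryEmbedding {M N : Set S} (j : M → N) : Prop where
  isClass : {p | ∃ x : M, IsPair E p x (j x)} ∈ 𝒞
  delta0 : ∀ (k : ℕ) (φ : setLang.Formula (Fin k)), IsDelta0 φ →
    ∀ v : Fin k → M, Sat E M φ v ↔ Sat E N φ (fun i => j (v i))
  cofinal : ∀ y : N, ∃ x : M, E y (j x)

/-- The class `{x ∈ N | N ⊨ φ(x, b)}`. -/
def definedClass (N : Set S) (φ : setLang.Formula (Fin 2)) (b : N) : Set S :=
  {x | ∃ h : x ∈ N, Sat E N φ ![⟨x, h⟩, b]}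

/-- `OD[b]^N`: the elements of `N` that are definable in `(N, ∈)` from `b` and finitely many
ordinals. (By reflection inside `N` these are the elements that are definable in some `V_α` of
`N`, in the sense of `N`, from `b` and ordinals below `α`; a possibly nonstandard formula of `N`
is there coded by an ordinal, so both readings agree in every model.) -/
def OD (N : Set S) (b : N) : Set S :=
  {x | ∃ h : x ∈ N,
    @Set.Definable₁ N ({a : N | IsOrd E a} ∪ {b}) setLang (inStructure E N) {⟨x, h⟩}}

/-- `HOD[b]^N`: the sets `x` such that `x` and all members of its transitive closure are
in `OD[b]^N`. -/
def HOD (N : Set S) (b : N) : Set S := {x | tcl E 𝒞 {x} ⊆ OD E N b}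

/-- `{(x, y) | N ⊨ χ(x, y, b)}` is a (strict) well-ordering, in `N`, of the class `T ⊆ N`. -/
structure WellOrdersIn (N T : Set S) (χ : setLang.Formula (Fin 3)) (b : N) : Prop where
  irrefl : ∀ x : N, ↑x ∈ T → ¬ Sat E N χ ![x, x, b]
  trans : ∀ x y z : N, ↑x ∈ T → ↑y ∈ T → ↑z ∈ T →
    Sat E N χ ![x, y, b] → Sat E N χ ![y, z, b] → Sat E N χ ![x, z, b]
  total : ∀ x y : N, ↑x ∈ T → ↑y ∈ T → x ≠ y → Sat E N χ ![x, y, b] ∨ Sat E N χ ![y, x, b]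
  /-- Every nonempty set of `N` that is included in `T` has a least element. -/
  least : ∀ s : N, (∃ x, E x s) → (∀ x, E x s → x ∈ T) →
    ∃ m : N, E m s ∧ ∀ x : N, E x s → x ≠ m → Sat E N χ ![m, x, b]

end

end ClassTheory

open ClassTheory

set_option autoImplicit false
set_option linter.unusedSectionVars false

/-! ### Definable predicates and their closure properties -/

namespace ClassTheory

open FirstOrder FirstOrder.Language

universe u v w x

/-! The argument lives in one model of class theory, whose natural numbers may be nonstandard, and
there is no truth predicate for the inner models. Both facts shape it.

Part (1). A recursion over the ordinals of `N` enumerates sets. An index codes a triple `(i, α, β)`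
of smaller ordinals, and the set at that index is `V_α`, `{α}`, `{b}`, or the result of a Goedel
operation on the sets with indices `α` and `β`. The class of enumerated sets is closed under these
operations and contains every `V_α`, so it satisfies separation for each formula with `b` and
ordinals as parameters (`OpClosed.exists_separation`). Cutting `{x}` out of some `V_σ` shows that
every set definable from `b` and ordinals is enumerated (`ZFModel.enumerated_of_definable`), so such
sets are well-ordered by their first index. Conversely, a `b`-definable well-ordering of the
transitive closure of `A` becomes set-like when ranks are compared first. Its Mostowski collapse
assigns distinct ordinals to distinct elements, so each element is definable from `b` and one
ordinal (`tcl_subset_OD`).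

Part (2) rests on `DefinableEmbedding.exists_fixed`: the least ordinal with a property that is
definable from `b` in `N` is fixed by `j`. Let `d₁` be this ordinal as computed in `M`; then `j(d₁)`
is the one of `N`, and `j(d₁) < d₁` is impossible. Suppose `d₁ < j(d₁)`. Let `M_n` be the domain of
the iterate `j^n`. Then `j^n : M_n → N` is elementary and fixes `b`, and `M_{n+1}` is defined in
`M_n` just as `M` is defined in `N`. Hence the drop from `N` to `M` recurs from `M_n` to `M_{n+1}`
for every `n`, against foundation for classes (`not_descending`).

Here `n` runs through the finite ordinals of the model, so facts about `j^n` need internal induction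
on a single definable statement. Full elementarity is no such statement. The induction therefore
carries cofinality and almost universality (`IterGood`) and, for one formula at a time,
`Δ₀`-preservation; Gaifman's theorem (`sat_iff_of_cofinal`) then gives elementarity for each `n`.

As `M` is definable from `b`, the structure `N` can speak about disagreements between itself and
`M`. The `ξ`-th set of `M` is mapped to the `j(ξ)`-th set of `N`. A least index that witnesses a
disagreement is fixed by `j`, and this refutes the disagreement. So hereditarily enumerated sets
have the same indices in `M` and `N` (`not_bad`), and applying this principle to the elements of `A`
gives `A^M = A^N` (`definedClass_eq`).

Definability is checked by instance search throughout: `DefSystem` abstracts the closure properties,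
and its instances differ in the admitted parameters and predicates. -/

/-- A system of definable predicates of valuations `ℕ → X i`, uniform in `i`. -/
structure DefSystem {ι : Type u} {X : ι → Type v} (E : ∀ i, X i → X i → Prop) where
  Def : (∀ i, (ℕ → X i) → Prop) → Prop
  Term : (∀ i, (ℕ → X i) → X i) → Prop
  var : ∀ k, Term fun _ v => v k
  shift : ∀ {t : ∀ i, (ℕ → X i) → X i}, Term t → Term fun i v => t i fun n => v (n + 1)
  mem : ∀ {s t : ∀ i, (ℕ → X i) → X i}, Term s → Term t → Def fun i v => E i (s i v) (t i v)
  eq : ∀ {s t : ∀ i, (ℕ → X i) → X i}, Term s → Term t → Def fun i v => s i v = t i v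
  falsum : Def fun _ _ => False
  imp : ∀ {P Q : ∀ i, (ℕ → X i) → Prop}, Def P → Def Q → Def fun i v => P i v → Q i v
  all : ∀ {P : ∀ i, (ℕ → X i) → X i → Prop},
    Def (fun i v => P i (fun n => v (n + 1)) (v 0)) → Def fun i v => ∀ x, P i v x
  subst : ∀ {P : ∀ i, (ℕ → X i) → Prop} {t : ℕ → ∀ i, (ℕ → X i) → X i}, Def P → (∀ k : ℕ, Term (t k)) → Def fun i v => P i fun k => t k i v

section

variable {ι : Type u} {X : ι → Type v} {E : ∀ i, X i → X i → Prop}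

/-- Definability as a type class. -/
class IsDef (D : DefSystem E) (P : ∀ i, (ℕ → X i) → Prop) : Prop where
  out : D.Def P

/-- Terms as a type class. -/
class IsTm (D : DefSystem E) (t : ∀ i, (ℕ → X i) → X i) : Prop where
  out : D.Term t

variable {D : DefSystem E}

instance isTm_var (k : ℕ) : IsTm D (fun _ v => v k) := ⟨D.var k⟩

variable {P Q : ∀ i, (ℕ → X i) → Prop} {R : ∀ i, (ℕ → X i) → X i → Prop}
  {s t : ∀ i, (ℕ → X i) → X i}

instance isDef_mem [hs : IsTm D s] [ht : IsTm D t] : IsDef D (fun i v => E i (s i v) (t i v)) :=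
  ⟨D.mem hs.out ht.out⟩

instance isDef_eq [hs : IsTm D s] [ht : IsTm D t] : IsDef D (fun i v => s i v = t i v) :=
  ⟨D.eq hs.out ht.out⟩

instance isDef_false : IsDef D (fun _ _ => False) := ⟨D.falsum⟩

instance isDef_imp [hP : IsDef D P] [hQ : IsDef D Q] : IsDef D (fun i v => P i v → Q i v) :=
  ⟨D.imp hP.out hQ.out⟩

instance isDef_not [hP : IsDef D P] : IsDef D (fun i v => ¬ P i v) :=
  ⟨D.imp hP.out D.falsum⟩

instance isDef_true : IsDef D (fun _ _ => True) :=
  ⟨by simpa using D.imp D.falsum D.falsum⟩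

theorem IsDef.congr (hP : IsDef D P) (h : ∀ i v, P i v ↔ Q i v) : IsDef D Q := by
  have : P = Q := by funext i v; exact propext (h i v)
  exact this ▸ hP

instance isDef_and [hP : IsDef D P] [hQ : IsDef D Q] : IsDef D (fun i v => P i v ∧ Q i v) :=
  IsDef.congr (P := fun i v => ¬ (P i v → ¬ Q i v)) inferInstance (by intros; tauto)

instance isDef_or [hP : IsDef D P] [hQ : IsDef D Q] : IsDef D (fun i v => P i v ∨ Q i v) :=
  IsDef.congr (P := fun i v => ¬ P i v → Q i v) inferInstance (by intros; tauto)

instance isDef_iff [hP : IsDef D P] [hQ : IsDef D Q] : IsDef D (fun i v => P i v ↔ Q i v) :=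
  IsDef.congr (P := fun i v => (P i v → Q i v) ∧ (Q i v → P i v)) inferInstance (by intros; tauto)

/-- Variables are de Bruijn indices: the quantified variable becomes variable `0` and the others
move up. The instance lets type class search descend through a displayed formula. -/
instance isDef_all [hR : IsDef D fun i v => R i (fun n => v (n + 1)) (v 0)] :
    IsDef D (fun i v => ∀ x, R i v x) := ⟨D.all hR.out⟩

instance isDef_ex [hR : IsDef D fun i v => R i (fun n => v (n + 1)) (v 0)] :
    IsDef D (fun i v => ∃ x, R i v x) :=
  IsDef.congr (P := fun i v => ¬ ∀ x, ¬ R i v x) ⟨D.imp (D.all (D.imp hR.out D.falsum)) D.falsum⟩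
    (by intros; push Not; rfl)

theorem IsTm.shift (ht : IsTm D t) : IsTm D (fun i v => t i fun n => v (n + 1)) :=
  ⟨D.shift ht.out⟩

/-- The `_base` lemmas treat a notion at the first few variables; these substitution lemmas turn
them into instances at arbitrary terms. -/
theorem IsDef.subst₁ {R : ∀ i, X i → Prop} (h : IsDef D fun i v => R i (v 0)) {t₀}
    (h₀ : IsTm D t₀) : IsDef D fun i v => R i (t₀ i v) :=
  ⟨D.subst (t := fun _ => t₀) h.out fun _ => h₀.out⟩

theorem IsDef.subst₂ {R : ∀ i, X i → X i → Prop} (h : IsDef D fun i v => R i (v 0) (v 1)) {t₀ t₁}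
    (h₀ : IsTm D t₀) (h₁ : IsTm D t₁) : IsDef D fun i v => R i (t₀ i v) (t₁ i v) :=
  ⟨D.subst (t := fun | 0 => t₀ | _ => t₁) h.out fun | 0 => h₀.out | _ + 1 => h₁.out⟩

theorem IsDef.subst₃ {R : ∀ i, X i → X i → X i → Prop}
    (h : IsDef D fun i v => R i (v 0) (v 1) (v 2)) {t₀ t₁ t₂}
    (h₀ : IsTm D t₀) (h₁ : IsTm D t₁) (h₂ : IsTm D t₂) :
    IsDef D fun i v => R i (t₀ i v) (t₁ i v) (t₂ i v) :=
  ⟨D.subst (t := fun | 0 => t₀ | 1 => t₁ | _ => t₂) h.out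
    fun | 0 => h₀.out | 1 => h₁.out | _ + 2 => h₂.out⟩

theorem IsDef.subst₄ {R : ∀ i, X i → X i → X i → X i → Prop}
    (h : IsDef D fun i v => R i (v 0) (v 1) (v 2) (v 3)) {t₀ t₁ t₂ t₃}
    (h₀ : IsTm D t₀) (h₁ : IsTm D t₁) (h₂ : IsTm D t₂) (h₃ : IsTm D t₃) :
    IsDef D fun i v => R i (t₀ i v) (t₁ i v) (t₂ i v) (t₃ i v) :=
  ⟨D.subst (t := fun | 0 => t₀ | 1 => t₁ | 2 => t₂ | _ => t₃) h.out
    fun | 0 => h₀.out | 1 => h₁.out | 2 => h₂.out | _ + 3 => h₃.out⟩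

theorem isDef_forall_fin {n : ℕ} : ∀ {P : Fin n → ∀ i, (ℕ → X i) → Prop}, (∀ k, IsDef D (P k)) →
    IsDef D (fun i v => ∀ k, P k i v) := by
  induction n with
  | zero => exact fun _ => isDef_true.congr fun i v => ⟨fun _ k => k.elim0, fun _ => trivial⟩
  | succ n ih =>
    intro P h
    exact (@isDef_and _ _ _ _ _ _ (h 0) (ih fun k => h k.succ)).congr fun i v =>
      (Fin.forall_fin_succ (P := fun k => P k i v)).symm

/-- Definability of a quantifier over finite tuples. -/
theorem isDef_all_fin (n : ℕ) : ∀ {R : ∀ i, (ℕ → X i) → (Fin n → X i) → Prop},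
    IsDef D (fun i v => R i (fun k => v (k + n)) (fun k => v k)) →
    IsDef D (fun i v => ∀ x : Fin n → X i, R i v x) := by
  induction n with
  | zero =>
    intro R h
    refine h.congr fun i v => ?_
    exact ⟨fun h x => (Subsingleton.elim (fun k : Fin 0 => v k) x) ▸ h, fun h => h _⟩
  | succ n ih =>
    intro R h
    -- The last coordinate is quantified outermost, so it ends up as variable `n`, above the
    -- variables of the shorter tuple.
    have : IsDef D (fun i v => ∀ x, ∀ y : Fin n → X i, R i v (Fin.snoc y x)) := by
      refine @isDef_all _ _ _ _ _ (ih ?_)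
      refine h.congr fun i v => ?_
      have e1 : (fun k => v (k + (n + 1))) = fun k => v (k + 1 + n) := by
        funext k; congr 1; omega
      have e2 : (fun k : Fin (n + 1) => v k) =
          Fin.snoc (fun k : Fin n => v k) (v (0 + n)) := by
        funext k
        refine Fin.lastCases ?_ (fun k => ?_) k <;> simp
      rw [e1, e2]
    refine this.congr fun i v => ⟨fun h x => ?_, fun h x y => h _⟩
    simpa using h (x (Fin.last n)) (Fin.init x)

end

/-! ### Systems given by first-order formulas -/

section

variable {ι : Type u} {X : ι → Type v} {K : Type w} {κ : Type x}

/-- The predicates defined by first-order formulas with predicate symbols indexed by `K` and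
parameters indexed by `κ`. -/
def formulaSystem (E : ∀ i, X i → X i → Prop) (I : ∀ i, K → Set (X i)) (c : ∀ i, κ → X i) :
    DefSystem E where
  Def P := ∃ φ : (setLangWith K).Formula (κ ⊕ ℕ), ∀ i v,
    (letI := setStructureWith (E i) (I i); φ.Realize (Sum.elim (c i) v)) ↔ P i v
  Term t := ∃ x : κ ⊕ ℕ, ∀ i v, Sum.elim (c i) v x = t i v
  var k := ⟨Sum.inr k, fun _ _ => rfl⟩
  shift := by
    rintro t ⟨x | x, h⟩
    · exact ⟨Sum.inl x, fun i v => h i fun n => v (n + 1)⟩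
    · exact ⟨Sum.inr (x + 1), fun i v => h i fun n => v (n + 1)⟩
  mem := by
    rintro s t ⟨x, hx⟩ ⟨y, hy⟩
    refine ⟨Relations.formula₂ (L := setLangWith K) SetRel.mem (Term.var x) (Term.var y), fun i v => ?_⟩
    let _ := setStructureWith (E i) (I i)
    refine (Formula.realize_rel₂ (L := setLangWith K)).trans ?_
    change E i (Sum.elim (c i) v x) (Sum.elim (c i) v y) ↔ _
    rw [hx, hy]
  eq := by
    rintro s t ⟨x, hx⟩ ⟨y, hy⟩
    refine ⟨Term.equal (Term.var x) (Term.var y), fun i v => ?_⟩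
    let _ := setStructureWith (E i) (I i)
    rw [Formula.realize_equal]
    simp [hx, hy]
  falsum := ⟨⊥, fun _ _ => Iff.rfl⟩
  imp := by
    rintro P Q ⟨φ, hφ⟩ ⟨χ, hχ⟩
    exact ⟨φ.imp χ, fun i v => imp_congr (hφ i v) (hχ i v)⟩
  all := by
    rintro P ⟨φ, hφ⟩
    -- Variable `0` becomes the bound variable and variable `n + 1` becomes the free variable `n`.
    let g : κ ⊕ ℕ → (κ ⊕ ℕ) ⊕ Fin 1 := fun
      | .inl a => .inl (.inl a)
      | .inr 0 => .inr 0
      | .inr (n + 1) => .inl (.inr n)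
    refine ⟨(BoundedFormula.relabel g φ).all, fun i v => ?_⟩
    let _ := setStructureWith (E i) (I i)
    refine forall_congr' fun x => ?_
    rw [BoundedFormula.realize_relabel]
    have := hφ i (fun | 0 => x | n + 1 => v n)
    refine Iff.trans ?_ this
    rw [Formula.Realize, iff_iff_eq]
    congr 1
    · funext a
      rcases a with a | _ | n <;> rfl
    · exact Subsingleton.elim _ _
  subst := by
    rintro P t ⟨φ, hφ⟩ ht
    choose x hx using ht
    refine ⟨φ.relabel (Sum.elim Sum.inl x), fun i v => ?_⟩
    let _ := setStructureWith (E i) (I i)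
    rw [Formula.realize_relabel]
    refine Iff.trans ?_ (hφ i fun k => t k i v)
    rw [iff_iff_eq]
    congr 1
    funext a
    rcases a with a | a
    · rfl
    · exact hx a i v

/-- The class of all binary relations. -/
structure BinRel where
  carrier : Type u
  rel : carrier → carrier → Prop

/-- Predicates that are defined by one formula of set theory in all structures. -/
abbrev uniformSystem : DefSystem (fun i : BinRel.{u} => i.rel) :=
  formulaSystem (K := Empty) (κ := Empty) _ (fun _ k => k.elim) (fun _ k => k.elim)

end

section

variable {X : Type v} {E : X → X → Prop}

/-- Systems on one structure in which every element is a parameter. -/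
class HasParams (D : DefSystem (fun _ : Unit => E)) : Prop where
  const : ∀ c, D.Term fun _ _ => c

instance isTm_const {D : DefSystem (fun _ : Unit => E)} [h : HasParams D] (c : X) :
    IsTm D (fun _ _ => c) := ⟨h.const c⟩

/-- Definability with parameters in the structure `(X, E)` with additional predicates. -/
abbrev paramSystem {K : Type w} (E : X → X → Prop) (I : K → Set X) : DefSystem (fun _ : Unit => E) :=
  formulaSystem (κ := X) _ (fun _ => I) (fun _ => id)

instance {K : Type w} (I : K → Set X) : HasParams (paramSystem E I) :=
  ⟨fun c => ⟨Sum.inl c, fun _ _ => rfl⟩⟩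

end

/-! ### Pairs, ordinals and recursion as definable notions -/

section

variable {ι : Type u} {X : ι → Type v} {E : ∀ i, X i → X i → Prop} {D : DefSystem E}
variable {s t r q : ∀ i, (ℕ → X i) → X i}

theorem isDef_upair_base : IsDef D (fun i v => IsUPair (E i) (v 0) (v 1) (v 2)) := by
  unfold IsUPair; infer_instance

instance [hs : IsTm D s] [ht : IsTm D t] [hr : IsTm D r] :
    IsDef D (fun i v => IsUPair (E i) (s i v) (t i v) (r i v)) :=
  isDef_upair_base.subst₃ hs ht hr

theorem isDef_pair_base : IsDef D (fun i v => IsPair (E i) (v 0) (v 1) (v 2)) := by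
  unfold IsPair; infer_instance

instance [hs : IsTm D s] [ht : IsTm D t] [hr : IsTm D r] :
    IsDef D (fun i v => IsPair (E i) (s i v) (t i v) (r i v)) :=
  isDef_pair_base.subst₃ hs ht hr

theorem isDef_ord_base : IsDef D (fun i v => IsOrd (E i) (v 0)) := by
  unfold IsOrd IsTransClass
  simp only [Set.mem_ofPred_eq]
  infer_instance

instance [hs : IsTm D s] : IsDef D (fun i v => IsOrd (E i) (s i v)) :=
  isDef_ord_base.subst₁ hs

end

section

variable {X : Type v}

/-- `f(x) = y`, for a set `f` of ordered pairs. -/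
def App (E : X → X → Prop) (f x y : X) : Prop := ∃ p, E p f ∧ IsPair E p x y

/-- `f` is the restriction to the `R`-predecessors of `x` of a function with
`f(z) = {t | Φ z (f ↾ {w | R w z}) t}`. -/
def IsAttempt (E : X → X → Prop) (R : X → X → Prop) (Φ : X → X → X → Prop) (x f : X) : Prop :=
  (∀ q, E q f → ∃ z y, R z x ∧ IsPair E q z y) ∧
  ∀ z, R z x → ∃ y g, App E f z y ∧ (∀ y', App E f z y' → y' = y) ∧
    (∀ q, E q g ↔ E q f ∧ ∃ w y', R w z ∧ IsPair E q w y') ∧ ∀ t, E t y ↔ Φ z g t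

/-- `y` is the value at `x` of the function defined by recursion along `R` with the rule `Φ`. -/
def Rec (E : X → X → Prop) (R : X → X → Prop) (Φ : X → X → X → Prop) (x y : X) : Prop :=
  ∃ f, IsAttempt E R Φ x f ∧ ∀ t, E t y ↔ Φ x f t

/-- The strict order of the ordinals. -/
def OrdLt (E : X → X → Prop) (x y : X) : Prop := IsOrd E y ∧ E x y

end

section

variable {ι : Type u} {X : ι → Type v} {E : ∀ i, X i → X i → Prop} {D : DefSystem E}
variable {s t r q : ∀ i, (ℕ → X i) → X i}

theorem isDef_app_base : IsDef D (fun i v => App (E i) (v 0) (v 1) (v 2)) := by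
  unfold App; infer_instance

instance [hs : IsTm D s] [ht : IsTm D t] [hr : IsTm D r] :
    IsDef D (fun i v => App (E i) (s i v) (t i v) (r i v)) :=
  isDef_app_base.subst₃ hs ht hr

theorem isDef_ordLt_base : IsDef D (fun i v => OrdLt (E i) (v 0) (v 1)) := by
  unfold OrdLt; infer_instance

instance [hs : IsTm D s] [ht : IsTm D t] : IsDef D (fun i v => OrdLt (E i) (s i v) (t i v)) :=
  isDef_ordLt_base.subst₂ hs ht

/-- The relation and the rule may depend on a further term `s`. This keeps the recursion uniform in
a parameter such as `b`. -/
theorem isDef_rec {R : ∀ i, X i → X i → X i → Prop} {Φ : ∀ i, X i → X i → X i → X i → Prop}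
    (hR : IsDef D fun i v => R i (v 0) (v 1) (v 2))
    (hΦ : IsDef D fun i v => Φ i (v 0) (v 1) (v 2) (v 3)) [hs : IsTm D s] [ht : IsTm D t]
    [hr : IsTm D r] :
    IsDef D fun i v => Rec (E i) (R i (s i v)) (Φ i (s i v)) (t i v) (r i v) := by
  refine IsDef.subst₃ (R := fun i p x y => Rec (E i) (R i p) (Φ i p) x y) ?_ hs ht hr
  have hR' : ∀ {a b c : ∀ i, (ℕ → X i) → X i} [IsTm D a] [IsTm D b] [IsTm D c],
      IsDef D fun i v => R i (a i v) (b i v) (c i v) := hR.subst₃ ‹_› ‹_› ‹_›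
  have hΦ' : ∀ {a b c d : ∀ i, (ℕ → X i) → X i} [IsTm D a] [IsTm D b] [IsTm D c] [IsTm D d],
      IsDef D fun i v => Φ i (a i v) (b i v) (c i v) (d i v) := hΦ.subst₄ ‹_› ‹_› ‹_› ‹_›
  unfold Rec IsAttempt
  infer_instance

end

section

variable {X : Type v} {E : X → X → Prop}

theorem exists_isPair (hext : ∀ x y : X, (∀ z, E z x ↔ E z y) → x = y)
    (hpair : ∀ x y : X, ∃ p, IsUPair E p x y) (x y : X) : ∃ p, IsPair E p x y := by
  obtain ⟨u, hu⟩ := hpair x x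
  obtain ⟨w, hw⟩ := hpair x y
  obtain ⟨p, hp⟩ := hpair u w
  refine ⟨p, fun z => (hp z).trans (or_congr ⟨?_, ?_⟩ ⟨?_, ?_⟩)⟩
  · rintro rfl; exact hu
  · exact fun h => hext _ _ fun t => (h t).trans (hu t).symm
  · rintro rfl; exact hw
  · exact fun h => hext _ _ fun t => (h t).trans (hw t).symm

theorem isPair_unique (hext : ∀ x y : X, (∀ z, E z x ↔ E z y) → x = y) {p q x y : X}
    (hp : IsPair E p x y) (hq : IsPair E q x y) :
    p = q := hext _ _ fun t => (hp t).trans (hq t).symm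

theorem isPair_inj (hpair : ∀ x y : X, ∃ p, IsUPair E p x y) {p x y x' y' : X}
    (h : IsPair E p x y)
    (h' : IsPair E p x' y') : x = x' ∧ y = y' := by
  obtain ⟨u, hu⟩ := hpair x x
  obtain ⟨w, hw⟩ := hpair x y
  obtain ⟨w', hw'⟩ := hpair x' y'
  have hx : x' = x := by
    have : E x' u := by
      rcases (h' u).1 ((h u).2 (Or.inl hu)) with k | k <;> exact (k x').2 (Or.inl rfl)
    simpa using (hu x').1 this
  subst hx
  refine ⟨rfl, ?_⟩
  have h1 : y = x' ∨ y = y' := by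
    have hy := (hw y).2 (Or.inr rfl)
    rcases (h' w).1 ((h w).2 (Or.inr hw)) with k | k
    · exact Or.inl (by simpa using (k y).1 hy)
    · exact (k y).1 hy
  have h2 : y' = x' ∨ y' = y := by
    have hy := (hw' y').2 (Or.inr rfl)
    rcases (h w').1 ((h' w').2 (Or.inr hw')) with k | k
    · exact Or.inl (by simpa using (k y').1 hy)
    · exact (k y').1 hy
  rcases h1 with rfl | rfl
  · rcases h2 with rfl | rfl <;> rfl
  · rfl

end

/-! ### Elementary set theory and ordinals in a model -/

/-- Models of `ZF` with replacement and foundation for the `D`-definable classes, in a form that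
covers both class theory and set theory. -/
structure ZFModel {X : Type v} (E : X → X → Prop) (D : DefSystem (fun _ : Unit => E)) : Prop where
  inhabited : Nonempty X
  ext : ∀ x y : X, (∀ z, E z x ↔ E z y) → x = y
  pairing : ∀ x y : X, ∃ p, IsUPair E p x y
  union : ∀ x : X, ∃ u, ∀ z, E z u ↔ ∃ y, E y x ∧ E z y
  powerset : ∀ x : X, ∃ p, ∀ z, E z p ↔ ∀ t, E t z → E t x
  foundation : ∀ P : X → Prop, IsDef D (fun _ v => P (v 0)) → (∃ x, P x) →
    ∃ x, P x ∧ ∀ y, E y x → ¬ P y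
  replacement : ∀ R : X → X → Prop, IsDef D (fun _ v => R (v 0) (v 1)) →
    (∀ x y y', R x y → R x y' → y = y') → ∀ a, ∃ c, ∀ y, E y c ↔ ∃ x, E x a ∧ R x y

namespace ZFModel

variable {X : Type v} {E : X → X → Prop} {D : DefSystem (fun _ : Unit => E)} [HasParams D]

theorem separation (Z : ZFModel E D) (P : X → Prop) (hP : IsDef D fun _ v => P (v 0)) (a : X) :
    ∃ c, ∀ x, E x c ↔ E x a ∧ P x := by
  obtain ⟨c, hc⟩ := Z.replacement (fun x y => x = y ∧ P x) inferInstance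
    (fun x y y' h h' => h.1.symm.trans h'.1) a
  refine ⟨c, fun x => (hc x).trans ⟨?_, fun h => ⟨x, h.1, rfl, h.2⟩⟩⟩
  rintro ⟨y, hy, rfl, h⟩
  exact ⟨hy, h⟩

theorem exists_empty (Z : ZFModel E D) : ∃ e, ∀ z, ¬ E z e := by
  obtain ⟨x⟩ := Z.inhabited
  obtain ⟨e, he⟩ := Z.separation (fun _ => False) inferInstance x
  exact ⟨e, fun z hz => ((he z).1 hz).2⟩

theorem induction (Z : ZFModel E D) (P : X → Prop) (hP : IsDef D fun _ v => P (v 0))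
    (h : ∀ x, (∀ y, E y x → P y) → P x) (x : X) : P x := by
  by_contra hx
  obtain ⟨y, hy, hmin⟩ := Z.foundation (fun x => ¬ P x) inferInstance ⟨x, hx⟩
  exact hy (h y fun z hz => not_not.1 (hmin z hz))

theorem irrefl (Z : ZFModel E D) (x : X) : ¬ E x x := by
  obtain ⟨y, rfl, h⟩ := Z.foundation (fun y => y = x) inferInstance ⟨x, rfl⟩
  exact fun hx => h _ hx rfl

theorem asymm (Z : ZFModel E D) {x y : X} (hxy : E x y) (hyx : E y x) : False := by
  obtain ⟨z, rfl | rfl, h⟩ := Z.foundation (fun z => z = x ∨ z = y) inferInstance ⟨x, Or.inl rfl⟩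
  · exact h _ hyx (Or.inr rfl)
  · exact h _ hxy (Or.inl rfl)

theorem exists_union₂ (Z : ZFModel E D) (a b : X) : ∃ c, ∀ z, E z c ↔ E z a ∨ E z b := by
  obtain ⟨p, hp⟩ := Z.pairing a b
  obtain ⟨c, hc⟩ := Z.union p
  refine ⟨c, fun z => (hc z).trans ⟨?_, ?_⟩⟩
  · rintro ⟨y, hy, hz⟩
    rcases (hp y).1 hy with rfl | rfl
    exacts [Or.inl hz, Or.inr hz]
  · rintro (h | h)
    exacts [⟨a, (hp a).2 (Or.inl rfl), h⟩, ⟨b, (hp b).2 (Or.inr rfl), h⟩]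

theorem exists_singleton (Z : ZFModel E D) (a : X) : ∃ c, ∀ z, E z c ↔ z = a := by
  obtain ⟨p, hp⟩ := Z.pairing a a
  exact ⟨p, fun z => by rw [hp z, or_self]⟩

theorem exists_insert (Z : ZFModel E D) (a x : X) : ∃ c, ∀ z, E z c ↔ E z a ∨ z = x := by
  obtain ⟨s, hs⟩ := Z.exists_singleton x
  obtain ⟨c, hc⟩ := Z.exists_union₂ a s
  exact ⟨c, fun z => by rw [hc, hs]⟩

theorem exists_pair (Z : ZFModel E D) (x y : X) : ∃ p, IsPair E p x y :=
  exists_isPair Z.ext Z.pairing x y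

theorem pair_unique (Z : ZFModel E D) {p q x y : X} (hp : IsPair E p x y) (hq : IsPair E q x y) :
    p = q := isPair_unique Z.ext hp hq

theorem pair_inj (Z : ZFModel E D) {p x y x' y' : X} (h : IsPair E p x y)
    (h' : IsPair E p x' y') : x = x' ∧ y = y' := isPair_inj Z.pairing h h'

section Ordinals

theorem ord_of_mem {x y : X} (hx : IsOrd E x) (hy : E y x) : IsOrd E y :=
  ⟨hx.2 y hy, fun z hz => hx.2 z (hx.1 y hy z hz)⟩

theorem ord_trans {x y z : X} (hx : IsOrd E x) (hy : E y x) (hz : E z y) : E z x :=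
  hx.1 y hy z hz

/-- Take `α` minimal among the ordinals incomparable with some ordinal, and `β` minimal among those
incomparable with `α`. Minimality makes `α` and `β` have the same elements, so they are equal after
all. -/
theorem ord_trichotomy (Z : ZFModel E D) {α β : X} (hα : IsOrd E α) (hβ : IsOrd E β) :
    E α β ∨ α = β ∨ E β α := by
  by_contra hne
  obtain ⟨α, ⟨hα, β, hβ, hne⟩, hminα⟩ := Z.foundation
    (fun α => IsOrd E α ∧ ∃ β, IsOrd E β ∧ ¬ (E α β ∨ α = β ∨ E β α)) inferInstance
    ⟨α, hα, β, hβ, hne⟩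
  obtain ⟨β, ⟨hβ, hne⟩, hminβ⟩ := Z.foundation
    (fun β => IsOrd E β ∧ ¬ (E α β ∨ α = β ∨ E β α)) inferInstance ⟨β, hβ, hne⟩
  refine hne (Or.inr (Or.inl (Z.ext _ _ fun z => ⟨fun hz => ?_, fun hz => ?_⟩)))
  · by_contra hzβ
    refine hminα z hz ⟨ord_of_mem hα hz, β, hβ, ?_⟩
    rintro (h | rfl | h)
    · exact hzβ h
    · exact hne (Or.inr (Or.inr hz))
    · exact hne (Or.inr (Or.inr (ord_trans hα hz h)))
  · by_contra hzα
    refine hminβ z hz ⟨ord_of_mem hβ hz, ?_⟩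
    rintro (h | rfl | h)
    · exact hne (Or.inl (ord_trans hβ hz h))
    · exact hne (Or.inl hz)
    · exact hzα h

theorem ord_succ (Z : ZFModel E D) {α : X} (hα : IsOrd E α) :
    ∃ σ, IsOrd E σ ∧ ∀ z, E z σ ↔ E z α ∨ z = α := by
  obtain ⟨σ, hσ⟩ := Z.exists_insert α α
  refine ⟨σ, ⟨fun x hx y hy => (hσ y).2 ?_, fun x hx => ?_⟩, hσ⟩
  · rcases (hσ x).1 hx with h | rfl
    exacts [Or.inl (ord_trans hα h hy), Or.inl hy]
  · rcases (hσ x).1 hx with h | rfl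
    exacts [hα.2 x h, hα.1]

theorem ord_sup (Z : ZFModel E D) (a : X) (ha : ∀ α, E α a → IsOrd E α) :
    ∃ σ, IsOrd E σ ∧ ∀ α, E α a → E α σ := by
  obtain ⟨u, hu⟩ := Z.union a
  have hu' : IsOrd E u := by
    refine ⟨fun x hx y hy => ?_, fun x hx => ?_⟩
    · obtain ⟨α, hα, hxα⟩ := (hu x).1 hx
      exact (hu y).2 ⟨α, hα, ord_trans (ha α hα) hxα hy⟩
    · obtain ⟨α, hα, hxα⟩ := (hu x).1 hx
      exact (ha α hα).2 x hxα
  obtain ⟨σ, hσ, hmem⟩ := Z.ord_succ hu'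
  refine ⟨σ, hσ, fun α hα => (hmem α).2 ?_⟩
  rcases Z.ord_trichotomy (ha α hα) hu' with h | h | h
  · exact Or.inl h
  · exact Or.inr h
  · exact absurd ((hu u).2 ⟨α, hα, h⟩) (Z.irrefl u)

theorem ord_sup₂ (Z : ZFModel E D) {α β : X} (hα : IsOrd E α) (hβ : IsOrd E β) :
    ∃ σ, IsOrd E σ ∧ E α σ ∧ E β σ := by
  obtain ⟨p, hp⟩ := Z.pairing α β
  obtain ⟨σ, hσ, h⟩ := Z.ord_sup p fun x hx => by
    rcases (hp x).1 hx with rfl | rfl <;> assumption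
  exact ⟨σ, hσ, h α ((hp α).2 (Or.inl rfl)), h β ((hp β).2 (Or.inr rfl))⟩

theorem ord_empty {e : X} (he : ∀ z, ¬ E z e) : IsOrd E e :=
  ⟨fun x hx => (he x hx).elim, fun x hx => (he x hx).elim⟩

theorem ord_min (Z : ZFModel E D) (P : X → Prop) (hP : IsDef D fun _ v => P (v 0))
    (h : ∃ α, IsOrd E α ∧ P α) : ∃ α, IsOrd E α ∧ P α ∧ ∀ β, E β α → ¬ P β := by
  obtain ⟨α, ⟨h1, h2⟩, h3⟩ := Z.foundation (fun α => IsOrd E α ∧ P α) inferInstance h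
  exact ⟨α, h1, h2, fun β hβ hP => h3 β hβ ⟨ord_of_mem h1 hβ, hP⟩⟩

end Ordinals

/-! ### Recursion along set-like well-founded relations -/

section Recursion

/-- The hypotheses of the recursion theorem on the relation: it is definable, transitive, set-like
and well-founded for definable classes. -/
structure GoodRel (D : DefSystem (fun _ : Unit => E)) (R : X → X → Prop) : Prop where
  isDef : IsDef D fun _ v => R (v 0) (v 1)
  trans : ∀ x y z, R x y → R y z → R x z
  setLike : ∀ x, ∃ s, ∀ z, E z s ↔ R z x
  wf : ∀ P : X → Prop, IsDef D (fun _ v => P (v 0)) → (∃ x, P x) → ∃ x, P x ∧ ∀ y, R y x → ¬ P y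

theorem GoodRel.induction {R : X → X → Prop} (hR : GoodRel D R) (P : X → Prop)
    (hP : IsDef D fun _ v => P (v 0)) (h : ∀ x, (∀ y, R y x → P y) → P x) (x : X) : P x := by
  by_contra hx
  obtain ⟨y, hy, hmin⟩ := hR.wf (fun x => ¬ P x) inferInstance ⟨x, hx⟩
  exact hy (h y fun z hz => not_not.1 (hmin z hz))

theorem goodRel_ordLt (Z : ZFModel E D) : GoodRel D (OrdLt E) where
  isDef := inferInstance
  trans _ _ _ h h' := ⟨h'.1, ord_trans h'.1 h'.2 h.2⟩
  setLike x := by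
    by_cases hx : IsOrd E x
    · exact ⟨x, fun z => ⟨fun h => ⟨hx, h⟩, fun h => h.2⟩⟩
    · obtain ⟨e, he⟩ := Z.exists_empty
      exact ⟨e, fun z => ⟨fun h => (he z h).elim, fun h => (hx h.1).elim⟩⟩
  wf P hP h := by
    obtain ⟨x, hx, hmin⟩ := Z.foundation P hP h
    exact ⟨x, hx, fun y hy => hmin y hy.2⟩

variable {R : X → X → Prop} {Φ : X → X → X → Prop}

/-- The restriction `g` that comes with an attempt is itself an attempt below `z`, because `R` is
transitive. -/
theorem _root_.ClassTheory.IsAttempt.rec_of_app (hR : GoodRel D R) {x f z y : X} (hf : IsAttempt E R Φ x f)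
    (hz : R z x) (hy : App E f z y) : Rec E R Φ z y := by
  obtain ⟨y', g, h1, h2, h3, h4⟩ := hf.2 z hz
  obtain rfl := h2 y hy
  refine ⟨g, ⟨fun q hq => ((h3 q).1 hq).2, fun w hw => ?_⟩, h4⟩
  obtain ⟨a, k, k1, k2, k3, k4⟩ := hf.2 w (hR.trans _ _ _ hw hz)
  obtain ⟨p, hp, hpw⟩ := k1
  refine ⟨a, k, ⟨p, (h3 p).2 ⟨hp, w, a, hw, hpw⟩, hpw⟩, ?_, fun q => (k3 q).trans ?_, k4⟩
  · rintro a' ⟨p', hp', h⟩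
    exact k2 a' ⟨p', ((h3 p').1 hp').1, h⟩
  · constructor
    · rintro ⟨hq, c, d, hc, hcd⟩
      exact ⟨(h3 q).2 ⟨hq, c, d, hR.trans _ _ _ hc hw, hcd⟩, c, d, hc, hcd⟩
    · rintro ⟨hq, h⟩
      exact ⟨((h3 q).1 hq).1, h⟩

/-- The hypothesis of the recursion theorem on the rule: it is definable and, applied to functions
defined on the predecessors of a point, it defines a set. -/
structure GoodRule (D : DefSystem (fun _ : Unit => E)) (R : X → X → Prop)
    (Φ : X → X → X → Prop) : Prop where
  isDef : IsDef D fun _ v => Φ (v 0) (v 1) (v 2)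
  total : ∀ x f, (∀ q, E q f → ∃ z y, R z x ∧ IsPair E q z y) →
    (∀ z, R z x → ∃ y, App E f z y) → (∀ z y y', App E f z y → App E f z y' → y = y') →
    ∃ y, ∀ t, E t y ↔ Φ x f t

theorem isDef_rec' (hR : GoodRel D R) (hΦ : GoodRule D R Φ) :
    ∀ {s t : Unit → (ℕ → X) → X} [IsTm D s] [IsTm D t],
      IsDef D fun i v => Rec E R Φ (s i v) (t i v) :=
  @fun s t _ _ => by
    have h1 := hR.isDef
    have h2 := hΦ.isDef
    exact isDef_rec (E := fun _ : Unit => E) (R := fun _ _ => R) (Φ := fun _ _ => Φ) (s := s)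
      (h1.subst₂ (R := fun _ => R) (isTm_var 1) (isTm_var 2))
      (h2.subst₃ (R := fun _ => Φ) (isTm_var 1) (isTm_var 2) (isTm_var 3))

/-- By induction along `R`, two attempts below `x` have the same values, hence are the same set of
pairs. -/
theorem rec_unique (Z : ZFModel E D) (hR : GoodRel D R) (hΦ : GoodRule D R Φ) :
    ∀ {x y y'}, Rec E R Φ x y → Rec E R Φ x y' → y = y' := by
  have hdef := @isDef_rec' _ _ _ _ _ _ hR hΦ
  intro x y y'
  refine hR.induction (fun x => ∀ y y', Rec E R Φ x y → Rec E R Φ x y' → y = y')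
    inferInstance ?_ x y y'
  rintro x ih y y' ⟨f, hf, hy⟩ ⟨f', hf', hy'⟩
  have key : ∀ f f', IsAttempt E R Φ x f → IsAttempt E R Φ x f' → ∀ q, E q f → E q f' := by
    intro f f' hf hf' q hq
    obtain ⟨z, a, hz, hqa⟩ := hf.1 q hq
    obtain ⟨a', -, ⟨p, hp, hpa⟩, -⟩ := hf'.2 z hz
    obtain rfl := ih z hz a a' (hf.rec_of_app hR hz ⟨q, hq, hqa⟩)
      (hf'.rec_of_app hR hz ⟨p, hp, hpa⟩)
    rwa [Z.pair_unique hqa hpa]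
  obtain rfl := Z.ext f f' fun q => ⟨key _ _ hf hf' q, key _ _ hf' hf q⟩
  exact Z.ext _ _ fun t => (hy t).trans (hy' t).symm

/-- Values at the predecessors are unique by `rec_unique`, so replacement collects them into a set
`f` of pairs, and `f` is an attempt. -/
theorem rec_exists (Z : ZFModel E D) (hR : GoodRel D R) (hΦ : GoodRule D R Φ) (x : X) :
    ∃ y, Rec E R Φ x y := by
  have hdef := @isDef_rec' _ _ _ _ _ _ hR hΦ
  refine hR.induction (fun x => ∃ y, Rec E R Φ x y) inferInstance ?_ x
  intro x ih
  obtain ⟨s, hs⟩ := hR.setLike x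
  obtain ⟨f, hf⟩ := Z.replacement (fun z q => ∃ w, Rec E R Φ z w ∧ IsPair E q z w) inferInstance
    (by
      rintro z q q' ⟨w, hw, hq⟩ ⟨w', hw', hq'⟩
      obtain rfl := Z.rec_unique hR hΦ hw hw'
      exact Z.pair_unique hq hq') s
  have happ : ∀ z w, App E f z w ↔ R z x ∧ Rec E R Φ z w := by
    intro z w
    constructor
    · rintro ⟨q, hq, hqw⟩
      obtain ⟨z', hz', w', hw', hq'⟩ := (hf q).1 hq
      obtain ⟨rfl, rfl⟩ := Z.pair_inj hqw hq'
      exact ⟨(hs z).1 hz', hw'⟩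
    · rintro ⟨hz, hw⟩
      obtain ⟨q, hq⟩ := Z.exists_pair z w
      exact ⟨q, (hf q).2 ⟨z, (hs z).2 hz, w, hw, hq⟩, hq⟩
  have hdom : ∀ q, E q f → ∃ z y, R z x ∧ IsPair E q z y := by
    intro q hq
    obtain ⟨z, hz, w, -, h⟩ := (hf q).1 hq
    exact ⟨z, w, (hs z).1 hz, h⟩
  have hatt : IsAttempt E R Φ x f := by
    refine ⟨hdom, fun z hz => ?_⟩
    obtain ⟨y, hy⟩ := ih z hz
    obtain ⟨g, hg, hgy⟩ := id hy
    replace hg : IsAttempt E R Φ z g := hg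
    refine ⟨y, g, (happ z y).2 ⟨hz, hy⟩, fun y' hy' => Z.rec_unique hR hΦ ((happ z y').1 hy').2 hy,
      fun q => ⟨fun hq => ?_, ?_⟩, hgy⟩
    · obtain ⟨w, a, hw, hqa⟩ := hg.1 q hq
      obtain ⟨q', hq', hqa'⟩ := (happ w a).2 ⟨hR.trans _ _ _ hw hz,
        hg.rec_of_app hR hw ⟨q, hq, hqa⟩⟩
      exact ⟨Z.pair_unique hqa' hqa ▸ hq', w, a, hw, hqa⟩
    · rintro ⟨hq, w, a, hw, hqa⟩
      obtain ⟨a', -, ⟨q', hq', hqa'⟩, -⟩ := hg.2 w hw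
      obtain rfl := Z.rec_unique hR hΦ ((happ w a).1 ⟨q, hq, hqa⟩).2
        (hg.rec_of_app hR hw ⟨q', hq', hqa'⟩)
      exact Z.pair_unique hqa' hqa ▸ hq'
  obtain ⟨y, hy⟩ := hΦ.total x f hdom
    (fun z hz => (ih z hz).imp fun y hy => (happ z y).2 ⟨hz, hy⟩)
    (fun z y y' h h' => Z.rec_unique hR hΦ ((happ z y).1 h).2 ((happ z y').1 h').2)
  exact ⟨y, f, hatt, hy⟩

/-- The recursion equation in usable form: attempts disappear, and the rule is applied to the true
restriction of the recursive function. -/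
theorem rec_eq (Z : ZFModel E D) (hR : GoodRel D R) (hΦ : GoodRule D R Φ) {x y : X}
    (h : Rec E R Φ x y) :
    ∃ f, (∀ z w, App E f z w ↔ R z x ∧ Rec E R Φ z w) ∧ ∀ t, E t y ↔ Φ x f t := by
  obtain ⟨f, hf, hy⟩ := h
  refine ⟨f, fun z w => ⟨fun h => ?_, fun h => ?_⟩, hy⟩
  · obtain ⟨q, hq, hqw⟩ := id h
    obtain ⟨z', w', hz, hq'⟩ := hf.1 q hq
    obtain ⟨rfl, rfl⟩ := Z.pair_inj hqw hq'
    exact ⟨hz, hf.rec_of_app hR hz h⟩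
  · obtain ⟨w', -, h1, -⟩ := hf.2 z h.1
    rwa [Z.rec_unique hR hΦ h.2 (hf.rec_of_app hR h.1 h1)]

end Recursion

end ZFModel

/-! ### Formulas for the hierarchy, closures, collapses and ordinal codes -/

section

variable {X : Type v}

/-- The recursive rule of the cumulative hierarchy. -/
def VRule (E : X → X → Prop) (_α f t : X) : Prop := ∃ β s, App E f β s ∧ ∀ z, E z t → E z s

/-- `v = V_α`. -/
def IsV (E : X → X → Prop) (α v : X) : Prop := IsOrd E α ∧ Rec E (OrdLt E) (VRule E) α v

/-- `t` is a transitive set. -/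
def IsTransSet (E : X → X → Prop) (t : X) : Prop := ∀ x, E x t → ∀ y, E y x → E y t

/-- `t` is the least transitive set with the element `a`. -/
def IsTC (E : X → X → Prop) (a t : X) : Prop :=
  IsTransSet E t ∧ E a t ∧ ∀ t', IsTransSet E t' → E a t' → ∀ x, E x t → E x t'

/-- The recursive rule of the Mostowski collapse. -/
def ColRule (E : X → X → Prop) (_x f t : X) : Prop := ∃ z, App E f z t

/-- `p = (γ, α)` for ordinals `α ≤ γ`. -/
def OrdPair (E : X → X → Prop) (p γ α : X) : Prop :=
  IsOrd E γ ∧ IsOrd E α ∧ (E α γ ∨ α = γ) ∧ IsPair E p γ α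

/-- The lexicographic order of the pairs `(γ, α)` of ordinals `α ≤ γ`. -/
def OrdLex (E : X → X → Prop) (p q : X) : Prop :=
  ∃ γ α δ β, OrdPair E p γ α ∧ OrdPair E q δ β ∧ (E γ δ ∨ γ = δ ∧ E α β)

/-- `ξ` is the ordinal that codes the pair `(γ, α)`, where `α ≤ γ`. -/
def OrdCode (E : X → X → Prop) (γ α ξ : X) : Prop :=
  ∃ p, OrdPair E p γ α ∧ Rec E (OrdLex E) (ColRule E) p ξ

end

section

variable {ι : Type u} {X : ι → Type v} {E : ∀ i, X i → X i → Prop} {D : DefSystem E}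
variable {s t r q : ∀ i, (ℕ → X i) → X i}

theorem isDef_vRule_base : IsDef D (fun i v => VRule (E i) (v 0) (v 1) (v 2)) := by
  unfold VRule; infer_instance

instance [hs : IsTm D s] [ht : IsTm D t] [hr : IsTm D r] :
    IsDef D (fun i v => VRule (E i) (s i v) (t i v) (r i v)) :=
  isDef_vRule_base.subst₃ hs ht hr

theorem isDef_isV_base : IsDef D (fun i v => IsV (E i) (v 0) (v 1)) := by
  have := isDef_rec (D := D) (R := fun i _ => OrdLt (E i)) (Φ := fun i _ => VRule (E i))
    (s := fun _ v => v 0) (t := fun _ v => v 0) (r := fun _ v => v 1) inferInstance inferInstance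
  unfold IsV; infer_instance

instance [hs : IsTm D s] [ht : IsTm D t] : IsDef D (fun i v => IsV (E i) (s i v) (t i v)) :=
  isDef_isV_base.subst₂ hs ht

theorem isDef_isTransSet_base : IsDef D (fun i v => IsTransSet (E i) (v 0)) := by
  unfold IsTransSet; infer_instance

instance [hs : IsTm D s] : IsDef D (fun i v => IsTransSet (E i) (s i v)) :=
  isDef_isTransSet_base.subst₁ hs

theorem isDef_isTC_base : IsDef D (fun i v => IsTC (E i) (v 0) (v 1)) := by
  unfold IsTC; infer_instance

instance [hs : IsTm D s] [ht : IsTm D t] : IsDef D (fun i v => IsTC (E i) (s i v) (t i v)) :=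
  isDef_isTC_base.subst₂ hs ht

theorem isDef_colRule_base : IsDef D (fun i v => ColRule (E i) (v 0) (v 1) (v 2)) := by
  unfold ColRule; infer_instance

instance [hs : IsTm D s] [ht : IsTm D t] [hr : IsTm D r] :
    IsDef D (fun i v => ColRule (E i) (s i v) (t i v) (r i v)) :=
  isDef_colRule_base.subst₃ hs ht hr

theorem isDef_ordPair_base : IsDef D (fun i v => OrdPair (E i) (v 0) (v 1) (v 2)) := by
  unfold OrdPair; infer_instance

instance [hs : IsTm D s] [ht : IsTm D t] [hr : IsTm D r] :
    IsDef D (fun i v => OrdPair (E i) (s i v) (t i v) (r i v)) :=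
  isDef_ordPair_base.subst₃ hs ht hr

theorem isDef_ordLex_base : IsDef D (fun i v => OrdLex (E i) (v 0) (v 1)) := by
  unfold OrdLex; infer_instance

instance [hs : IsTm D s] [ht : IsTm D t] : IsDef D (fun i v => OrdLex (E i) (s i v) (t i v)) :=
  isDef_ordLex_base.subst₂ hs ht

theorem isDef_ordCode_base : IsDef D (fun i v => OrdCode (E i) (v 0) (v 1) (v 2)) := by
  have : ∀ {s t : ∀ i, (ℕ → X i) → X i} [IsTm D s] [IsTm D t],
      IsDef D fun i v => Rec (E i) (OrdLex (E i)) (ColRule (E i)) (s i v) (t i v) :=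
    @fun s t _ _ => isDef_rec (D := D) (R := fun i _ => OrdLex (E i))
      (Φ := fun i _ => ColRule (E i)) (s := s) inferInstance inferInstance
  unfold OrdCode; infer_instance

instance [hs : IsTm D s] [ht : IsTm D t] [hr : IsTm D r] :
    IsDef D (fun i v => OrdCode (E i) (s i v) (t i v) (r i v)) :=
  isDef_ordCode_base.subst₃ hs ht hr

end

namespace ZFModel

variable {X : Type v} {E : X → X → Prop} {D : DefSystem (fun _ : Unit => E)} [HasParams D]

theorem exists_image (Z : ZFModel E D) {R : X → X → Prop} (hR : GoodRel D R) {x f : X}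
    (hdom : ∀ q, E q f → ∃ z y, R z x ∧ IsPair E q z y)
    (huniq : ∀ z y y', App E f z y → App E f z y' → y = y') :
    ∃ c, ∀ y, E y c ↔ ∃ z, App E f z y := by
  obtain ⟨s, hs⟩ := hR.setLike x
  obtain ⟨c, hc⟩ := Z.replacement (fun z y => App E f z y) inferInstance huniq s
  refine ⟨c, fun y => (hc y).trans ⟨fun ⟨z, _, h⟩ => ⟨z, h⟩, fun ⟨z, h⟩ => ⟨z, ?_, h⟩⟩⟩
  obtain ⟨q, hq, hzy⟩ := h
  obtain ⟨z', y', hz', hq'⟩ := hdom q hq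
  obtain ⟨rfl, rfl⟩ := Z.pair_inj hzy hq'
  exact (hs z).2 hz'

/-! ### The cumulative hierarchy and collection -/

section Hierarchy

theorem goodRule_vRule (Z : ZFModel E D) : GoodRule D (OrdLt E) (VRule E) where
  isDef := inferInstance
  total x f hdom _ huniq := by
    obtain ⟨c, hc⟩ := Z.exists_image Z.goodRel_ordLt hdom huniq
    obtain ⟨u, hu⟩ := Z.union c
    obtain ⟨p, hp⟩ := Z.powerset u
    obtain ⟨y, hy⟩ := Z.separation (fun t => VRule E x f t) inferInstance p
    refine ⟨y, fun t => (hy t).trans ⟨fun h => h.2, fun h => ⟨(hp t).2 fun z hz => ?_, h⟩⟩⟩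
    obtain ⟨β, s, hs, hts⟩ := h
    exact (hu z).2 ⟨s, (hc s).2 ⟨β, hs⟩, hts z hz⟩

theorem exists_isV (Z : ZFModel E D) {α : X} (hα : IsOrd E α) : ∃ v, IsV E α v :=
  (Z.rec_exists Z.goodRel_ordLt Z.goodRule_vRule α).imp fun _ h => ⟨hα, h⟩

theorem isV_unique (Z : ZFModel E D) {α v v' : X} (h : IsV E α v) (h' : IsV E α v') : v = v' :=
  Z.rec_unique Z.goodRel_ordLt Z.goodRule_vRule h.2 h'.2

theorem mem_isV (Z : ZFModel E D) {α v : X} (h : IsV E α v) (t : X) :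
    E t v ↔ ∃ β s, E β α ∧ IsV E β s ∧ ∀ z, E z t → E z s := by
  obtain ⟨f, hf, hv⟩ := Z.rec_eq Z.goodRel_ordLt Z.goodRule_vRule h.2
  refine (hv t).trans (exists_congr fun β => exists_congr fun s => ?_)
  rw [hf]
  exact ⟨fun ⟨⟨h1, h2⟩, h3⟩ => ⟨h1.2, ⟨ord_of_mem h1.1 h1.2, h2⟩, h3⟩,
    fun ⟨h1, h2, h3⟩ => ⟨⟨⟨h.1, h1⟩, h2.2⟩, h3⟩⟩

theorem isV_mono (Z : ZFModel E D) {α β v w : X} (h : IsV E α v) (h' : IsV E β w) (hαβ : E α β)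
    {t : X} (ht : E t v) : E t w := by
  obtain ⟨γ, s, hγ, hs, hts⟩ := (Z.mem_isV h t).1 ht
  exact (Z.mem_isV h' t).2 ⟨γ, s, ord_trans h'.1 hαβ hγ, hs, hts⟩

theorem isV_trans (Z : ZFModel E D) {α v : X} (h : IsV E α v) : IsTransSet E v := by
  intro x hx y hy
  obtain ⟨γ, s, hγ, hs, hts⟩ := (Z.mem_isV h x).1 hx
  exact Z.isV_mono hs h hγ (hts y hy)

/-- Every set of elements of the hierarchy is included in some `V_σ`. -/
theorem exists_isV_superset_of (Z : ZFModel E D) (x : X)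
    (h : ∀ y, E y x → ∃ α v, IsV E α v ∧ E y v) :
    ∃ σ v, IsV E σ v ∧ ∀ y, E y x → E y v := by
  have hdef : IsDef D (fun (_ : Unit) v => IsOrd E (v 1) ∧ (∃ w, IsV E (v 1) w ∧ E (v 0) w) ∧
      ∀ β, E β (v 1) → ¬ ∃ w, IsV E β w ∧ E (v 0) w) := inferInstance
  -- Replacement applies to the map that sends `y` to the least `α` with `y ∈ V_α`.
  obtain ⟨a, ha⟩ := Z.replacement (fun y α => IsOrd E α ∧ (∃ w, IsV E α w ∧ E y w) ∧
      ∀ β, E β α → ¬ ∃ w, IsV E β w ∧ E y w) hdef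
    (by
      rintro y α α' ⟨h1, h2, h3⟩ ⟨h1', h2', h3'⟩
      rcases Z.ord_trichotomy h1 h1' with h | h | h
      exacts [(h3' _ h h2).elim, h, (h3 _ h h2').elim]) x
  obtain ⟨σ, hσ, hmem⟩ := Z.ord_sup a fun α hα => by
    obtain ⟨y, -, h, -⟩ := (ha α).1 hα
    exact h
  obtain ⟨v, hv⟩ := Z.exists_isV hσ
  refine ⟨σ, v, hv, fun y hy => ?_⟩
  obtain ⟨α, h1, ⟨w, hw, hyw⟩, h3⟩ := Z.ord_min (fun α => ∃ w, IsV E α w ∧ E y w) inferInstance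
    (by obtain ⟨α, w, hw, hyw⟩ := h y hy; exact ⟨α, hw.1, w, hw, hyw⟩)
  exact Z.isV_mono hw hv (hmem α ((ha α).2 ⟨y, hy, h1, ⟨w, hw, hyw⟩, h3⟩)) hyw

theorem isV_succ (Z : ZFModel E D) {σ v : X} (hv : IsV E σ v) :
    ∃ τ w, IsV E τ w ∧ ∀ x, E x w ↔ ∀ y, E y x → E y v := by
  obtain ⟨τ, hτ, hmem⟩ := Z.ord_succ hv.1
  obtain ⟨w, hw⟩ := Z.exists_isV hτ
  refine ⟨τ, w, hw, fun x => (Z.mem_isV hw x).trans ⟨?_, fun h => ⟨σ, v, (hmem σ).2 (Or.inr rfl), hv, h⟩⟩⟩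
  rintro ⟨β, s, hβ, hs, hxs⟩ y hy
  rcases (hmem β).1 hβ with h | rfl
  · exact Z.isV_mono hs hv h (hxs y hy)
  · exact Z.isV_unique hs hv ▸ hxs y hy

/-- By `∈`-induction: if the elements of `x` lie in the hierarchy, they lie in a single `V_σ`, so
`x` lies in the next level. -/
theorem exists_isV_mem (Z : ZFModel E D) (x : X) : ∃ α v, IsV E α v ∧ E x v := by
  refine Z.induction (fun x => ∃ α v, IsV E α v ∧ E x v) inferInstance (fun x ih => ?_) x
  obtain ⟨σ, v, hv, h⟩ := Z.exists_isV_superset_of x ih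
  obtain ⟨τ, w, hw, hmem⟩ := Z.isV_succ hv
  exact ⟨τ, w, hw, (hmem x).2 h⟩

theorem exists_isV_superset (Z : ZFModel E D) (x : X) :
    ∃ σ v, IsV E σ v ∧ ∀ y, E y x → E y v :=
  Z.exists_isV_superset_of x fun y _ => Z.exists_isV_mem y

/-- Scott's trick: each `x` is sent to the least level that contains a witness, and these levels are
bounded by replacement. -/
theorem collection (Z : ZFModel E D) (P : X → X → Prop)
    (hP : IsDef D fun _ v => P (v 0) (v 1)) (a : X) :
    ∃ c, ∀ x, E x a → (∃ y, P x y) → ∃ y, E y c ∧ P x y := by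
  have hP' : ∀ {s t : Unit → (ℕ → X) → X} [IsTm D s] [IsTm D t],
      IsDef D fun i v => P (s i v) (t i v) := hP.subst₂ (R := fun _ => P) ‹_› ‹_›
  have hdef : IsDef D (fun (_ : Unit) v => IsOrd E (v 1) ∧
      (∃ w y, IsV E (v 1) w ∧ E y w ∧ P (v 0) y) ∧
      ∀ β, E β (v 1) → ¬ ∃ w y, IsV E β w ∧ E y w ∧ P (v 0) y) := inferInstance
  obtain ⟨r, hr⟩ := Z.replacement (fun x α => IsOrd E α ∧ (∃ w y, IsV E α w ∧ E y w ∧ P x y) ∧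
      ∀ β, E β α → ¬ ∃ w y, IsV E β w ∧ E y w ∧ P x y) hdef
    (by
      rintro y α α' ⟨h1, h2, h3⟩ ⟨h1', h2', h3'⟩
      rcases Z.ord_trichotomy h1 h1' with h | h | h
      exacts [(h3' _ h h2).elim, h, (h3 _ h h2').elim]) a
  obtain ⟨σ, hσ, hmem⟩ := Z.ord_sup r fun α hα => by
    obtain ⟨y, -, h, -⟩ := (hr α).1 hα
    exact h
  obtain ⟨v, hv⟩ := Z.exists_isV hσ
  refine ⟨v, fun x hx ⟨y, hxy⟩ => ?_⟩
  obtain ⟨α, h1, ⟨w, y, hw, hyw, hxy⟩, h3⟩ := Z.ord_min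
    (fun α => ∃ w y, IsV E α w ∧ E y w ∧ P x y) inferInstance
    (by obtain ⟨α, w, hw, hyw⟩ := Z.exists_isV_mem y; exact ⟨α, hw.1, w, y, hw, hyw, hxy⟩)
  exact ⟨y, Z.isV_mono hw hv (hmem α ((hr α).2 ⟨x, hx, h1, ⟨w, y, hw, hyw, hxy⟩, h3⟩)) hyw, hxy⟩

/-- Collection for a relation between finite tuples and sets. -/
theorem collection_tuple (Z : ZFModel E D) (a : X) (n : ℕ) : ∀ (P : (Fin n → X) → X → Prop),
    IsDef D (fun _ w => P (fun i => w (i + 1)) (w 0)) →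
    ∃ c, ∀ v : Fin n → X, (∀ i, E (v i) a) → (∃ x, P v x) → ∃ x, E x c ∧ P v x := by
  induction n with
  | zero =>
    intro P _
    by_cases h : ∃ x, P Fin.elim0 x
    · obtain ⟨x, hx⟩ := h
      obtain ⟨c, hc⟩ := Z.exists_singleton x
      exact ⟨c, fun v _ _ => ⟨x, (hc x).2 rfl, by rwa [Subsingleton.elim v Fin.elim0]⟩⟩
    · exact ⟨a, fun v _ hv => (h (by rwa [Subsingleton.elim v Fin.elim0] at hv)).elim⟩
  | succ n ih =>
    intro P hP
    have hP' : ∀ t : ℕ → Unit → (ℕ → X) → X, (∀ k, IsTm D (t k)) →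
        IsDef D (fun i w => P (Fin.cons (t 1 i w) fun k => t (k + 2) i w) (t 0 i w)) := by
      intro t ht
      refine IsDef.congr ⟨D.subst (t := t) hP.out fun k => (ht k).out⟩ fun i v => ?_
      rw [iff_iff_eq]
      congr 1
      funext k
      refine Fin.cases ?_ (fun k => ?_) k <;> simp
    have step (y : X) := ih (fun v x => P (Fin.cons y v) x) (hP' (fun
      | 0 => fun _ w => w 0
      | 1 => fun _ _ => y
      | k + 2 => fun _ w => w (k + 1)) fun
      | 0 => inferInstance
      | 1 => inferInstance
      | k + 2 => inferInstance)
    have hdef : IsDef D fun (_ : Unit) w => ∀ v : Fin n → X, (∀ i, E (v i) a) →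
        (∃ x, P (Fin.cons (w 0) v) x) → ∃ x, E x (w 1) ∧ P (Fin.cons (w 0) v) x := by
      have h1 : IsDef D fun (_ : Unit) w => ∀ i : Fin n, E (w i) a :=
        isDef_forall_fin fun i => inferInstance
      have h2 : IsDef D fun (_ : Unit) w =>
          P (Fin.cons (w (n + 1)) fun k => w (k + 1)) (w 0) := hP' (fun
        | 0 => fun _ w => w 0
        | 1 => fun _ w => w (n + 1)
        | k + 2 => fun _ w => w (k + 1)) fun
        | 0 => inferInstance
        | 1 => inferInstance
        | k + 2 => inferInstance
      refine isDef_all_fin n ?_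
      have h3 : IsDef D fun (_ : Unit) w =>
          ∃ x, P (Fin.cons (w n) fun k => w k) x := by
        exact @isDef_ex _ _ _ _ _ h2
      have h4 : IsDef D fun (_ : Unit) w =>
          ∃ x, E x (w (n + 1)) ∧ P (Fin.cons (w n) fun k => w k) x := by
        refine @isDef_ex _ _ _ _ _ ?_
        exact @isDef_and _ _ _ _ _ _ inferInstance h2
      have : IsDef D fun (_ : Unit) w => (∀ i : Fin n, E (w i) a) →
        (∃ x, P (Fin.cons (w n) fun k => w k) x) →
        ∃ x, E x (w (n + 1)) ∧ P (Fin.cons (w n) fun k => w k) x := inferInstance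
      refine this.congr fun _ v => ?_
      simp only [Nat.zero_add, Nat.add_comm 1 n]
    -- The bound for the remaining coordinates depends on the first coordinate `y`. Collection
    -- gathers bounds for all `y` in `a`, and their union serves for all tuples.
    obtain ⟨C, hC⟩ := Z.collection (fun y c => ∀ v : Fin n → X, (∀ i, E (v i) a) →
      (∃ x, P (Fin.cons y v) x) → ∃ x, E x c ∧ P (Fin.cons y v) x) hdef a
    obtain ⟨c, hc⟩ := Z.union C
    refine ⟨c, fun v hv hx => ?_⟩
    rw [← Fin.cons_self_tail v] at hx ⊢
    obtain ⟨c', hc', h⟩ := hC (v 0) (hv 0) (step (v 0))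
    obtain ⟨x, hx, h⟩ := h (Fin.tail v) (fun i => hv _) hx
    exact ⟨x, (hc x).2 ⟨c', hc', hx⟩, h⟩

end Hierarchy

/-! ### Transitive closures of sets -/

section TransitiveClosure

/-- The intersection of all transitive sets containing `a` is a set, being included in some
transitive `V_α` with `a ∈ V_α`. -/
theorem exists_isTC (Z : ZFModel E D) (a : X) : ∃ t, IsTC E a t := by
  obtain ⟨α, v, hv, ha⟩ := Z.exists_isV_mem a
  obtain ⟨t, ht⟩ := Z.separation (fun x => ∀ t', IsTransSet E t' → E a t' → E x t') inferInstance v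
  refine ⟨t, fun x hx y hy => ?_, (ht a).2 ⟨ha, fun _ _ h => h⟩, fun t' h h' x hx =>
    ((ht x).1 hx).2 t' h h'⟩
  obtain ⟨h1, h2⟩ := (ht x).1 hx
  exact (ht y).2 ⟨Z.isV_trans hv x h1 y hy, fun t' h h' => h x (h2 t' h h') y hy⟩

/-- The recursive description of the closure makes `∈`-induction on `a` possible. Its right-hand
side is transitive and contains `a`, so minimality of `t` applies. -/
theorem isTC_iff (Z : ZFModel E D) {a t : X} (h : IsTC E a t) (x : X) :
    E x t ↔ x = a ∨ ∃ z s, E z a ∧ IsTC E z s ∧ E x s := by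
  obtain ⟨u, hu⟩ := Z.separation (fun x => x = a ∨ ∃ z s, E z a ∧ IsTC E z s ∧ E x s)
    inferInstance t
  have hsub : ∀ x, (x = a ∨ ∃ z s, E z a ∧ IsTC E z s ∧ E x s) → E x t := by
    rintro x (rfl | ⟨z, s, hz, hs, hx⟩)
    · exact h.2.1
    · exact hs.2.2 t h.1 (h.1 a h.2.1 z hz) x hx
  refine ⟨fun hx => ((hu x).1 (h.2.2 u (fun x hx y hy => ?_) ?_ x hx)).2, hsub x⟩
  · have : y = a ∨ ∃ z s, E z a ∧ IsTC E z s ∧ E y s := by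
      rcases ((hu x).1 hx).2 with rfl | ⟨z, s, hz, hs, hxs⟩
      · obtain ⟨s, hs⟩ := Z.exists_isTC y
        exact Or.inr ⟨y, s, hy, hs, hs.2.1⟩
      · exact Or.inr ⟨z, s, hz, hs, hs.1 x hxs y hy⟩
    exact (hu y).2 ⟨hsub y this, this⟩
  · exact (hu a).2 ⟨h.2.1, Or.inl rfl⟩

end TransitiveClosure

/-! ### Mostowski collapse, and coding pairs of ordinals by ordinals -/

section Collapse

variable {R : X → X → Prop}

theorem goodRule_colRule (Z : ZFModel E D) (hR : GoodRel D R) : GoodRule D R (ColRule E) where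
  isDef := inferInstance
  total _ _ hdom _ huniq := Z.exists_image hR hdom huniq

theorem mem_col (Z : ZFModel E D) (hR : GoodRel D R) {x y : X} (h : Rec E R (ColRule E) x y)
    (t : X) : E t y ↔ ∃ z, R z x ∧ Rec E R (ColRule E) z t := by
  obtain ⟨f, hf, hy⟩ := Z.rec_eq hR (Z.goodRule_colRule hR) h
  exact (hy t).trans (exists_congr fun z => hf z t)

theorem isTransSet_col (Z : ZFModel E D) (hR : GoodRel D R) {x y : X}
    (h : Rec E R (ColRule E) x y) : IsTransSet E y := by
  intro t ht s hs
  obtain ⟨z, hz, hzt⟩ := (Z.mem_col hR h t).1 ht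
  obtain ⟨w, hw, hws⟩ := (Z.mem_col hR hzt s).1 hs
  exact (Z.mem_col hR h s).2 ⟨w, hR.trans _ _ _ hw hz, hws⟩

/-- Since `R` is transitive, every value of the collapse is a transitive set, and so are its
elements, which are values as well. Linearity of `R` is not needed. -/
theorem isOrd_col (Z : ZFModel E D) (hR : GoodRel D R) {x y : X}
    (h : Rec E R (ColRule E) x y) : IsOrd E y :=
  ⟨Z.isTransSet_col hR h, fun t ht => by
    obtain ⟨z, hz, hzt⟩ := (Z.mem_col hR h t).1 ht
    exact Z.isTransSet_col hR hzt⟩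

theorem col_inj (Z : ZFModel E D) (hR : GoodRel D R) {x x' y : X}
    (htri : R x x' ∨ x = x' ∨ R x' x)
    (h : Rec E R (ColRule E) x y) (h' : Rec E R (ColRule E) x' y) : x = x' := by
  rcases htri with k | k | k
  · exact (Z.irrefl y ((Z.mem_col hR h' y).2 ⟨x, k, h⟩)).elim
  · exact k
  · exact (Z.irrefl y ((Z.mem_col hR h y).2 ⟨x', k, h'⟩)).elim

theorem ordPair_inj (Z : ZFModel E D) {p γ α γ' α' : X} (h : OrdPair E p γ α)
    (h' : OrdPair E p γ' α') : γ = γ' ∧ α = α' := Z.pair_inj h.2.2.2 h'.2.2.2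

theorem exists_product (Z : ZFModel E D) (a b : X) :
    ∃ c, ∀ p, E p c ↔ ∃ x y, E x a ∧ E y b ∧ IsPair E p x y := by
  obtain ⟨u, hu⟩ := Z.exists_union₂ a b
  obtain ⟨p, hp⟩ := Z.powerset u
  obtain ⟨q, hq⟩ := Z.powerset p
  obtain ⟨c, hc⟩ := Z.separation (fun p => ∃ x y, E x a ∧ E y b ∧ IsPair E p x y) inferInstance q
  refine ⟨c, fun r => (hc r).trans ⟨fun h => h.2, fun h => ⟨(hq r).2 fun z hz => (hp z).2 fun t ht => ?_, h⟩⟩⟩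
  obtain ⟨x, y, hx, hy, hr⟩ := h
  refine (hu t).2 ?_
  rcases (hr z).1 hz with k | k <;> rcases (k t).1 ht with rfl | rfl <;> tauto

/-- The restriction `α ≤ γ` makes the lexicographic order set-like: everything below `(δ, β)` lies
in the square of the successor of `δ`. -/
theorem goodRel_ordLex (Z : ZFModel E D) : GoodRel D (OrdLex E) where
  isDef := inferInstance
  trans := by
    rintro x y z ⟨γ, α, δ, β, hx, hy, h⟩ ⟨δ', β', ε, ζ, hy', hz, h'⟩
    obtain ⟨rfl, rfl⟩ := Z.ordPair_inj hy hy'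
    refine ⟨γ, α, ε, ζ, hx, hz, ?_⟩
    rcases h with h | ⟨rfl, h⟩ <;> rcases h' with h' | ⟨rfl, h'⟩
    · exact Or.inl (ord_trans hz.1 h' h)
    · exact Or.inl h
    · exact Or.inl h'
    · exact Or.inr ⟨rfl, ord_trans hz.2.1 h' h⟩
  setLike := by
    intro q
    by_cases hq : ∃ δ β, OrdPair E q δ β
    · obtain ⟨δ, β, hq⟩ := hq
      obtain ⟨σ, hσ, hmem⟩ := Z.ord_succ hq.1
      obtain ⟨c, hc⟩ := Z.exists_product σ σ
      obtain ⟨d, hd⟩ := Z.separation (fun p => OrdLex E p q) inferInstance c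
      refine ⟨d, fun p => (hd p).trans ⟨fun h => h.2, fun h => ⟨(hc p).2 ?_, h⟩⟩⟩
      obtain ⟨γ, α, δ', β', hp, hq', h⟩ := h
      obtain ⟨rfl, rfl⟩ := Z.ordPair_inj hq hq'
      have hγ : E γ σ := (hmem γ).2 (h.imp id And.left)
      refine ⟨γ, α, hγ, ?_, hp.2.2.2⟩
      rcases hp.2.2.1 with h | rfl
      exacts [ord_trans hσ hγ h, hγ]
    · obtain ⟨e, he⟩ := Z.exists_empty
      refine ⟨e, fun z => ⟨fun h => (he z h).elim, ?_⟩⟩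
      rintro ⟨γ, α, δ, β, -, h, -⟩
      exact (hq ⟨δ, β, h⟩).elim
  wf := by
    rintro P hP ⟨x, hx⟩
    by_cases h : ∃ γ α p, OrdPair E p γ α ∧ P p
    · have hP' : ∀ {s : Unit → (ℕ → X) → X} [IsTm D s],
        IsDef D fun i v => P (s i v) := hP.subst₁ (R := fun _ => P) ‹_›
      obtain ⟨γ, hγ, ⟨α, p, hp, hPp⟩, hmin⟩ := Z.ord_min
        (fun γ => ∃ α p, OrdPair E p γ α ∧ P p) inferInstance
        (by obtain ⟨γ, α, p, hp, h⟩ := h; exact ⟨γ, hp.1, α, p, hp, h⟩)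
      obtain ⟨α, hα, ⟨p, hp, hPp⟩, hmin'⟩ := Z.ord_min
        (fun α => ∃ p, OrdPair E p γ α ∧ P p) inferInstance ⟨α, hp.2.1, p, hp, hPp⟩
      refine ⟨p, hPp, ?_⟩
      rintro q ⟨δ, β, γ', α', hq, hp', h⟩ hPq
      obtain ⟨rfl, rfl⟩ := Z.ordPair_inj hp hp'
      rcases h with h | ⟨rfl, h⟩
      · exact hmin δ h ⟨β, q, hq, hPq⟩
      · exact hmin' β h ⟨q, hq, hPq⟩
    · refine ⟨x, hx, ?_⟩
      rintro y ⟨γ, α, δ, β, -, hx', -⟩ -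
      exact h ⟨δ, β, x, hx', hx⟩

theorem exists_ordCode (Z : ZFModel E D) {γ α : X} (hγ : IsOrd E γ) (hα : IsOrd E α)
    (h : E α γ ∨ α = γ) : ∃ ξ, OrdCode E γ α ξ := by
  obtain ⟨p, hp⟩ := Z.exists_pair γ α
  exact (Z.rec_exists Z.goodRel_ordLex (Z.goodRule_colRule Z.goodRel_ordLex) p).imp
    fun ξ hξ => ⟨p, ⟨hγ, hα, h, hp⟩, hξ⟩

theorem ordCode_inj (Z : ZFModel E D) {γ α γ' α' ξ : X} (h : OrdCode E γ α ξ)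
    (h' : OrdCode E γ' α' ξ) : γ = γ' ∧ α = α' := by
  obtain ⟨p, hp, h⟩ := h
  obtain ⟨p', hp', h'⟩ := h'
  obtain rfl : p = p' := by
    refine Z.col_inj Z.goodRel_ordLex ?_ h h'
    rcases Z.ord_trichotomy hp.1 hp'.1 with k | rfl | k
    · exact Or.inl ⟨_, _, _, _, hp, hp', Or.inl k⟩
    · rcases Z.ord_trichotomy hp.2.1 hp'.2.1 with k | rfl | k
      · exact Or.inl ⟨_, _, _, _, hp, hp', Or.inr ⟨rfl, k⟩⟩
      · exact Or.inr (Or.inl (Z.pair_unique hp.2.2.2 hp'.2.2.2))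
      · exact Or.inr (Or.inr ⟨_, _, _, _, hp', hp, Or.inr ⟨rfl, k⟩⟩)
    · exact Or.inr (Or.inr ⟨_, _, _, _, hp', hp, Or.inl k⟩)
  exact Z.ordPair_inj hp hp'

theorem isOrd_ordCode (Z : ZFModel E D) {γ α ξ : X} (h : OrdCode E γ α ξ) : IsOrd E ξ :=
  let ⟨_, _, h⟩ := h
  Z.isOrd_col Z.goodRel_ordLex h

/-- Take `γ` least with a code `ξ < γ`. The pair `(ξ, ξ)` precedes `(γ, α)`, so its code is below
`ξ`, which contradicts minimality of `γ`. -/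
theorem le_ordCode (Z : ZFModel E D) {γ α ξ : X} (h : OrdCode E γ α ξ) : E γ ξ ∨ γ = ξ := by
  have hγ : IsOrd E γ := by obtain ⟨p, hp, -⟩ := h; exact hp.1
  by_contra hne
  have hlt : E ξ γ := by
    rcases Z.ord_trichotomy hγ (Z.isOrd_ordCode h) with k | k | k
    exacts [(hne (Or.inl k)).elim, (hne (Or.inr k)).elim, k]
  obtain ⟨γ, hγ, ⟨α, ξ, ⟨p, hp, h⟩, hξ⟩, hmin⟩ := Z.ord_min
    (fun γ => ∃ α ξ, OrdCode E γ α ξ ∧ E ξ γ) inferInstance ⟨γ, hγ, α, ξ, h, hlt⟩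
  have hξo := Z.isOrd_col Z.goodRel_ordLex h
  obtain ⟨ζ, q, hq, hζ⟩ := Z.exists_ordCode hξo hξo (Or.inr rfl)
  exact hmin ξ hξ ⟨ξ, ζ, ⟨q, hq, hζ⟩, (Z.mem_col Z.goodRel_ordLex h ζ).2
    ⟨q, ⟨_, _, _, _, hq, hp, Or.inl hξ⟩, hζ⟩⟩

end Collapse

end ZFModel

/-! ### Satisfaction relativized to a class -/

section RelSat

/-- The variable that constitutes a term of the language of set theory. -/
def termVar {K : Type u} {β : Type v} : (setLangWith K).Term β → β
  | .var x => x
  | .func f _ => (f : Empty).elim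

theorem realize_term {K : Type u} {β : Type v} {X : Type w} [(setLangWith K).Structure X]
    (t : (setLangWith K).Term β) (v : β → X) : t.realize v = v (termVar t) := by
  cases t with
  | var x => rfl
  | func f _ => exact (f : Empty).elim

/-- Interpretation of the relation symbols of set theory. -/
def RelHolds {X : Type v} (E : X → X → Prop) : ∀ {l}, SetRel Empty l → (Fin l → X) → Prop
  | _, .mem, v => E (v 0) (v 1)
  | _, .cls k, _ => k.elim

/-- Satisfaction of formulas relativized to the class `C`. -/
def RelSat {X : Type v} {α : Type w} (E : X → X → Prop) (C : X → Prop) :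
    ∀ {n}, setLang.BoundedFormula α n → (α → X) → (Fin n → X) → Prop
  | _, .falsum, _, _ => False
  | _, .equal t₁ t₂, v, xs => Sum.elim v xs (termVar t₁) = Sum.elim v xs (termVar t₂)
  | _, .rel R ts, v, xs => RelHolds E R fun k => Sum.elim v xs (termVar (ts k))
  | _, .imp φ χ, v, xs => RelSat E C φ v xs → RelSat E C χ v xs
  | _, .all φ, v, xs => ∀ x, C x → RelSat E C φ v (Fin.snoc xs x)

theorem realize_iff_relSat {X : Type v} {Y : Type u} {α : Type w} {E : X → X → Prop} {C : X → Prop}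
    {F : Y → Y → Prop} (e : Y → X) (he : Function.Injective e)
    (hE : ∀ a b, F a b ↔ E (e a) (e b)) (hC : ∀ x, C x ↔ ∃ y, e y = x) {n : ℕ}
    (φ : setLang.BoundedFormula α n) (v : α → Y) (xs : Fin n → Y) :
    (letI := setStructureWith F (fun k : Empty => k.elim); φ.Realize v xs) ↔
      RelSat E C φ (e ∘ v) (e ∘ xs) := by
  let _ := setStructureWith F (fun k : Empty => k.elim)
  induction φ with
  | falsum => exact Iff.rfl
  | equal t₁ t₂ =>
    rw [BoundedFormula.Realize, RelSat, realize_term, realize_term, ← Sum.comp_elim]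
    exact he.eq_iff.symm
  | rel R ts =>
    cases R with
    | mem =>
      simp only [BoundedFormula.Realize, RelSat, realize_term, ← Sum.comp_elim]
      exact hE _ _
    | cls k => exact k.elim
  | imp φ χ h₁ h₂ => exact imp_congr (h₁ xs) (h₂ xs)
  | all φ h =>
    constructor
    · intro H x hx
      obtain ⟨y, rfl⟩ := (hC x).1 hx
      rw [← Fin.comp_snoc]
      exact (h _).1 (H y)
    · intro H y
      refine (h _).2 ?_
      rw [Fin.comp_snoc]
      exact H _ ((hC _).2 ⟨y, rfl⟩)

/-- Satisfaction of a formula relativized to the class `C`. -/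
def RelSatF {X : Type v} {α : Type w} (E : X → X → Prop) (C : X → Prop) (φ : setLang.Formula α)
    (v : α → X) : Prop := RelSat E C φ v default

/-- The membership relation of a class. -/
abbrev sub {S : Type u} (E : S → S → Prop) (M : Set S) : M → M → Prop := fun x y => E x y

theorem sat_iff_relSatF {S : Type u} {α : Type w} (E : S → S → Prop) (M : Set S)
    (φ : setLang.Formula α) (v : α → M) :
    Sat E M φ v ↔ RelSatF E (· ∈ M) φ (fun a => v a) := by
  unfold RelSatF Sat Formula.Realize
  refine (realize_iff_relSat (E := E) (C := (· ∈ M)) (F := sub E M) Subtype.val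
    Subtype.val_injective (fun _ _ => Iff.rfl) (fun x => by simp) φ v default).trans ?_
  rw [Subsingleton.elim (Subtype.val ∘ default) (default : Fin 0 → S)]
  rfl

/-- When `C` is definable in `N`, this turns truth in `M` into a statement that `N` itself can make.
-/
theorem sat_iff_relSatF_sub {S : Type u} {α : Type w} (E : S → S → Prop) {M N : Set S}
    (hMN : M ⊆ N) (C : N → Prop) (hC : ∀ x : N, C x ↔ (x : S) ∈ M)
    (φ : setLang.Formula α) (v : α → M) :
    Sat E M φ v ↔ RelSatF (sub E N) C φ (fun a => ⟨v a, hMN (v a).2⟩) := by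
  unfold RelSatF Sat Formula.Realize
  refine (realize_iff_relSat (E := sub E N) (C := C) (F := sub E M) (fun x => ⟨x, hMN x.2⟩)
    (fun x y h => Subtype.ext (by simpa using h)) (fun _ _ => Iff.rfl)
    (fun x => (hC x).trans ⟨fun h => ⟨⟨x, h⟩, rfl⟩, fun ⟨y, h⟩ => h ▸ y.2⟩) φ v default).trans ?_
  rw [iff_iff_eq]
  congr 1
  exact Subsingleton.elim _ _

theorem realize_iff_relSatF {X : Type v} {α : Type w} (E : X → X → Prop) (φ : setLang.Formula α)
    (v : α → X) :
    (letI := setStructureWith E (fun k : Empty => k.elim); φ.Realize v) ↔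
      RelSatF E (fun _ => True) φ v := by
  unfold RelSatF Formula.Realize
  refine (realize_iff_relSat (E := E) (C := fun _ => True) (F := E) id
    (fun _ _ h => h) (fun _ _ => Iff.rfl) (fun x => by simp) φ v default).trans ?_
  rw [iff_iff_eq]
  congr 1

variable {ι : Type u} {X : ι → Type v} {E : ∀ i, X i → X i → Prop} {D : DefSystem E} {α : Type w}

/-- The induction runs over an actual formula outside the model, so the result is one definable
predicate per formula and no truth predicate. -/
theorem isDef_relSat {C : ∀ i, X i → X i → Prop} (hC : IsDef D fun i v => C i (v 0) (v 1)) {n : ℕ}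
    (φ : setLang.BoundedFormula α n) : ∀ (p : ∀ i, (ℕ → X i) → X i)
    (s : α → ∀ i, (ℕ → X i) → X i) (t : Fin n → ∀ i, (ℕ → X i) → X i),
    IsTm D p → (∀ a, IsTm D (s a)) → (∀ k, IsTm D (t k)) →
    IsDef D fun i v => RelSat (E i) (C i (p i v)) φ (fun a => s a i v) (fun k => t k i v) := by
  have hsum : ∀ {n : ℕ} (s : α → ∀ i, (ℕ → X i) → X i) (t : Fin n → ∀ i, (ℕ → X i) → X i)
      (x : α ⊕ Fin n) (i : ι) (v : ℕ → X i),
      Sum.elim (fun a => s a i v) (fun k => t k i v) x = Sum.elim s t x i v := by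
    rintro n s t (x | x) i v <;> rfl
  have hterm : ∀ {n : ℕ} (s : α → ∀ i, (ℕ → X i) → X i) (t : Fin n → ∀ i, (ℕ → X i) → X i)
      (_ : ∀ a, IsTm D (s a)) (_ : ∀ k, IsTm D (t k)) (x : α ⊕ Fin n), IsTm D (Sum.elim s t x) := by
    rintro n s t hs ht (x | x)
    exacts [hs x, ht x]
  induction φ with
  | falsum => intros; exact isDef_false
  | equal t₁ t₂ =>
    intro p s t _ hs ht
    have h₁ := hterm s t hs ht (termVar t₁)
    have h₂ := hterm s t hs ht (termVar t₂)
    simp only [RelSat, hsum]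
    infer_instance
  | rel R ts =>
    intro p s t _ hs ht
    cases R with
    | mem =>
      have h₁ := hterm s t hs ht (termVar (ts 0))
      have h₂ := hterm s t hs ht (termVar (ts 1))
      simp only [RelSat, hsum, RelHolds]
      infer_instance
    | cls k => exact k.elim
  | imp φ χ h₁ h₂ =>
    intro p s t hp hs ht
    exact @isDef_imp _ _ _ _ _ _ (h₁ p s t hp hs ht) (h₂ p s t hp hs ht)
  | @all n φ h =>
    intro p s t hp hs ht
    have h0 := h (fun i v => p i fun n => v (n + 1)) (fun a i v => s a i fun n => v (n + 1))
      (Fin.snoc (α := fun _ => ∀ i, (ℕ → X i) → X i) (fun k i v => t k i fun n => v (n + 1))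
        fun i v => v 0) hp.shift (fun a => (hs a).shift)
      (fun k => by
        refine Fin.lastCases ?_ (fun k => ?_) k
        · rw [Fin.snoc_last]; infer_instance
        · rw [Fin.snoc_castSucc]; exact (ht k).shift)
    have h1 := hC.subst₂ hp.shift (isTm_var 0)
    refine @isDef_all _ _ _ _ _ (@isDef_imp _ _ _ _ _ _ h1 (h0.congr fun i v => ?_))
    rw [iff_iff_eq]
    congr 1
    funext k
    refine Fin.lastCases ?_ (fun k => ?_) k <;> simp

theorem isDef_relSatF {C : ∀ i, X i → X i → Prop} (hC : IsDef D fun i v => C i (v 0) (v 1))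
    (φ : setLang.Formula α) (p : ∀ i, (ℕ → X i) → X i) [hp : IsTm D p]
    (s : α → ∀ i, (ℕ → X i) → X i) (hs : ∀ a, IsTm D (s a)) :
    IsDef D fun i v => RelSatF (E i) (C i (p i v)) φ (fun a => s a i v) :=
  (isDef_relSat hC φ p s Fin.elim0 hp hs fun k => k.elim0).congr fun i v => by
    unfold RelSatF
    rw [Subsingleton.elim (fun k : Fin 0 => _) default]

theorem isDef_relSatF₂ {C : ∀ i, X i → X i → Prop} (hC : IsDef D fun i v => C i (v 0) (v 1))
    (φ : setLang.Formula (Fin 2)) (p s t : ∀ i, (ℕ → X i) → X i) [IsTm D p] [hs : IsTm D s]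
    [ht : IsTm D t] :
    IsDef D fun i v => RelSatF (E i) (C i (p i v)) φ ![s i v, t i v] :=
  (isDef_relSatF hC φ p ![s, t] fun a => by fin_cases a; exacts [hs, ht]).congr fun i v => by
    rw [iff_iff_eq]; congr 1; funext a; fin_cases a <;> rfl

theorem isDef_relSatF₃ {C : ∀ i, X i → X i → Prop} (hC : IsDef D fun i v => C i (v 0) (v 1))
    (φ : setLang.Formula (Fin 3)) (p s t r : ∀ i, (ℕ → X i) → X i) [IsTm D p] [hs : IsTm D s]
    [ht : IsTm D t] [hr : IsTm D r] :
    IsDef D fun i v => RelSatF (E i) (C i (p i v)) φ ![s i v, t i v, r i v] :=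
  (isDef_relSatF hC φ p ![s, t, r] fun a => by fin_cases a; exacts [hs, ht, hr]).congr
    fun i v => by rw [iff_iff_eq]; congr 1; funext a; fin_cases a <;> rfl

end RelSat

/-- A uniformly definable predicate is defined by a formula. -/
theorem exists_formula {m : ℕ} {P : ∀ i : BinRel.{u}, (Fin (m + 1) → i.carrier) → Prop}
    (h : IsDef uniformSystem fun i v => P i fun k => v k) :
    ∃ φ : setLang.Formula (Fin (m + 1)), ∀ (i : BinRel.{u}) (w : Fin (m + 1) → i.carrier),
      (letI := setStructureWith i.rel (fun k : Empty => k.elim); φ.Realize w) ↔ P i w := by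
  obtain ⟨φ, hφ⟩ := h.out
  -- Only the first `m + 1` variables matter to `P`; reading all indices modulo `m + 1` supplies
  -- values for any others that occur in `φ`.
  refine ⟨φ.relabel (Sum.elim (fun k : Empty => k.elim) (Fin.ofNat (m + 1))), fun i w => ?_⟩
  let _ := setStructureWith i.rel (fun k : Empty => k.elim)
  have h1 : _ ↔ P i fun k : Fin (m + 1) => w (Fin.ofNat (m + 1) k) :=
    hφ i fun k => w (Fin.ofNat (m + 1) k)
  rw [Formula.realize_relabel]
  have h2 : (fun k : Fin (m + 1) => w (Fin.ofNat (m + 1) k)) = w := by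
    funext k; congr 1; ext; simp
  rw [h2] at h1
  refine Iff.trans ?_ h1
  rw [iff_iff_eq]
  congr 1
  funext x
  rcases x with x | x
  exacts [x.elim, rfl]

/-! ### Class theory as an instance of the framework -/

section NGB

variable {S : Type u} {E : S → S → Prop} {𝒞 : Set (Set S)}

/-- The predicates that are defined by quantifying over sets, with set and class parameters. -/
abbrev classSystem (E : S → S → Prop) (𝒞 : Set (Set S)) : DefSystem (fun _ : Unit => E) :=
  paramSystem E (fun k : 𝒞 => (k : Set S))

theorem IsNGB.mem_of_isDef (h : IsNGB E 𝒞) {P : S → Prop}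
    (hP : IsDef (classSystem E 𝒞) fun _ v => P (v 0)) : {x | P x} ∈ 𝒞 := by
  obtain ⟨φ, hφ⟩ := hP.out
  let _ := setStructureWith E (fun k : 𝒞 => (k : Set S))
  refine h.comprehension _ (Set.definable_iff_exists_formula_sum.2
    ⟨φ.relabel (Sum.map (fun a => ⟨a, trivial⟩) fun _ => 0), ?_⟩)
  ext v
  have h1 := hφ () fun _ => v 0
  refine h1.symm.trans ?_
  change _ ↔ Formula.Realize _ _
  rw [Formula.realize_relabel, iff_iff_eq]
  congr 1
  funext x
  rcases x with x | x <;> rfl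

theorem isDef_mem_class {C : Set S} (hC : C ∈ 𝒞) {t : Unit → (ℕ → S) → S}
    [ht : IsTm (classSystem E 𝒞) t] : IsDef (classSystem E 𝒞) fun i v => t i v ∈ C := by
  obtain ⟨x, hx⟩ := ht.out
  refine ⟨Relations.formula₁ (L := setLangWith 𝒞) (SetRel.cls ⟨C, hC⟩) (Term.var x),
    fun i v => ?_⟩
  let _ := setStructureWith E (fun k : 𝒞 => (k : Set S))
  refine (Formula.realize_rel₁ (L := setLangWith 𝒞)).trans ?_
  exact iff_of_eq (congrArg (· ∈ C) (hx i v))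

/-- Comprehension turns a definable relation into a class of ordered pairs, to which the replacement
axiom for class functions applies. -/
theorem IsNGB.zfModel (h : IsNGB E 𝒞) : ZFModel E (classSystem E 𝒞) where
  inhabited := let ⟨w, _⟩ := h.infinity; ⟨w⟩
  ext := h.extensionality
  pairing := h.pairing
  union := h.union
  powerset := h.powerset
  foundation P hP hne := let ⟨x, hx, hmin⟩ := h.foundation {x | P x} (h.mem_of_isDef hP) hne
    ⟨x, hx, fun y hy hPy => hmin y hPy hy⟩
  replacement R hR hfun a := by
    have hR' : ∀ {s t : Unit → (ℕ → S) → S} [IsTm (classSystem E 𝒞) s] [IsTm (classSystem E 𝒞) t],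
      IsDef (classSystem E 𝒞) fun i v => R (s i v) (t i v) := hR.subst₂ (R := fun _ => R) ‹_› ‹_›
    have hF : {p | ∃ x y, IsPair E p x y ∧ R x y} ∈ 𝒞 := h.mem_of_isDef inferInstance
    have hinj := @isPair_inj S E h.pairing
    obtain ⟨c, hc⟩ := h.replacement _ hF (by
      rintro x y y' p p' ⟨a, b, hp, hab⟩ ⟨a', b', hp', hab'⟩ h1 h2
      obtain ⟨rfl, rfl⟩ := hinj hp h1
      obtain ⟨rfl, rfl⟩ := hinj hp' h2
      exact hfun _ _ _ hab hab') a
    refine ⟨c, fun y => (hc y).trans ⟨?_, ?_⟩⟩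
    · rintro ⟨x, p, hx, ⟨a, b, hp, hab⟩, h1⟩
      obtain ⟨rfl, rfl⟩ := hinj hp h1
      exact ⟨_, hx, hab⟩
    · rintro ⟨x, hx, hxy⟩
      obtain ⟨p, hp⟩ := exists_isPair h.extensionality h.pairing x y
      exact ⟨x, p, hx, ⟨x, y, hp, hxy⟩, hp⟩

end NGB

/-! ### Substitution in `Δ₀` formulas -/

section Delta0

/-- Satisfaction of a formula with displayed bound variables. -/
def BSat {X : Type v} {α : Type w} (F : X → X → Prop) {n : ℕ} (χ : setLang.BoundedFormula α n)
    (v : α → X) (xs : Fin n → X) : Prop :=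
  letI := setStructureWith F (fun k : Empty => k.elim); χ.Realize v xs

variable {X : Type v} {α : Type w} {F : X → X → Prop} {n : ℕ}

theorem bSat_mem (x y : α ⊕ Fin n) (v : α → X) (xs : Fin n → X) :
    BSat F (memF x y) v xs ↔ F (Sum.elim v xs x) (Sum.elim v xs y) := by
  let _ := setStructureWith F (fun k : Empty => k.elim)
  exact BoundedFormula.realize_rel₂ (L := setLang)

theorem bSat_equal (x y : α ⊕ Fin n) (v : α → X) (xs : Fin n → X) :
    BSat F (Term.bdEqual (Term.var x) (Term.var y)) v xs ↔
      Sum.elim v xs x = Sum.elim v xs y := by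
  let _ := setStructureWith F (fun k : Empty => k.elim)
  exact BoundedFormula.realize_bdEqual _ _

theorem bSat_ball (x : α ⊕ Fin n) (φ : setLang.BoundedFormula α (n + 1)) (v : α → X)
    (xs : Fin n → X) :
    BSat F ((memF (Sum.inr (Fin.last n)) (Sum.map id Fin.castSucc x)).imp φ).all v xs ↔
      ∀ a, F a (Sum.elim v xs x) → BSat F φ v (Fin.snoc xs a) := by
  refine forall_congr' fun a => ?_
  refine imp_congr ((bSat_mem _ _ v (Fin.snoc xs a)).trans ?_) Iff.rfl
  rcases x with x | x <;> simp

/-- Bounded quantifiers have a fixed syntactic shape, so the new formula is rebuilt by induction.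
Bound and free variables may be exchanged freely by `g`. -/
theorem IsDelta0.exists_subst {β : Type u} {χ : setLang.BoundedFormula α n} (h : IsDelta0 χ) :
    ∀ {n' : ℕ} (g : α ⊕ Fin n → β ⊕ Fin n'), ∃ χ' : setLang.BoundedFormula β n', IsDelta0 χ' ∧
      ∀ {X : Type v} (F : X → X → Prop) (v : β → X) (xs : Fin n' → X), BSat F χ' v xs ↔
        BSat F χ (fun a => Sum.elim v xs (g (Sum.inl a)))
          (fun k => Sum.elim v xs (g (Sum.inr k))) := by
  have key : ∀ {n n' : ℕ} (g : α ⊕ Fin n → β ⊕ Fin n') {X : Type v} (v : β → X) (xs : Fin n' → X)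
      (x : α ⊕ Fin n), Sum.elim v xs (g x) = Sum.elim (fun a => Sum.elim v xs (g (Sum.inl a)))
        (fun k => Sum.elim v xs (g (Sum.inr k))) x := by
    rintro n n' g X v xs (x | x) <;> rfl
  induction h with
  | falsum => exact fun g => ⟨⊥, .falsum, fun F v xs => Iff.rfl⟩
  | mem x y =>
    exact fun g => ⟨_, .mem (g x) (g y), fun F v xs => by rw [bSat_mem, bSat_mem, ← key, ← key]⟩
  | equal x y =>
    exact fun g => ⟨_, .equal (g x) (g y), fun F v xs => by
      rw [bSat_equal, bSat_equal, ← key, ← key]⟩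
  | imp _ _ h₁ h₂ =>
    intro n' g
    obtain ⟨χ₁, d₁, e₁⟩ := h₁ g
    obtain ⟨χ₂, d₂, e₂⟩ := h₂ g
    exact ⟨_, .imp d₁ d₂, fun F v xs => imp_congr (e₁ F v xs) (e₂ F v xs)⟩
  | @ball n x φ _ h =>
    intro n' g
    obtain ⟨χ, d, e⟩ := h (Sum.elim (fun a => Sum.map id Fin.castSucc (g (Sum.inl a)))
      (Fin.lastCases (Sum.inr (Fin.last n')) fun k => Sum.map id Fin.castSucc (g (Sum.inr k))))
    refine ⟨_, .ball (g x) d, fun {X} F v xs => ?_⟩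
    rw [bSat_ball, bSat_ball, key g v xs x]
    have hs : ∀ (a : X) (y : β ⊕ Fin n'),
        Sum.elim v (Fin.snoc (α := fun _ => X) xs a) (Sum.map id Fin.castSucc y) =
          Sum.elim v xs y := by
      rintro a (y | y) <;> simp
    refine forall_congr' fun a => imp_congr Iff.rfl ((e F v _).trans ?_)
    rw [iff_iff_eq]
    congr 1
    · funext c
      simp [hs]
    · funext k
      refine Fin.lastCases ?_ (fun k => ?_) k <;> simp [hs]

/-- A `Δ₀` formula has only finitely many free variables. -/
theorem IsDelta0.exists_fin {χ : setLang.BoundedFormula α n} (h : IsDelta0 χ) :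
    ∃ (k : ℕ) (e : Fin k → α) (χ' : setLang.BoundedFormula (Fin k) n), IsDelta0 χ' ∧
      ∀ {X : Type v} (F : X → X → Prop) (v : α → X) (xs : Fin n → X),
        BSat F χ' (v ∘ e) xs ↔ BSat F χ v xs := by
  have hvar : ∀ {n : ℕ} (x : α ⊕ Fin n), ∃ (k : ℕ) (e : Fin k → α) (x' : Fin k ⊕ Fin n),
      Sum.map e id x' = x := by
    rintro n (a | i)
    · exact ⟨1, fun _ => a, Sum.inl 0, rfl⟩
    · exact ⟨0, Fin.elim0, Sum.inr i, rfl⟩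
  have hvar₂ : ∀ {n : ℕ} (x y : α ⊕ Fin n), ∃ (k : ℕ) (e : Fin k → α) (x' y' : Fin k ⊕ Fin n),
      ∀ {X : Type v} (v : α → X) (xs : Fin n → X),
        Sum.elim (v ∘ e) xs x' = Sum.elim v xs x ∧ Sum.elim (v ∘ e) xs y' = Sum.elim v xs y := by
    intro n x y
    obtain ⟨k, e, x', rfl⟩ := hvar x
    obtain ⟨l, f, y', rfl⟩ := hvar y
    refine ⟨k + l, Fin.append e f, Sum.map (Fin.castAdd l) id x', Sum.map (Fin.natAdd k) id y',
      fun v xs => ⟨?_, ?_⟩⟩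
    · rcases x' with x' | x' <;> simp
    · rcases y' with y' | y' <;> simp
  induction h with
  | falsum => exact ⟨0, Fin.elim0, ⊥, .falsum, fun F v xs => Iff.rfl⟩
  | mem x y =>
    obtain ⟨k, e, x', y', h⟩ := hvar₂ x y
    exact ⟨k, e, _, .mem x' y', fun F v xs => by rw [bSat_mem, bSat_mem, (h v xs).1, (h v xs).2]⟩
  | equal x y =>
    obtain ⟨k, e, x', y', h⟩ := hvar₂ x y
    exact ⟨k, e, _, .equal x' y', fun F v xs => by
      rw [bSat_equal, bSat_equal, (h v xs).1, (h v xs).2]⟩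
  | imp _ _ h₁ h₂ =>
    obtain ⟨k, e, χ, hχ, hχ'⟩ := h₁
    obtain ⟨l, f, θ, hθ, hθ'⟩ := h₂
    obtain ⟨χ₁, d₁, e₁⟩ := hχ.exists_subst (β := Fin (k + l)) (Sum.map (Fin.castAdd l) id)
    obtain ⟨θ₁, d₂, e₂⟩ := hθ.exists_subst (β := Fin (k + l)) (Sum.map (Fin.natAdd k) id)
    refine ⟨k + l, Fin.append e f, _, .imp d₁ d₂, fun F v xs => imp_congr ?_ ?_⟩
    · refine (e₁ F _ xs).trans (Iff.trans ?_ (hχ' F v xs))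
      simp [Function.comp_def]
    · refine (e₂ F _ xs).trans (Iff.trans ?_ (hθ' F v xs))
      simp [Function.comp_def]
  | ball x _ h =>
    obtain ⟨k, e, x', hx⟩ := hvar x
    obtain ⟨l, f, θ, hθ, hθ'⟩ := h
    obtain ⟨θ₁, d, hd⟩ := hθ.exists_subst (β := Fin (k + l)) (Sum.map (Fin.natAdd k) id)
    refine ⟨k + l, Fin.append e f, _, .ball (Sum.map (Fin.castAdd l) id x') d, fun F v xs => ?_⟩
    rw [bSat_ball, bSat_ball, ← hx]
    refine forall_congr' fun a => imp_congr ?_ ((hd F _ _).trans (Iff.trans ?_ (hθ' F v _)))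
    · rcases x' with x' | x' <;> simp
    · simp [Function.comp_def]

end Delta0

/-! ### Gaifman's theorem -/

section Gaifman

variable {S : Type u} {E : S → S → Prop} {𝒞 : Set (Set S)} {K N : Set S}

/-- Predicates of `n`-tuples of `K` and `N` defined by the same `Δ₀` formula with parameters from
`K` and their images under `k`. -/
def Delta0Pair (E : S → S → Prop) (k : K → N) (n : ℕ) (P : (Fin n → K) → Prop)
    (Q : (Fin n → N) → Prop) : Prop :=
  ∃ χ : setLang.BoundedFormula K n, IsDelta0 χ ∧ (∀ v, BSat (sub E K) χ id v ↔ P v) ∧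
    ∀ v, BSat (sub E N) χ k v ↔ Q v

/-- `k : K → N` preserves `Δ₀` formulas. -/
def PreservesDelta0 (E : S → S → Prop) (k : K → N) : Prop :=
  ∀ (m : ℕ) (φ : setLang.Formula (Fin m)), IsDelta0 φ →
    ∀ v : Fin m → K, Sat E K φ v ↔ Sat E N φ (fun i => k (v i))

variable {k : K → N} {n : ℕ}

/-- The parameters from `K` are free variables of the formula. Only finitely many occur, so
`Δ₀`-preservation for formulas in `Fin m` suffices. -/
theorem Delta0Pair.transfer₀ (hk : PreservesDelta0 E k) {P : (Fin 0 → K) → Prop}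
    {Q : (Fin 0 → N) → Prop} (h : Delta0Pair E k 0 P Q) : P default ↔ Q default := by
  obtain ⟨χ, hχ, h₁, h₂⟩ := h
  rw [← h₁, ← h₂]
  obtain ⟨m, e, χ', hχ', h⟩ := hχ.exists_fin
  rw [← h, ← h]
  exact hk m χ' hχ' e

theorem Delta0Pair.imp {P P' : (Fin n → K) → Prop} {Q Q' : (Fin n → N) → Prop}
    (h : Delta0Pair E k n P Q) (h' : Delta0Pair E k n P' Q') :
    Delta0Pair E k n (fun v => P v → P' v) (fun v => Q v → Q' v) := by
  obtain ⟨χ, d, h₁, h₂⟩ := h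
  obtain ⟨χ', d', h₁', h₂'⟩ := h'
  exact ⟨_, .imp d d', fun v => imp_congr (h₁ v) (h₁' v), fun v => imp_congr (h₂ v) (h₂' v)⟩

theorem Delta0Pair.ball {P : (Fin (n + 1) → K) → Prop} {Q : (Fin (n + 1) → N) → Prop}
    (h : Delta0Pair E k (n + 1) P Q) (a : K) :
    Delta0Pair E k n (fun v => ∀ x : K, E x a → P (Fin.snoc v x))
      (fun v => ∀ x : N, E x (k a) → Q (Fin.snoc v x)) := by
  obtain ⟨χ, d, h₁, h₂⟩ := h
  refine ⟨_, .ball (Sum.inl a) d, fun v => ?_, fun v => ?_⟩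
  · rw [bSat_ball]
    exact forall_congr' fun x => imp_congr Iff.rfl (h₁ _)
  · rw [bSat_ball]
    exact forall_congr' fun x => imp_congr Iff.rfl (h₂ _)

theorem Delta0Pair.mem (x y : K ⊕ Fin n) : Delta0Pair E k n
    (fun v => sub E K (Sum.elim id v x) (Sum.elim id v y))
    (fun v => sub E N (Sum.elim k v x) (Sum.elim k v y)) :=
  ⟨_, .mem x y, fun _ => bSat_mem _ _ _ _, fun _ => bSat_mem _ _ _ _⟩

theorem Delta0Pair.equal (x y : K ⊕ Fin n) : Delta0Pair E k n
    (fun v => Sum.elim id v x = (Sum.elim id v y : K))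
    (fun v => Sum.elim k v x = Sum.elim k v y) :=
  ⟨_, .equal x y, fun _ => bSat_equal _ _ _ _, fun _ => bSat_equal _ _ _ _⟩

theorem Delta0Pair.transfer_const (hk : PreservesDelta0 E k) {P : (Fin n → K) → Prop}
    {Q : (Fin n → N) → Prop} (h : Delta0Pair E k n P Q) (w : Fin n → K) :
    P w ↔ Q fun i => k (w i) := by
  obtain ⟨χ, d, h₁, h₂⟩ := h
  obtain ⟨χ', d', h'⟩ := d.exists_subst (β := K) (n' := 0) (Sum.elim Sum.inl (Sum.inl ∘ w))
  have : Delta0Pair E k 0 (fun _ => P w) (fun _ => Q fun i => k (w i)) :=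
    ⟨χ', d', fun v => (h' _ _ _).trans (h₁ w), fun v => (h' _ _ _).trans (h₂ _)⟩
  exact this.transfer₀ hk

theorem Delta0Pair.transfer_ball (hk : PreservesDelta0 E k) (a : K) :
    ∀ {n : ℕ} {P : (Fin n → K) → Prop} {Q : (Fin n → N) → Prop}, Delta0Pair E k n P Q →
    ((∀ v : Fin n → K, (∀ i, E (v i) a) → P v) ↔
      ∀ v : Fin n → N, (∀ i, E (v i) (k a)) → Q v) := by
  intro n
  induction n with
  | zero =>
    intro P Q h
    constructor
    · intro H v _
      rw [Subsingleton.elim v default]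
      exact (h.transfer₀ hk).1 (H _ fun i => i.elim0)
    · intro H v _
      rw [Subsingleton.elim v default]
      exact (h.transfer₀ hk).2 (H _ fun i => i.elim0)
  | succ n ih =>
    intro P Q h
    have aux : ∀ {T : Set S} (c : S) (R : (Fin (n + 1) → T) → Prop),
        (∀ v : Fin (n + 1) → T, (∀ i, E (v i) c) → R v) ↔
          ∀ v : Fin n → T, (∀ i, E (v i) c) → ∀ x : T, E x c → R (Fin.snoc v x) := by
      intro T c R
      constructor
      · refine fun H v hv x hx => H _ fun i => ?_
        refine Fin.lastCases ?_ (fun i => ?_) i <;> simp [hx, hv]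
      · intro H v hv
        have := H (Fin.init v) (fun i => hv _) (v (Fin.last n)) (hv _)
        rwa [Fin.snoc_init_self] at this
    rw [aux, aux]
    exact ih (h.ball a)

theorem PreservesDelta0.mem_iff (hk : PreservesDelta0 E k) (x y : K) : E x y ↔ E (k x) (k y) :=
  (Delta0Pair.mem (k := k) (n := 0) (Sum.inl x) (Sum.inl y)).transfer₀ hk

theorem PreservesDelta0.subset (hk : PreservesDelta0 E k) {a c : K}
    (h : ∀ x : K, E x a → E x c) (x : N) (hx : E x (k a)) : E x (k c) := by
  have := ((Delta0Pair.mem (E := E) (k := k) (n := 1) (Sum.inr 0) (Sum.inl c)).transfer_ball hk a).1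
    (fun v hv => h _ (hv 0)) ![x] fun i => by simpa using hx
  simpa using this

/-- Almost universality is applied to `(x ∪ a) ∩ K`, a set by separation for the class `K`. -/
theorem exists_cover (Z : ZFModel E (classSystem E 𝒞)) (hK : K ∈ 𝒞) (htr : IsTransClass E K)
    (hau : AlmostUniversal E K) (x : S) {a : S} (ha : a ∈ K) :
    ∃ c ∈ K, (∀ z, E z a → E z c) ∧ ∀ z, E z x → z ∈ K → E z c := by
  have := @isDef_mem_class S E 𝒞 K hK
  obtain ⟨u, hu⟩ := Z.exists_union₂ x a
  obtain ⟨w, hw⟩ := Z.separation (· ∈ K) inferInstance u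
  obtain ⟨c, hc, h⟩ := hau w fun z hz => ((hw z).1 hz).2
  exact ⟨c, hc, fun z hz => h z ((hw z).2 ⟨(hu z).2 (Or.inr hz), htr a ha z hz⟩),
    fun z hz hzK => h z ((hw z).2 ⟨(hu z).2 (Or.inl hz), hzK⟩)⟩

theorem exists_bound (Z : ZFModel E (classSystem E 𝒞)) (hK : K ∈ 𝒞) (htr : IsTransClass E K)
    (hau : AlmostUniversal E K) (hne : K.Nonempty) :
    ∀ {m : ℕ} (v : Fin m → K), ∃ a : K, ∀ i, E (v i) a := by
  intro m
  induction m with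
  | zero => exact fun v => ⟨⟨_, hne.some_mem⟩, fun i => i.elim0⟩
  | succ m ih =>
    intro v
    obtain ⟨a, ha⟩ := ih (Fin.init v)
    obtain ⟨s, hs⟩ := Z.exists_singleton (v (Fin.last m))
    obtain ⟨c, hc, h₁, h₂⟩ := exists_cover Z hK htr hau s a.2
    refine ⟨⟨c, hc⟩, fun i => ?_⟩
    refine Fin.lastCases ?_ (fun i => ?_) i
    · exact h₂ _ ((hs _).2 rfl) (v _).2
    · exact h₁ _ (ha i)

/-- The collection principle in `K`, for the formula `¬ φ`. -/
theorem exists_counterexamples (Z : ZFModel E (classSystem E 𝒞)) (hK : K ∈ 𝒞)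
    (htr : IsTransClass E K) (hau : AlmostUniversal E K)
    (φ : setLang.BoundedFormula Empty (n + 1)) (a : K) :
    ∃ c : K, (∀ z, E z a → E z c) ∧ ∀ v : Fin n → K, (∀ i, E (v i) a) →
      (∀ x : K, E x c → BSat (sub E K) φ default (Fin.snoc v x)) →
      ∀ x, BSat (sub E K) φ default (Fin.snoc v x) := by
  have hmem := @isDef_mem_class S E 𝒞 K hK
  have hsat (v : Fin (n + 1) → K) : BSat (sub E K) φ default v ↔
      RelSat E (· ∈ K) φ (fun e => e.elim) (fun i => (v i : S)) := by
    refine (realize_iff_relSat (E := E) (C := (· ∈ K)) (F := sub E K) Subtype.val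
      Subtype.val_injective (fun _ _ => Iff.rfl) (fun x => by simp) φ default v).trans ?_
    rw [Subsingleton.elim (Subtype.val ∘ default) (fun e : Empty => e.elim)]
    rfl
  have hdef : IsDef (classSystem E 𝒞) fun _ w => w 0 ∈ K ∧
      ¬ RelSat E (· ∈ K) φ (fun e => e.elim) (Fin.snoc (fun i : Fin n => w (i + 1)) (w 0)) := by
    have h1 := isDef_relSat (D := classSystem E 𝒞) (C := fun _ _ x => x ∈ K) hmem φ
      (fun _ w => w 0) (fun e => e.elim)
      (Fin.snoc (α := fun _ => Unit → (ℕ → S) → S) (fun (i : Fin n) _ w => w (i + 1)) fun _ w => w 0)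
      inferInstance (fun e => e.elim) (fun i => by
        refine Fin.lastCases ?_ (fun i => ?_) i
        · rw [Fin.snoc_last]; infer_instance
        · rw [Fin.snoc_castSucc]; infer_instance)
    refine @isDef_and _ _ _ _ _ _ hmem (@isDef_not _ _ _ _ _ (h1.congr fun i w => ?_))
    rw [iff_iff_eq]
    congr 1
    · exact Subsingleton.elim _ _
    · funext i
      refine Fin.lastCases ?_ (fun i => ?_) i <;> simp
  obtain ⟨d, hd⟩ := Z.collection_tuple a n (fun v x => x ∈ K ∧
    ¬ RelSat E (· ∈ K) φ (fun e => e.elim) (Fin.snoc v x)) hdef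
  obtain ⟨c, hc, h₁, h₂⟩ := exists_cover Z hK htr hau d a.2
  refine ⟨⟨c, hc⟩, h₁, fun v hv H x => ?_⟩
  by_contra hx
  have hsnoc (y : K) : (fun i => ((Fin.snoc v y : Fin (n + 1) → K) i : S)) =
      Fin.snoc (fun i => (v i : S)) (y : S) := by
    funext i
    refine Fin.lastCases ?_ (fun i => ?_) i <;> simp
  rw [hsat, hsnoc] at hx
  obtain ⟨y, hyd, hyK, hy⟩ := hd (fun i => v i) hv ⟨x, x.2, hx⟩
  have := H ⟨y, hyK⟩ (h₂ y hyd hyK)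
  rw [hsat, hsnoc] at this
  exact hy this

/-- Restricted to tuples from a fixed set, every formula is equivalent to a `Δ₀` formula with
parameters from `K`, and the same formula with the images of the parameters works in `N`. For a
universal quantifier, collection in `K` provides one set `c` containing counterexamples for all
tuples from `a` that have any, so quantifying over `c` is enough. -/
theorem exists_delta0Pair (Z : ZFModel E (classSystem E 𝒞)) (hK : K ∈ 𝒞)
    (htr : IsTransClass E K) (hau : AlmostUniversal E K) (hk : PreservesDelta0 E k)
    (hcof : ∀ y : N, ∃ x : K, E y (k x)) (φ : setLang.BoundedFormula Empty n) : ∀ a : K,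
    ∃ P Q, Delta0Pair E k n P Q ∧
      (∀ v, (∀ i, E (v i) a) → (BSat (sub E K) φ default v ↔ P v)) ∧
      ∀ v, (∀ i, E (v i) (k a)) → (BSat (sub E N) φ default v ↔ Q v) := by
  have hvar : ∀ {n : ℕ} (x : Empty ⊕ Fin n), ∃ i, x = Sum.inr i := by
    rintro n (x | i)
    exacts [x.elim, ⟨i, rfl⟩]
  induction φ with
  | falsum => exact fun a => ⟨_, _, ⟨⊥, .falsum, fun _ => Iff.rfl, fun _ => Iff.rfl⟩,
      fun _ _ => Iff.rfl, fun _ _ => Iff.rfl⟩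
  | equal t₁ t₂ =>
    intro a
    obtain ⟨i, hi⟩ := hvar (termVar t₁)
    obtain ⟨j, hj⟩ := hvar (termVar t₂)
    refine ⟨_, _, Delta0Pair.equal (Sum.inr i) (Sum.inr j), fun v _ => ?_, fun v _ => ?_⟩ <;>
    simp [BSat, BoundedFormula.Realize, realize_term, hi, hj]
  | rel R ts =>
    intro a
    cases R with
    | mem =>
      obtain ⟨i, hi⟩ := hvar (termVar (ts 0))
      obtain ⟨j, hj⟩ := hvar (termVar (ts 1))
      refine ⟨_, _, Delta0Pair.mem (Sum.inr i) (Sum.inr j), fun v _ => ?_, fun v _ => ?_⟩ <;>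
      simp [BSat, BoundedFormula.Realize, realize_term, hi, hj, Structure.RelMap]
    | cls k => exact k.elim
  | imp φ χ h₁ h₂ =>
    intro a
    obtain ⟨P, Q, d, e, e'⟩ := h₁ a
    obtain ⟨P', Q', d', f, f'⟩ := h₂ a
    exact ⟨_, _, d.imp d', fun v hv => imp_congr (e v hv) (f v hv),
      fun v hv => imp_congr (e' v hv) (f' v hv)⟩
  | @all n φ ih =>
    intro a
    have hsnoc : ∀ {T : Set S} {c d : S} {v : Fin n → T} {x : T}, (∀ z, E z c → E z d) →
        (∀ i, E (v i) c) → E x d → ∀ i, E ((Fin.snoc v x : Fin (n + 1) → T) i) d := by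
      intro T c d v x hcd hv hx i
      refine Fin.lastCases ?_ (fun i => ?_) i <;> simp [hx, hcd _ (hv _)]
    obtain ⟨c, hac, hc⟩ := exists_counterexamples Z hK htr hau φ a
    obtain ⟨P, Q, d, e, e'⟩ := ih c
    have hkN : ∀ {a c : K}, (∀ z, E z a → E z c) → ∀ z ∈ N, E z (k a) → E z (k c) :=
      fun h z hzN hz => hk.subset (fun x hx => h x hx) ⟨z, hzN⟩ hz
    refine ⟨_, _, d.ball c, fun v hv => ⟨fun H x hx => ?_, fun H => ?_⟩,
      fun v hv => ⟨fun H x hx => ?_, fun H x => ?_⟩⟩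
    · exact (e _ (hsnoc hac hv hx)).1 (H x)
    · exact hc v hv fun x hx => (e _ (hsnoc hac hv hx)).2 (H x hx)
    · refine (e' _ fun i => ?_).1 (H x)
      refine Fin.lastCases ?_ (fun i => ?_) i
      · simpa using hx
      · simpa using hkN hac _ (v i).2 (hv i)
    · obtain ⟨z, hz⟩ := hcof x
      obtain ⟨d₀, hd₀, h₁, h₂⟩ := exists_cover Z hK htr hau z c.2
      obtain ⟨P', Q', d', f, f'⟩ := ih ⟨d₀, hd₀⟩
      have had : ∀ y, E y a → E y d₀ := fun y hy => h₁ y (hac y hy)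
      -- In `N` it remains to show that a statement true on `k(c)` is true at an arbitrary `x`. By
      -- cofinality `x ∈ k(d₀)` for some `d₀` covering `c`. That truth on `c` implies truth on `d₀`,
      -- for all tuples from `a`, is a `Δ₀` fact of `K`, and it is transferred along `k`.
      have hT := ((d.ball c).imp (d'.ball ⟨d₀, hd₀⟩)).transfer_ball hk a
      have h3 := hT.1 (fun v hv H x hx => by
        refine (f _ (hsnoc had hv hx)).1 (hc v hv (fun x hx => ?_) x)
        exact (e _ (hsnoc hac hv hx)).2 (H x hx)) v hv H x
          (hk.subset (c := ⟨d₀, hd₀⟩) (fun y hy => h₂ y hy y.2) x hz)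
      refine (f' _ fun i => ?_).2 h3
      refine Fin.lastCases ?_ (fun i => ?_) i
      · simpa using hk.subset (c := ⟨d₀, hd₀⟩) (fun y hy => h₂ y hy y.2) x hz
      · simpa using hkN had _ (v i).2 (hv i)

/-- Gaifman's theorem: cofinal `Δ₀`-elementary embeddings are elementary. -/
theorem sat_iff_of_cofinal (Z : ZFModel E (classSystem E 𝒞)) (hK : K ∈ 𝒞)
    (htr : IsTransClass E K) (hau : AlmostUniversal E K) (hk : PreservesDelta0 E k)
    (hcof : ∀ y : N, ∃ x : K, E y (k x)) (hne : K.Nonempty) {m : ℕ}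
    (φ : setLang.Formula (Fin m)) (v : Fin m → K) :
    Sat E K φ v ↔ Sat E N φ fun i => k (v i) := by
  have key {T : Set S} (w : Fin m → T) :
      BSat (sub E T) (BoundedFormula.relabel (Sum.inr : Fin m → Empty ⊕ Fin m) φ) default w ↔
        Sat E T φ w := by
    let _ := inStructure E T
    refine BoundedFormula.realize_relabel.trans ?_
    rw [iff_iff_eq]
    unfold Sat Formula.Realize
    congr 1
    exact Subsingleton.elim _ _
  obtain ⟨a, ha⟩ := exists_bound Z hK htr hau hne v
  obtain ⟨P, Q, d, e, f⟩ := exists_delta0Pair (n := m) Z hK htr hau hk hcof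
    (BoundedFormula.relabel (Sum.inr : Fin m → Empty ⊕ Fin m) φ) a
  exact (key v).symm.trans <| (e v ha).trans <| (d.transfer_const hk v).trans <|
    (f _ fun i => (hk.mem_iff _ _).1 (ha i)).symm.trans (key _)

end Gaifman

/-! ### Iterates of a partial class function -/

section Iterates

variable {X : Type v} {E : X → X → Prop}

/-- `n = m + 1`. -/
def IsSucc (E : X → X → Prop) (n m : X) : Prop := ∀ z, E z n ↔ E z m ∨ z = m

/-- Finite ordinals. -/
def IsFin (E : X → X → Prop) (n : X) : Prop :=
  IsOrd E n ∧ ∀ m, (E m n ∨ m = n) → (∀ z, ¬ E z m) ∨ ∃ k, IsSucc E m k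

/-- The recursive rule of the iteration of the partial function `J`, starting at `x`. -/
def IterRule (E J : X → X → Prop) (x n f t : X) : Prop :=
  ((∀ z, ¬ E z n) ∧ t = x) ∨ ∃ m s u, IsSucc E n m ∧ App E f m s ∧ E u s ∧ J u t

/-- `y = J^n(x)`. -/
def Iter (E J : X → X → Prop) (n x y : X) : Prop :=
  ∃ s, Rec E (OrdLt E) (IterRule E J x) n s ∧ E y s

section

variable {ι : Type u} {X : ι → Type v} {E : ∀ i, X i → X i → Prop} {D : DefSystem E}
variable {s t r q : ∀ i, (ℕ → X i) → X i}

theorem isDef_isSucc_base : IsDef D (fun i v => IsSucc (E i) (v 0) (v 1)) := by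
  unfold IsSucc; infer_instance

instance [hs : IsTm D s] [ht : IsTm D t] : IsDef D (fun i v => IsSucc (E i) (s i v) (t i v)) :=
  isDef_isSucc_base.subst₂ hs ht

theorem isDef_isFin_base : IsDef D (fun i v => IsFin (E i) (v 0)) := by
  unfold IsFin; infer_instance

instance [hs : IsTm D s] : IsDef D (fun i v => IsFin (E i) (s i v)) :=
  isDef_isFin_base.subst₁ hs

end

namespace ZFModel

variable {D : DefSystem (fun _ : Unit => E)} [HasParams D] {J : X → X → Prop}

theorem succ_inj (Z : ZFModel E D) {n m m' : X} (h : IsSucc E n m) (h' : IsSucc E n m') :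
    m = m' := by
  rcases (h' m).1 ((h m).2 (Or.inr rfl)) with k | k
  · rcases (h m').1 ((h' m').2 (Or.inr rfl)) with k' | k'
    · exact (Z.asymm k k').elim
    · exact k'.symm
  · exact k

theorem isFin_of_isSucc {n m : X} (hn : IsFin E n) (h : IsSucc E n m) : IsFin E m := by
  have hm : E m n := (h m).2 (Or.inr rfl)
  refine ⟨ord_of_mem hn.1 hm, fun k hk => hn.2 k (Or.inl ?_)⟩
  rcases hk with hk | rfl
  exacts [ord_trans hn.1 hm hk, hm]

theorem exists_isFin_succ (Z : ZFModel E D) {n : X} (hn : IsFin E n) :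
    ∃ m, IsFin E m ∧ IsSucc E m n := by
  obtain ⟨m, hm, h⟩ := Z.ord_succ hn.1
  refine ⟨m, ⟨hm, fun k hk => ?_⟩, h⟩
  rcases hk with hk | rfl
  · exact hn.2 k ((h k).1 hk)
  · exact Or.inr ⟨n, h⟩

theorem fin_induction (Z : ZFModel E D) (P : X → Prop) (hP : IsDef D fun _ v => P (v 0))
    (h0 : ∀ n, (∀ z, ¬ E z n) → P n) (hs : ∀ n m, IsFin E m → IsSucc E n m → P m → P n) (n : X)
    (hn : IsFin E n) : P n := by
  refine Z.induction (fun n => IsFin E n → P n) inferInstance (fun n ih hn => ?_) n hn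
  rcases hn.2 n (Or.inr rfl) with h | ⟨m, h⟩
  · exact h0 n h
  · have hm := isFin_of_isSucc hn h
    exact hs n m hm h (ih m ((h m).2 (Or.inr rfl)) hm)

theorem isFin_empty {e : X} (he : ∀ z, ¬ E z e) : IsFin E e :=
  ⟨ord_empty he, fun m hm => by
    rcases hm with h | rfl
    exacts [(he m h).elim, Or.inl he]⟩

variable (hJ : IsDef D fun _ v => J (v 0) (v 1))
include hJ

theorem isDef_iterRule {s t r q : Unit → (ℕ → X) → X} [hs : IsTm D s] [ht : IsTm D t]
    [hr : IsTm D r] [hq : IsTm D q] :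
    IsDef D fun i v => IterRule E J (s i v) (t i v) (r i v) (q i v) := by
  refine IsDef.subst₄ (R := fun _ => IterRule E J) ?_ hs ht hr hq
  have hJ' : ∀ {s t : Unit → (ℕ → X) → X} [IsTm D s] [IsTm D t],
      IsDef D fun i v => J (s i v) (t i v) := hJ.subst₂ (R := fun _ => J) ‹_› ‹_›
  unfold IterRule
  infer_instance

theorem isDef_iter {s t r : Unit → (ℕ → X) → X} [hs : IsTm D s] [ht : IsTm D t]
    [hr : IsTm D r] : IsDef D fun i v => Iter E J (s i v) (t i v) (r i v) := by
  refine IsDef.subst₃ (R := fun _ => Iter E J) ?_ hs ht hr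
  have hJ' : ∀ {s t r q : Unit → (ℕ → X) → X} [IsTm D s] [IsTm D t] [IsTm D r] [IsTm D q],
      IsDef D fun i v => IterRule E J (s i v) (t i v) (r i v) (q i v) := @isDef_iterRule _ _ _ _ _ hJ
  have : ∀ {s t r : Unit → (ℕ → X) → X} [IsTm D s] [IsTm D t] [IsTm D r],
      IsDef D fun i v => Rec E (OrdLt E) (IterRule E J (s i v)) (t i v) (r i v) :=
    @fun s t r _ _ _ => isDef_rec (D := D) (R := fun _ _ => OrdLt E) (Φ := fun _ => IterRule E J)
      inferInstance inferInstance
  unfold Iter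
  infer_instance

variable (hfun : ∀ x y y', J x y → J x y' → y = y')
include hfun

/-- The recursion produces at `n` the set `{J^n(x)}`, which is empty where the iterate is undefined,
so a partial `J` needs no default value. Membership is bounded by `x` together with the image under
`J` of the union of earlier values. -/
theorem goodRule_iterRule (Z : ZFModel E D) (x : X) : GoodRule D (OrdLt E) (IterRule E J x) where
  isDef := isDef_iterRule hJ
  total n f hdom _ huniq := by
    obtain ⟨c, hc⟩ := Z.exists_image Z.goodRel_ordLt hdom huniq
    obtain ⟨u, hu⟩ := Z.union c
    obtain ⟨d, hd⟩ := Z.replacement J hJ hfun u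
    obtain ⟨d', hd'⟩ := Z.exists_insert d x
    obtain ⟨y, hy⟩ := Z.separation (fun t => IterRule E J x n f t) (isDef_iterRule hJ) d'
    refine ⟨y, fun t => (hy t).trans ⟨fun h => h.2, fun h => ⟨(hd' t).2 ?_, h⟩⟩⟩
    rcases h with ⟨-, rfl⟩ | ⟨m, s, v, -, hs, hv, hvt⟩
    · exact Or.inr rfl
    · exact Or.inl ((hd t).2 ⟨v, (hu v).2 ⟨s, (hc s).2 ⟨m, hs⟩, hv⟩, hvt⟩)

theorem iter_zero (Z : ZFModel E D) {n : X} (hn : ∀ z, ¬ E z n) (x y : X) :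
    Iter E J n x y ↔ y = x := by
  have hG := Z.goodRule_iterRule hJ hfun x
  have key {s : X} (h : Rec E (OrdLt E) (IterRule E J x) n s) (y : X) : E y s ↔ y = x := by
    obtain ⟨f, -, hf⟩ := Z.rec_eq Z.goodRel_ordLt hG h
    refine (hf y).trans ⟨?_, fun h => Or.inl ⟨hn, h⟩⟩
    rintro (h | ⟨m, -, -, hm, -⟩)
    · exact h.2
    · exact (hn m ((hm m).2 (Or.inr rfl))).elim
  constructor
  · rintro ⟨s, hs, hy⟩
    exact (key hs y).1 hy
  · rintro rfl
    obtain ⟨s, hs⟩ := Z.rec_exists Z.goodRel_ordLt hG n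
    exact ⟨s, hs, (key hs y).2 rfl⟩

theorem iter_succ (Z : ZFModel E D) {n m : X} (hn : IsOrd E n) (h : IsSucc E n m) (x y : X) :
    Iter E J n x y ↔ ∃ u, Iter E J m x u ∧ J u y := by
  have hG := Z.goodRule_iterRule hJ hfun x
  have hm : E m n := (h m).2 (Or.inr rfl)
  have key {s : X} (hs : Rec E (OrdLt E) (IterRule E J x) n s) (y : X) :
      E y s ↔ ∃ u, Iter E J m x u ∧ J u y := by
    obtain ⟨f, hf, hf'⟩ := Z.rec_eq Z.goodRel_ordLt hG hs
    refine (hf' y).trans ⟨?_, ?_⟩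
    · rintro (h' | ⟨m', s, u, hm', hs, hu, huy⟩)
      · exact (h'.1 m hm).elim
      · obtain rfl := Z.succ_inj h hm'
        exact ⟨u, ⟨s, ((hf m s).1 hs).2, hu⟩, huy⟩
    · rintro ⟨u, ⟨s, hs, hu⟩, huy⟩
      exact Or.inr ⟨m, s, u, h, (hf m s).2 ⟨⟨hn, hm⟩, hs⟩, hu, huy⟩
  constructor
  · rintro ⟨s, hs, hy⟩
    exact (key hs y).1 hy
  · intro hy
    obtain ⟨s, hs⟩ := Z.rec_exists Z.goodRel_ordLt hG n
    exact ⟨s, hs, (key hs y).2 hy⟩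

end ZFModel

end Iterates

/-! ### Absoluteness of `Δ₀` formulas between transitive classes -/

section Absoluteness

variable {S : Type u} {E : S → S → Prop} {K N : Set S}

theorem IsDelta0.bSat_iff {α : Type v} {n : ℕ} {χ : setLang.BoundedFormula α n} (h : IsDelta0 χ)
    (hKN : K ⊆ N) (htr : IsTransClass E K) (v : α → K) (xs : Fin n → K) :
    BSat (sub E K) χ v xs ↔
      BSat (sub E N) χ (fun a => ⟨v a, hKN (v a).2⟩) (fun i => ⟨xs i, hKN (xs i).2⟩) := by
  have key : ∀ {n : ℕ} (xs : Fin n → K) (x : α ⊕ Fin n),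
      Sum.elim (fun a => (⟨v a, hKN (v a).2⟩ : N)) (fun i => ⟨xs i, hKN (xs i).2⟩) x =
        ⟨(Sum.elim v xs x : K), hKN (Sum.elim v xs x : K).2⟩ := by
    rintro n xs (x | x) <;> rfl
  induction h with
  | falsum => exact Iff.rfl
  | mem x y => rw [bSat_mem, bSat_mem, key, key]
  | equal x y =>
    rw [bSat_equal, bSat_equal, key, key]
    simp [Subtype.ext_iff]
  | imp _ _ h₁ h₂ => exact imp_congr (h₁ xs) (h₂ xs)
  | @ball n x φ _ h =>
    rw [bSat_ball, bSat_ball, key]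
    have hs (a : K) : (fun i => (⟨(Fin.snoc xs a : Fin (n + 1) → K) i, hKN (Subtype.mem _)⟩ : N)) =
        Fin.snoc (fun i => ⟨xs i, hKN (xs i).2⟩) ⟨a, hKN a.2⟩ := by
      funext i
      refine Fin.lastCases ?_ (fun i => ?_) i <;> simp
    constructor
    · intro H a ha
      have := (h _).1 (H ⟨a, htr _ (Subtype.mem _) a ha⟩ ha)
      rwa [hs] at this
    · intro H a ha
      refine (h _).2 ?_
      rw [hs]
      exact H ⟨a, hKN a.2⟩ ha

theorem IsDelta0.sat_iff {α : Type v} {φ : setLang.Formula α} (h : IsDelta0 φ)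
    (hKN : K ⊆ N) (htr : IsTransClass E K) (v : α → K) :
    Sat E K φ v ↔ Sat E N φ fun a => ⟨v a, hKN (v a).2⟩ := by
  refine (h.bSat_iff hKN htr v default).trans ?_
  rw [iff_iff_eq]
  unfold BSat Sat Formula.Realize
  congr 1
  exact Subsingleton.elim _ _

theorem sat_iff_true {α : Type v} (E : S → S → Prop) (N : Set S) (φ : setLang.Formula α)
    (v : α → N) : Sat E N φ v ↔ RelSatF (sub E N) (fun _ => True) φ v :=
  realize_iff_relSatF (sub E N) φ v

theorem isOrd_sub (hN : IsTransClass E N) (x : N) : IsOrd (sub E N) x ↔ IsOrd E (x : S) := by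
  constructor
  · intro h
    refine ⟨fun y hy z hz => ?_, fun y hy z hz t ht => ?_⟩
    · have hyN := hN x x.2 y hy
      exact h.1 ⟨y, hyN⟩ hy ⟨z, hN y hyN z hz⟩ hz
    · have hyN := hN x x.2 y hy
      have hzN := hN y hyN z hz
      exact h.2 ⟨y, hyN⟩ hy ⟨z, hzN⟩ hz ⟨t, hN z hzN t ht⟩ ht
  · intro h
    exact ⟨fun y hy z hz => h.1 y hy z hz, fun y hy z hz t ht => h.2 y hy z hz t ht⟩

end Absoluteness

section

variable {ι : Type u} {X : ι → Type v} {E : ∀ i, X i → X i → Prop} {D : DefSystem E}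
variable {s t r p : ∀ i, (ℕ → X i) → X i}

instance isDef_sat₂ (φ : setLang.Formula (Fin 2)) [IsTm D s] [IsTm D t] :
    IsDef D fun i v => RelSatF (E i) (fun _ => True) φ ![s i v, t i v] :=
  isDef_relSatF₂ (C := fun _ _ _ => True) inferInstance φ s s t

instance isDef_sat₃ (φ : setLang.Formula (Fin 3)) [IsTm D s] [IsTm D t] [IsTm D r] :
    IsDef D fun i v => RelSatF (E i) (fun _ => True) φ ![s i v, t i v, r i v] :=
  isDef_relSatF₃ (C := fun _ _ _ => True) inferInstance φ s s t r

instance isDef_sat₂_in (ψ φ : setLang.Formula (Fin 2)) [IsTm D p] [IsTm D s] [IsTm D t] :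
    IsDef D fun i v => RelSatF (E i) (fun x => RelSatF (E i) (fun _ => True) ψ ![x, p i v])
      φ ![s i v, t i v] :=
  isDef_relSatF₂ (C := fun i p x => RelSatF (E i) (fun _ => True) ψ ![x, p]) inferInstance φ p s t

instance isDef_sat₃_in (ψ : setLang.Formula (Fin 2)) (φ : setLang.Formula (Fin 3)) [IsTm D p]
    [IsTm D s] [IsTm D t] [IsTm D r] :
    IsDef D fun i v => RelSatF (E i) (fun x => RelSatF (E i) (fun _ => True) ψ ![x, p i v])
      φ ![s i v, t i v, r i v] :=
  isDef_relSatF₃ (C := fun i p x => RelSatF (E i) (fun _ => True) ψ ![x, p]) inferInstance φ p s t r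

end

/-! ### The embedding and its iterates -/

section Setup

variable {S : Type u} {E : S → S → Prop} {𝒞 : Set (Set S)} {M N : Set S}

/-- The graph of `j`. -/
def Graph (j : M → N) (x y : S) : Prop := ∃ h : x ∈ M, (j ⟨x, h⟩ : S) = y

/-- A cofinal `Δ₀`-elementary embedding `j : M → N` with `j b = b`, where `M ⊆ N` is defined in `N`
by `ψ` from `b`. -/
structure DefinableEmbedding (E : S → S → Prop) (𝒞 : Set (Set S)) (M N : Set S) (j : M → N) (b : S)
    (ψ : setLang.Formula (Fin 2)) : Prop where
  ngb : IsNGB E 𝒞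
  classM : M ∈ 𝒞
  classN : N ∈ 𝒞
  transM : IsTransClass E M
  transN : IsTransClass E N
  auM : AlmostUniversal E M
  auN : AlmostUniversal E N
  subset : M ⊆ N
  graph : {p | ∃ x : M, IsPair E p x (j x)} ∈ 𝒞
  delta0 : PreservesDelta0 E j
  cofinal : ∀ y : N, ∃ x : M, E y (j x)
  param : b ∈ M
  fixed : Graph j b b
  defined : ∀ x : N, (x : S) ∈ M ↔ Sat E N ψ ![x, ⟨b, subset param⟩]

/-- The `n`-th iterate of `J` is a cofinal embedding of an almost universal transitive subclass of
`N` into `N` that fixes `b`. -/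
def IterGood (E : S → S → Prop) (N : Set S) (J : S → S → Prop) (b n : S) : Prop :=
  (∀ x y y', x ∈ N → Iter E J n x y → Iter E J n x y' → y = y') ∧
  (∀ x y, x ∈ N → Iter E J n x y → y ∈ N) ∧
  (∀ x y z, x ∈ N → Iter E J n x y → E z x → ∃ w, Iter E J n z w) ∧
  (∀ s, (∀ z, E z s → z ∈ N ∧ ∃ w, Iter E J n z w) →
    ∃ c w, c ∈ N ∧ Iter E J n c w ∧ ∀ z, E z s → E z c) ∧
  (∀ y, y ∈ N → ∃ x w, x ∈ N ∧ Iter E J n x w ∧ E y w) ∧ Iter E J n b b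

/-- The domain of the `n`-th iterate. -/
def iterDom (E : S → S → Prop) (N : Set S) (J : S → S → Prop) (n : S) : Set S :=
  {x | x ∈ N ∧ ∃ y, Iter E J n x y}

namespace DefinableEmbedding

variable {j : M → N} {b : S} {ψ : setLang.Formula (Fin 2)}

theorem zf (H : DefinableEmbedding E 𝒞 M N j b ψ) : ZFModel E (classSystem E 𝒞) := H.ngb.zfModel

section

variable (H : DefinableEmbedding E 𝒞 M N j b ψ)
include H

theorem isDef_graph : IsDef (classSystem E 𝒞) fun _ v => Graph j (v 0) (v 1) := by
  have := @isDef_mem_class S E 𝒞 _ H.graph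
  have h : IsDef (classSystem E 𝒞) fun _ v =>
    ∃ p, p ∈ {p | ∃ x : M, IsPair E p x (j x)} ∧ IsPair E p (v 0) (v 1) := inferInstance
  refine h.congr fun _ v => ⟨?_, ?_⟩
  · rintro ⟨p, ⟨x, hx⟩, hp⟩
    obtain ⟨h1, h2⟩ := H.zf.pair_inj hp hx
    exact ⟨h1 ▸ x.2, by rw [h2]; congr 2; exact Subtype.ext h1⟩
  · rintro ⟨h, hj⟩
    obtain ⟨p, hp⟩ := H.zf.exists_pair (v 0) (v 1)
    exact ⟨p, ⟨⟨v 0, h⟩, hj ▸ hp⟩, hp⟩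

omit H in
theorem graph_unique (j : M → N) (x y y' : S) (h : Graph j x y) (h' : Graph j x y') : y = y' := by
  obtain ⟨h, rfl⟩ := h
  obtain ⟨h', rfl⟩ := h'
  rfl

theorem iter_zero {n : S} (hn : ∀ z, ¬ E z n) (x y : S) : Iter E (Graph j) n x y ↔ y = x :=
  H.zf.iter_zero H.isDef_graph (graph_unique j) hn x y

theorem iter_succ {n m : S} (hn : IsOrd E n) (h : IsSucc E n m) (x y : S) :
    Iter E (Graph j) n x y ↔ ∃ u, Iter E (Graph j) m x u ∧ Graph j u y :=
  H.zf.iter_succ H.isDef_graph (graph_unique j) hn h x y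

/-- Definability of this statement in `n` is what permits induction over possibly nonstandard finite
ordinals; elementarity of `j^n` could not be used as an induction hypothesis. -/
theorem isDef_iterGood : IsDef (classSystem E 𝒞) fun _ v => IterGood E N (Graph j) b (v 0) := by
  have h1 := @ZFModel.isDef_iter _ _ _ _ _ H.isDef_graph
  have h2 := @isDef_mem_class S E 𝒞 _ H.classN
  unfold IterGood
  infer_instance

/-- Iterates preserve `Δ₀` formulas. -/
theorem iter_delta0 {m : ℕ} {φ : setLang.Formula (Fin m)} (hφ : IsDelta0 φ) {n : S}
    (hn : IsFin E n) : ∀ v w : Fin m → S,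
      (∀ i, v i ∈ N ∧ w i ∈ N ∧ Iter E (Graph j) n (v i) (w i)) →
      (RelSatF E (· ∈ N) φ v ↔ RelSatF E (· ∈ N) φ w) := by
  have h1 := @ZFModel.isDef_iter _ _ _ _ _ H.isDef_graph
  have h2 := @isDef_mem_class S E 𝒞 _ H.classN
  refine H.zf.fin_induction (fun n => ∀ v w : Fin m → S,
      (∀ i, v i ∈ N ∧ w i ∈ N ∧ Iter E (Graph j) n (v i) (w i)) →
      (RelSatF E (· ∈ N) φ v ↔ RelSatF E (· ∈ N) φ w)) ?_ ?_ ?_ n hn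
  · refine isDef_all_fin m (isDef_all_fin m ?_)
    refine @isDef_imp _ _ _ _ _ _ (isDef_forall_fin fun i => inferInstance)
      (@isDef_iff _ _ _ _ _ _ ?_ ?_)
    · exact isDef_relSatF (C := fun _ _ x => x ∈ N) h2 φ (fun _ w => w 0) _ fun a => inferInstance
    · exact isDef_relSatF (C := fun _ _ x => x ∈ N) h2 φ (fun _ w => w 0) _ fun a => inferInstance
  · intro n hn v w h
    rw [show w = v from funext fun i => (H.iter_zero hn _ _).1 (h i).2.2]
  · intro n m hm hnm ih v w h
    have hnO : IsOrd E n := by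
      obtain ⟨σ, hσ, h⟩ := H.zf.ord_succ hm.1
      rwa [H.zf.ext n σ fun z => (hnm z).trans (h z).symm]
    choose u hu using fun i => (H.iter_succ hnO hnm _ _).1 (h i).2.2
    choose huM hu' using fun i => (hu i).2
    rw [ih v u fun i => ⟨(h i).1, H.subset (huM i), (hu i).1⟩]
    have e1 := sat_iff_relSatF E N φ fun i => ⟨u i, H.subset (huM i)⟩
    have e2 := sat_iff_relSatF E N φ fun i => ⟨w i, (h i).2.1⟩
    refine e1.symm.trans (Iff.trans ?_ e2)
    -- The intermediate values `u i` lie in `M`. A `Δ₀` formula has the same truth value at them in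
    -- `N` and in `M`, and from there `j` carries it to the `w i` in `N`.
    have e3 := hφ.sat_iff H.subset H.transM (fun i => ⟨u i, huM i⟩)
    refine e3.symm.trans ((H.delta0 _ φ hφ _).trans ?_)
    rw [show (fun i => j ⟨u i, huM i⟩) = fun i => ⟨w i, (h i).2.1⟩ from
      funext fun i => Subtype.ext (hu' i)]

omit H in
theorem iterDom_subset (n : S) : iterDom E N (Graph j) n ⊆ N := fun _ h => h.1

theorem iterDom_mem (n : S) : iterDom E N (Graph j) n ∈ 𝒞 := by
  have h1 := @ZFModel.isDef_iter _ _ _ _ _ H.isDef_graph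
  have h2 := @isDef_mem_class S E 𝒞 _ H.classN
  exact H.ngb.mem_of_isDef (P := fun x => x ∈ N ∧ ∃ y, Iter E (Graph j) n x y) inferInstance

/-- The `n`-th iterate is elementary. -/
theorem exists_iter {n : S} (hn : IsFin E n)
    (hg : IterGood E N (Graph j) b n) :
    ∃ k : iterDom E N (Graph j) n → N, (∀ x : iterDom E N (Graph j) n, Iter E (Graph j) n x (k x)) ∧
      (∀ (x : iterDom E N (Graph j) n) (y : S), Iter E (Graph j) n x y → y = (k x : S)) ∧
      PreservesDelta0 E k ∧ (∀ y : N, ∃ x, E y (k x)) ∧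
      IsTransClass E (iterDom E N (Graph j) n) ∧ AlmostUniversal E (iterDom E N (Graph j) n) ∧
      (∃ hb : b ∈ iterDom E N (Graph j) n, k ⟨b, hb⟩ = ⟨b, H.subset H.param⟩) ∧
      ∀ (m : ℕ) (φ : setLang.Formula (Fin m)) (v : Fin m → iterDom E N (Graph j) n),
        Sat E (iterDom E N (Graph j) n) φ v ↔ Sat E N φ fun i => k (v i) := by
  obtain ⟨g1, g2, g3, g4, g5, g6⟩ := hg
  choose k hk using fun x : iterDom E N (Graph j) n => x.2.2
  have huniq : ∀ x : iterDom E N (Graph j) n, ∀ y, Iter E (Graph j) n x y → y = k x :=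
    fun x y h => g1 x y _ x.2.1 h (hk x)
  have htr : IsTransClass E (iterDom E N (Graph j) n) := fun x hx y hy =>
    ⟨H.transN x hx.1 y hy, g3 x _ y hx.1 hx.2.choose_spec hy⟩
  have hau : AlmostUniversal E (iterDom E N (Graph j) n) := fun s hs => by
    obtain ⟨c, w, hc, hw, h⟩ := g4 s hs
    exact ⟨c, ⟨hc, w, hw⟩, h⟩
  let k' : iterDom E N (Graph j) n → N := fun x => ⟨k x, g2 x _ x.2.1 (hk x)⟩
  have hd : PreservesDelta0 E k' := fun m φ hφ v => by
    refine (hφ.sat_iff (iterDom_subset n) htr v).trans ((sat_iff_relSatF E N φ _).trans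
      ((H.iter_delta0 hφ hn _ _ fun i => ⟨(v i).2.1, (k' (v i)).2, hk (v i)⟩).trans
      (sat_iff_relSatF E N φ _).symm))
  have hcof : ∀ y : N, ∃ x, E y (k' x) := fun y => by
    obtain ⟨x, w, hx, hw, hy⟩ := g5 y y.2
    refine ⟨⟨x, hx, w, hw⟩, ?_⟩
    rwa [huniq ⟨x, hx, w, hw⟩ w hw] at hy
  have hb : b ∈ iterDom E N (Graph j) n := ⟨H.subset H.param, b, g6⟩
  exact ⟨k', hk, huniq, hd, hcof, htr, hau, ⟨hb, Subtype.ext (huniq ⟨b, hb⟩ b g6).symm⟩,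
    fun m φ v => sat_iff_of_cofinal H.zf (H.iterDom_mem n) htr hau hd hcof ⟨b, hb⟩ φ v⟩

end

end DefinableEmbedding

end Setup

/-! ### Transfer along elementary maps, and descent through the iterates -/

section

variable {S : Type u} {E : S → S → Prop} {𝒞 : Set (Set S)}

/-- The structure `(N, ∈)`. -/
abbrev inRel (E : S → S → Prop) (N : Set S) : BinRel.{u} := ⟨N, sub E N⟩

/-- A uniformly definable predicate is given by a formula in every class. -/
theorem exists_sat_formula {m : ℕ} {P : ∀ i : BinRel.{u}, (Fin (m + 1) → i.carrier) → Prop}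
    (h : IsDef uniformSystem fun i v => P i fun k => v k) :
    ∃ φ : setLang.Formula (Fin (m + 1)), ∀ (N : Set S) (v : Fin (m + 1) → N),
      Sat E N φ v ↔ P (inRel E N) v :=
  (exists_formula h).imp fun _ hφ N v => hφ (inRel E N) v

theorem exists_sat_formula₁ {P : ∀ i : BinRel.{u}, i.carrier → Prop}
    (h : IsDef uniformSystem fun i v => P i (v 0)) :
    ∃ φ : setLang.Formula (Fin 1), ∀ (N : Set S) (x : N),
      Sat E N φ ![x] ↔ P (inRel E N) x :=
  (exists_sat_formula (m := 0) (P := fun i v => P i (v 0)) h).imp fun _ hφ N _ => hφ N _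

theorem exists_sat_formula₂ {P : ∀ i : BinRel.{u}, i.carrier → i.carrier → Prop}
    (h : IsDef uniformSystem fun i v => P i (v 0) (v 1)) :
    ∃ φ : setLang.Formula (Fin 2), ∀ (N : Set S) (x y : N),
      Sat E N φ ![x, y] ↔ P (inRel E N) x y :=
  (exists_sat_formula (m := 1) (P := fun i v => P i (v 0) (v 1)) h).imp fun _ hφ N _ _ => hφ N _

theorem exists_sat_formula₃ {P : ∀ i : BinRel.{u}, i.carrier → i.carrier → i.carrier → Prop}
    (h : IsDef uniformSystem fun i v => P i (v 0) (v 1) (v 2)) :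
    ∃ φ : setLang.Formula (Fin 3), ∀ (N : Set S) (x y z : N),
      Sat E N φ ![x, y, z] ↔ P (inRel E N) x y z :=
  (exists_sat_formula (m := 2) (P := fun i v => P i (v 0) (v 1) (v 2)) h).imp
    fun _ hφ N _ _ _ => hφ N _

/-- Elementary maps between classes. -/
def Elementary (E : S → S → Prop) {K N : Set S} (k : K → N) : Prop :=
  ∀ (m : ℕ) (φ : setLang.Formula (Fin m)) (v : Fin m → K), Sat E K φ v ↔ Sat E N φ fun i => k (v i)

theorem comp_vec₁ {α : Type u} {β : Type v} (k : α → β) (x : α) :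
    (fun i => k ((![x] : Fin 1 → α) i)) = ![k x] := by
  funext i; fin_cases i; rfl

theorem comp_vec₂ {α : Type u} {β : Type v} (k : α → β) (x y : α) :
    (fun i => k ((![x, y] : Fin 2 → α) i)) = ![k x, k y] := by
  funext i; fin_cases i <;> rfl

theorem comp_vec₃ {α : Type u} {β : Type v} (k : α → β) (x y z : α) :
    (fun i => k ((![x, y, z] : Fin 3 → α) i)) = ![k x, k y, k z] := by
  funext i; fin_cases i <;> rfl

section

variable {K N : Set S} {k : K → N} (hk : Elementary E k)
include hk

/-- Uniform definability means that one formula expresses `P` in both structures, so an elementary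
map transfers `P` without the formula being written down. -/
theorem Elementary.iff₁ {P : ∀ i : BinRel.{u}, i.carrier → Prop}
    (h : IsDef uniformSystem fun i v => P i (v 0)) (x : K) :
    P (inRel E K) x ↔ P (inRel E N) (k x) := by
  obtain ⟨φ, hφ⟩ := exists_sat_formula₁ (E := E) h
  rw [← hφ, ← hφ, hk, comp_vec₁]

theorem Elementary.iff₂ {P : ∀ i : BinRel.{u}, i.carrier → i.carrier → Prop}
    (h : IsDef uniformSystem fun i v => P i (v 0) (v 1)) (x y : K) :
    P (inRel E K) x y ↔ P (inRel E N) (k x) (k y) := by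
  obtain ⟨φ, hφ⟩ := exists_sat_formula₂ (E := E) h
  rw [← hφ, ← hφ, hk, comp_vec₂]

theorem Elementary.iff₃ {P : ∀ i : BinRel.{u}, i.carrier → i.carrier → i.carrier → Prop}
    (h : IsDef uniformSystem fun i v => P i (v 0) (v 1) (v 2)) (x y z : K) :
    P (inRel E K) x y z ↔ P (inRel E N) (k x) (k y) (k z) := by
  obtain ⟨φ, hφ⟩ := exists_sat_formula₃ (E := E) h
  rw [← hφ, ← hφ, hk, comp_vec₃]

end

/-- `x` satisfies `ψ` with the parameter `b`. -/
def Holds (ψ : setLang.Formula (Fin 2)) (i : BinRel.{u}) (x b : i.carrier) : Prop :=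
  RelSatF i.rel (fun _ => True) ψ ![x, b]

/-- `u` satisfies `ψ`, and every element of `w` that satisfies `ψ` is an element and a subset
of `u`. -/
def CoverIn (ψ : setLang.Formula (Fin 2)) (i : BinRel.{u}) (w u b : i.carrier) : Prop :=
  Holds ψ i u b ∧ ∀ x, i.rel x w → Holds ψ i x b → i.rel x u ∧ ∀ z, i.rel z x → i.rel z u

/-- `x` is the least ordinal that satisfies `δ`. -/
def LeastOrd (δ : ∀ i : BinRel.{u}, i.carrier → i.carrier → Prop) (i : BinRel.{u})
    (x b : i.carrier) : Prop :=
  IsOrd i.rel x ∧ δ i x b ∧ ∀ y, i.rel y x → ¬ δ i y b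

section

variable {s t r q : ∀ i : BinRel.{u}, (ℕ → i.carrier) → i.carrier}

instance isDef_holds (ψ : setLang.Formula (Fin 2)) [IsTm uniformSystem s] [IsTm uniformSystem t] :
    IsDef uniformSystem fun i v => Holds ψ i (s i v) (t i v) := by
  unfold Holds; infer_instance

instance isDef_coverIn (ψ : setLang.Formula (Fin 2)) [hs : IsTm uniformSystem s]
    [ht : IsTm uniformSystem t] [hr : IsTm uniformSystem r] :
    IsDef uniformSystem fun i v => CoverIn ψ i (s i v) (t i v) (r i v) := by
  refine IsDef.subst₃ (R := CoverIn ψ) ?_ hs ht hr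
  unfold CoverIn
  infer_instance

theorem isDef_leastOrd {δ : ∀ i : BinRel.{u}, i.carrier → i.carrier → Prop}
    (hδ : IsDef uniformSystem fun i v => δ i (v 0) (v 1)) :
    IsDef uniformSystem fun i v => LeastOrd δ i (v 0) (v 1) := by
  have hδ' : ∀ {s t : ∀ i : BinRel.{u}, (ℕ → i.carrier) → i.carrier} [IsTm uniformSystem s]
      [IsTm uniformSystem t], IsDef uniformSystem fun i v => δ i (s i v) (t i v) :=
    hδ.subst₂ ‹_› ‹_›
  unfold LeastOrd
  infer_instance

end

theorem sat_iff_holds {N : Set S} (φ : setLang.Formula (Fin 2)) (x b : N) :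
    Sat E N φ ![x, b] ↔ Holds φ (inRel E N) x b := sat_iff_true E N φ _

namespace DefinableEmbedding

variable {M N : Set S} {j : M → N} {b : S} {ψ : setLang.Formula (Fin 2)}
  (H : DefinableEmbedding E 𝒞 M N j b ψ)
include H

theorem elementary : Elementary E j := fun _ φ v =>
  sat_iff_of_cofinal H.zf H.classM H.transM H.auM H.delta0 H.cofinal ⟨b, H.param⟩ φ v

theorem j_param : j ⟨b, H.param⟩ = ⟨b, H.subset H.param⟩ := by
  obtain ⟨h, h'⟩ := H.fixed
  exact Subtype.ext h'

/-- Almost universality of `M`, phrased as a statement about `ψ` and `b` in `N`. In this form it can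
be pulled back along the iterates. -/
theorem exists_coverIn (w : N) : ∃ u, CoverIn ψ (inRel E N) w u ⟨b, H.subset H.param⟩ := by
  have := @isDef_mem_class S E 𝒞 _ H.classM
  obtain ⟨a, ha⟩ := H.zf.union w
  obtain ⟨c, hc⟩ := H.zf.exists_union₂ w a
  obtain ⟨s, hs⟩ := H.zf.separation (· ∈ M) inferInstance c
  obtain ⟨u, hu, h⟩ := H.auM s fun z hz => ((hs z).1 hz).2
  have hd (x : N) : Holds ψ (inRel E N) x ⟨b, H.subset H.param⟩ ↔ (x : S) ∈ M := by
    rw [H.defined, sat_iff_holds]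
  refine ⟨⟨u, H.subset hu⟩, (hd _).2 hu, fun x hx hxM => ⟨?_, fun z hz => ?_⟩⟩
  · exact h x ((hs x).2 ⟨(hc x).2 (Or.inl hx), (hd x).1 hxM⟩)
  · exact h z ((hs z).2 ⟨(hc z).2 (Or.inr ((ha z).2 ⟨x, hx, hz⟩)), H.transM x ((hd x).1 hxM) z hz⟩)

/-- Internal induction on `n`. For `n = m + 1` let `k = j^m` with domain `K`; it is elementary by
the induction hypothesis. The domain of `j^n` consists of the `x ∈ K` with `k(x) ∈ M`, so it is
defined in `K` by `ψ` from `b`, and pulling back `exists_coverIn` yields its almost universality. -/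
theorem iterGood {n : S} (hn : IsFin E n) : IterGood E N (Graph j) b n := by
  refine H.zf.fin_induction _ H.isDef_iterGood ?_ ?_ n hn
  · intro n hn
    have h0 := H.iter_zero hn
    refine ⟨?_, ?_, ?_, ?_, ?_, ?_⟩
    · intro x y y' _ h h'
      rw [(h0 x y).1 h, (h0 x y').1 h']
    · intro x y hx h
      rwa [(h0 x y).1 h]
    · intro x y z _ _ _
      exact ⟨z, (h0 z z).2 rfl⟩
    · intro s hs
      obtain ⟨c, hc, h⟩ := H.auN s fun z hz => (hs z hz).1
      exact ⟨c, c, hc, (h0 c c).2 rfl, h⟩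
    · intro y hy
      obtain ⟨s, hs⟩ := H.zf.exists_singleton y
      obtain ⟨c, hc, h⟩ := H.auN s fun z hz => (hs z).1 hz ▸ hy
      exact ⟨c, c, hc, (h0 c c).2 rfl, h y ((hs y).2 rfl)⟩
    · exact (h0 b b).2 rfl
  · intro n m hm hnm ih
    have hnO : IsOrd E n := by
      obtain ⟨σ, hσ, h⟩ := H.zf.ord_succ hm.1
      rwa [H.zf.ext n σ fun z => (hnm z).trans (h z).symm]
    have hS := H.iter_succ hnO hnm
    obtain ⟨k, hk, huniq, hd, hcof, htr, hau, ⟨hb, hkb⟩, hel⟩ := H.exists_iter hm ih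
    have hel : Elementary E k := hel
    obtain ⟨g1, g2, g3, -, -, g6⟩ := ih
    have hdef (x : N) : Holds ψ (inRel E N) x ⟨b, H.subset H.param⟩ ↔ (x : S) ∈ M := by
      rw [H.defined, sat_iff_holds]
    have hS' (x : iterDom E N (Graph j) m) (hx : (k x : S) ∈ M) :
        Iter E (Graph j) n x (j ⟨k x, hx⟩) := (hS _ _).2 ⟨k x, hk x, hx, rfl⟩
    have hcover (w : iterDom E N (Graph j) m) :
        ∃ u, CoverIn ψ (inRel E (iterDom E N (Graph j) m)) w u ⟨b, hb⟩ := by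
      refine (hel.iff₂ (P := fun i w b => ∃ u, CoverIn ψ i w u b) inferInstance w ⟨b, hb⟩).2 ?_
      rw [hkb]
      exact H.exists_coverIn _
    refine ⟨?_, ?_, ?_, ?_, ?_, ?_⟩
    · intro x y y' hx h h'
      obtain ⟨u, hu, huy⟩ := (hS x y).1 h
      obtain ⟨u', hu', huy'⟩ := (hS x y').1 h'
      obtain rfl := g1 x u u' hx hu hu'
      exact graph_unique j u y y' huy huy'
    · intro x y hx h
      obtain ⟨u, -, hu, rfl⟩ := (hS x y).1 h
      exact Subtype.mem _
    · intro x y z hx h hzx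
      obtain ⟨u, hu, hu', -⟩ := (hS x y).1 h
      have hxK : x ∈ iterDom E N (Graph j) m := ⟨hx, u, hu⟩
      obtain rfl := huniq ⟨x, hxK⟩ u hu
      have hzK := htr x hxK z hzx
      have hkz := H.transM _ hu' _ ((hd.mem_iff ⟨z, hzK⟩ ⟨x, hxK⟩).1 hzx)
      exact ⟨_, hS' ⟨z, hzK⟩ hkz⟩
    · intro s hs
      have hs' (z : S) (hz : E z s) : ∃ h : z ∈ iterDom E N (Graph j) m, (k ⟨z, h⟩ : S) ∈ M := by
        obtain ⟨hzN, w, hw⟩ := hs z hz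
        obtain ⟨u, hu, hu', -⟩ := (hS z w).1 hw
        have hzK : z ∈ iterDom E N (Graph j) m := ⟨hzN, u, hu⟩
        exact ⟨hzK, huniq ⟨z, hzK⟩ u hu ▸ hu'⟩
      obtain ⟨w, hw, hsw⟩ := hau s fun z hz => (hs' z hz).1
      obtain ⟨u, hu⟩ := hcover ⟨w, hw⟩
      have huM : (k u : S) ∈ M := by
        have := (hel.iff₂ (P := Holds ψ) inferInstance u ⟨b, hb⟩).1 hu.1
        rw [hkb] at this
        exact (hdef _).1 this
      refine ⟨u, _, u.2.1, hS' u huM, fun z hz => ?_⟩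
      obtain ⟨hzK, hzM⟩ := hs' z hz
      refine (hu.2 ⟨z, hzK⟩ (hsw z hz) ?_).1
      refine (hel.iff₂ (P := Holds ψ) inferInstance _ ⟨b, hb⟩).2 ?_
      rw [hkb]
      exact (hdef _).2 hzM
    · intro y hy
      -- Cofinality: choose `y ∈ j(x)` and `x ∈ k(w)`, and let `u` cover `w` in `K`. Then `x ⊆ k(u)
      -- ∈ M`, hence `y ∈ j(x) ⊆ j(k(u))`.
      obtain ⟨x, hx⟩ := H.cofinal ⟨y, hy⟩
      obtain ⟨w, hw⟩ := hcof ⟨x, H.subset x.2⟩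
      obtain ⟨u, hu⟩ := hcover w
      have hu := (hel.iff₃ (P := CoverIn ψ) inferInstance w u ⟨b, hb⟩).1 hu
      rw [hkb] at hu
      have huM := (hdef _).1 hu.1
      obtain ⟨-, hsub⟩ := hu.2 ⟨x, H.subset x.2⟩ hw ((hdef _).2 x.2)
      refine ⟨u, _, u.2.1, hS' u huM, ?_⟩
      exact H.delta0.subset (c := ⟨k u, huM⟩) (fun z hz => hsub ⟨z, H.subset z.2⟩ hz) ⟨y, hy⟩ hx
    · exact (hS b b).2 ⟨b, g6, H.fixed⟩

theorem exists_iter' {n : S} (hn : IsFin E n) :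
    ∃ k : iterDom E N (Graph j) n → N, (∀ x : iterDom E N (Graph j) n, Iter E (Graph j) n x (k x)) ∧
      (∀ (x : iterDom E N (Graph j) n) (y : S), Iter E (Graph j) n x y → y = (k x : S)) ∧
      IsTransClass E (iterDom E N (Graph j) n) ∧
      (∃ hb : b ∈ iterDom E N (Graph j) n, k ⟨b, hb⟩ = ⟨b, H.subset H.param⟩) ∧
      Elementary E k := by
  obtain ⟨k, hk, huniq, -, -, htr, -, hb, hel⟩ := H.exists_iter hn (H.iterGood hn)
  exact ⟨k, hk, huniq, htr, hb, hel⟩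

/-- The domain of the next iterate is defined by `ψ` in the domain of an iterate. -/
theorem iterDom_succ {n m : S} (hm : IsFin E m) (hnm : IsSucc E n m)
    (hb : b ∈ iterDom E N (Graph j) m) (x : iterDom E N (Graph j) m) :
    Holds ψ (inRel E (iterDom E N (Graph j) m)) x ⟨b, hb⟩ ↔ (x : S) ∈ iterDom E N (Graph j) n := by
  have hnO : IsOrd E n := by
    obtain ⟨σ, hσ, h⟩ := H.zf.ord_succ hm.1
    rwa [H.zf.ext n σ fun z => (hnm z).trans (h z).symm]
  obtain ⟨k, hk, huniq, -, ⟨hb, hkb⟩, hel⟩ := H.exists_iter' hm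
  rw [hel.iff₂ (P := Holds ψ) inferInstance, hkb, ← sat_iff_holds, ← H.defined]
  constructor
  · intro h
    exact ⟨x.2.1, _, (H.iter_succ hnO hnm _ _).2 ⟨_, hk x, h, rfl⟩⟩
  · rintro ⟨-, y, hy⟩
    obtain ⟨u, hu, hu', -⟩ := (H.iter_succ hnO hnm _ _).1 hy
    rwa [← huniq x u hu]

theorem iterDom_subset_of_succ {n m : S} (hm : IsFin E m) (hnm : IsSucc E n m) :
    iterDom E N (Graph j) n ⊆ iterDom E N (Graph j) m := by
  have hnO : IsOrd E n := by
    obtain ⟨σ, hσ, h⟩ := H.zf.ord_succ hm.1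
    rwa [H.zf.ext n σ fun z => (hnm z).trans (h z).symm]
  rintro x ⟨hx, y, hy⟩
  obtain ⟨u, hu, -⟩ := (H.iter_succ hnO hnm _ _).1 hy
  exact ⟨hx, u, hu⟩

theorem iterDom_zero {n : S} (hn : ∀ z, ¬ E z n) : iterDom E N (Graph j) n = N :=
  Set.Subset.antisymm (iterDom_subset n) fun x hx => ⟨hx, x, (H.iter_zero hn x x).2 rfl⟩

/-- There is no infinite descent through the domains of the iterates. -/
theorem not_descending (lam : setLang.Formula (Fin 2)) (d₀ : N)
    (h₀ : Sat E N lam ![d₀, ⟨b, H.subset H.param⟩])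
    (hdesc : ∀ d : N, Sat E N lam ![d, ⟨b, H.subset H.param⟩] → ∃ d' : M, E d' d ∧
      Sat E M lam ![d', ⟨b, H.param⟩]) : False := by
  have h1 := @ZFModel.isDef_iter _ _ _ _ _ H.isDef_graph
  have h2 := @isDef_mem_class S E 𝒞 _ H.classN
  have hdom : IsDef (classSystem E 𝒞) fun _ v => v 1 ∈ iterDom E N (Graph j) (v 0) := by
    have : IsDef (classSystem E 𝒞) fun _ v => v 1 ∈ N ∧ ∃ y, Iter E (Graph j) (v 0) (v 1) y :=
      inferInstance
    exact this
  have hdom' : ∀ {s t : Unit → (ℕ → S) → S} [IsTm (classSystem E 𝒞) s]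
      [IsTm (classSystem E 𝒞) t],
      IsDef (classSystem E 𝒞) fun i v => s i v ∈ iterDom E N (Graph j) (t i v) :=
    @fun s t hs ht => hdom.subst₂ (R := fun _ n x => x ∈ iterDom E N (Graph j) n) ht hs
  have hsat : ∀ {s t : Unit → (ℕ → S) → S} [IsTm (classSystem E 𝒞) s]
      [IsTm (classSystem E 𝒞) t], IsDef (classSystem E 𝒞) fun i v =>
        RelSatF E (fun x => x ∈ iterDom E N (Graph j) (t i v)) lam ![s i v, b] :=
    @fun s t hs ht => isDef_relSatF₂ (C := fun _ n x => x ∈ iterDom E N (Graph j) n) hdom lam t s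
      (fun _ _ => b)
  -- Foundation is applied to the class of all `d` that satisfy `lam` in the domain of some iterate.
  obtain ⟨d, ⟨n, hn, hd, hlam⟩, hmin⟩ := H.zf.foundation (fun d => ∃ n, IsFin E n ∧
    d ∈ iterDom E N (Graph j) n ∧ RelSatF E (fun x => x ∈ iterDom E N (Graph j) n) lam ![d, b])
    inferInstance (by
      obtain ⟨e, he⟩ := H.zf.exists_empty
      refine ⟨d₀, e, ZFModel.isFin_empty he, ?_⟩
      rw [H.iterDom_zero he]
      refine ⟨d₀.2, ?_⟩
      have := (sat_iff_relSatF E N lam _).1 h₀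
      rwa [comp_vec₂] at this)
  obtain ⟨m, hm, hmn⟩ := H.zf.exists_isFin_succ hn
  obtain ⟨k, -, -, htr, ⟨hb, hkb⟩, hel⟩ := H.exists_iter' hn
  obtain ⟨-, -, -, -, ⟨hb', -⟩, -⟩ := H.exists_iter' hm
  let K := iterDom E N (Graph j) n
  have hlam' : Holds lam (inRel E K) ⟨d, hd⟩ ⟨b, hb⟩ := by
    rw [← sat_iff_holds, sat_iff_relSatF, comp_vec₂]
    exact hlam
  -- The descent hypothesis is one definable property of `d` and the parameter, truth in `M` being
  -- truth in `N` relativized to `ψ`. Hence it pulls back from `N` to the domain `K` of the iterate.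
  have key : ∀ d c : K, k c = ⟨b, H.subset H.param⟩ → Holds lam (inRel E K) d c →
      ∃ d', sub E K d' d ∧ Holds ψ (inRel E K) d' c ∧ RelSatF (sub E K) (fun x => RelSatF (sub E K) (fun _ => True) ψ ![x, c])
        lam ![d', c] := by
    intro d c hc
    refine (hel.iff₂ (P := fun i d b => Holds lam i d b → ∃ d', i.rel d' d ∧
      Holds ψ i d' b ∧
      RelSatF i.rel (fun x => RelSatF i.rel (fun _ => True) ψ ![x, b]) lam ![d', b])
      inferInstance d c).2 ?_
    rw [hc]
    intro h
    obtain ⟨d', hd', hs⟩ := hdesc _ ((sat_iff_holds _ _ _).2 h)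
    refine ⟨⟨d', H.subset d'.2⟩, hd', ?_, ?_⟩
    · rw [← sat_iff_holds, ← H.defined]
      exact d'.2
    have := (sat_iff_relSatF_sub E H.subset (fun x => Holds ψ (inRel E N) x ⟨b, H.subset H.param⟩)
      (fun x => by rw [H.defined, sat_iff_holds]) lam ![d', ⟨b, H.param⟩]).1 hs
    rwa [comp_vec₂ (fun x : M => (⟨x, H.subset x.2⟩ : N))] at this
  obtain ⟨d', hd', hψ, hs⟩ := key ⟨d, hd⟩ ⟨b, hb⟩ hkb hlam'
  have hmem := H.iterDom_succ hn hmn hb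
  have hd'm := (hmem d').1 hψ
  refine hmin d' hd' ⟨m, hm, hd'm, ?_⟩
  have := (sat_iff_relSatF_sub E (H.iterDom_subset_of_succ hn hmn)
    (fun x => Holds ψ (inRel E K) x ⟨b, hb⟩) hmem lam ![⟨d', hd'm⟩, ⟨b, hb'⟩]).2 (by
      rw [comp_vec₂ (fun x : iterDom E N (Graph j) m => (⟨x, H.iterDom_subset_of_succ hn hmn x.2⟩ : K))]
      exact hs)
  rwa [sat_iff_relSatF, comp_vec₂] at this

end DefinableEmbedding

end

/-! ### Least definable ordinals are fixed -/

section

variable {S : Type u} {E : S → S → Prop} {𝒞 : Set (Set S)}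

namespace DefinableEmbedding

variable {M N : Set S} {j : M → N} {b : S} {ψ : setLang.Formula (Fin 2)}
  (H : DefinableEmbedding E 𝒞 M N j b ψ)
include H

/-- Ordinals do not move down. -/
theorem not_j_mem (α : M) (hα : IsOrd E α) : ¬ E (j α) α := by
  have hg := H.isDef_graph
  have hg' : ∀ {s t : Unit → (ℕ → S) → S} [IsTm (classSystem E 𝒞) s]
      [IsTm (classSystem E 𝒞) t], IsDef (classSystem E 𝒞) fun i v => Graph j (s i v) (t i v) :=
    hg.subst₂ (R := fun _ => Graph j) ‹_› ‹_›
  intro h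
  obtain ⟨α, hα, ⟨β, ⟨hαM, rfl⟩, h⟩, hmin⟩ := H.zf.ord_min (fun α => ∃ β, Graph j α β ∧ E β α)
    inferInstance ⟨α, hα, j α, ⟨α.2, rfl⟩, h⟩
  have hβ := H.transM α hαM _ h
  -- Applying `j` to `j(α) ∈ α` gives `j(j(α)) ∈ j(α)`, so `j(α)` is a smaller ordinal that moves
  -- down.
  refine hmin _ h ⟨_, ⟨hβ, rfl⟩, ?_⟩
  exact (H.delta0.mem_iff ⟨_, hβ⟩ ⟨α, hαM⟩).1 h

theorem leastOrd_unique {δ : ∀ i : BinRel.{u}, i.carrier → i.carrier → Prop} {K : Set S}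
    (hK : IsTransClass E K) {x y c : K} (hx : LeastOrd δ (inRel E K) x c)
    (hy : LeastOrd δ (inRel E K) y c) : x = y := by
  rcases H.zf.ord_trichotomy ((isOrd_sub hK x).1 hx.1) ((isOrd_sub hK y).1 hy.1) with h | h | h
  · exact (hy.2.2 x h hx.2.1).elim
  · exact Subtype.ext h
  · exact (hx.2.2 y h hy.2.1).elim

/-- The least ordinal with a property that is definable from `b` in `N` is fixed by `j`. -/
theorem exists_fixed {δ : ∀ i : BinRel.{u}, i.carrier → i.carrier → Prop}
    (hδ : IsDef uniformSystem fun i v => δ i (v 0) (v 1))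
    (h : ∃ α : N, IsOrd E α ∧ δ (inRel E N) α ⟨b, H.subset H.param⟩) :
    ∃ α : M, IsOrd E α ∧ (j α : S) = α ∧ LeastOrd δ (inRel E N) (j α) ⟨b, H.subset H.param⟩ := by
  have hl := isDef_leastOrd hδ
  have hl' : ∀ {s t : ∀ i : BinRel.{u}, (ℕ → i.carrier) → i.carrier} [IsTm uniformSystem s]
      [IsTm uniformSystem t], IsDef uniformSystem fun i v => LeastOrd δ i (s i v) (t i v) :=
    hl.subst₂ ‹_› ‹_›
  have hN := @isDef_mem_class S E 𝒞 _ H.classN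
  obtain ⟨φ, hφ⟩ := exists_sat_formula₂ (E := E) hδ
  have hsat (x : N) : δ (inRel E N) x ⟨b, H.subset H.param⟩ ↔ RelSatF E (· ∈ N) φ ![(x : S), b] := by
    rw [← hφ, sat_iff_relSatF, comp_vec₂]
  have hd₀ : ∃ d₀ : N, LeastOrd δ (inRel E N) d₀ ⟨b, H.subset H.param⟩ := by
    obtain ⟨α, hα, hδα⟩ := h
    have hdef : IsDef (classSystem E 𝒞) fun _ v => RelSatF E (· ∈ N) φ ![v 0, b] :=
      isDef_relSatF₂ (C := fun _ _ x => x ∈ N) hN φ (fun _ v => v 0) (fun _ v => v 0) (fun _ _ => b)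
    obtain ⟨d, hd, ⟨hdN, hdδ⟩, hmin⟩ := H.zf.ord_min
      (fun x => x ∈ N ∧ RelSatF E (· ∈ N) φ ![x, b]) inferInstance ⟨α, hα, α.2, (hsat α).1 hδα⟩
    exact ⟨⟨d, hdN⟩, (isOrd_sub H.transN _).2 hd, (hsat _).2 hdδ,
      fun y hy hyδ => hmin y hy ⟨y.2, (hsat y).1 hyδ⟩⟩
  obtain ⟨d₀, hd₀⟩ := hd₀
  -- `M` has its own least ordinal `d₁`, and `j` maps it to the one of `N`.
  obtain ⟨d₁, hd₁⟩ := (H.elementary.iff₁ (P := fun i b => ∃ d, LeastOrd δ i d b) inferInstance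
    ⟨b, H.param⟩).2 (by rw [H.j_param]; exact ⟨d₀, hd₀⟩)
  have hj := (H.elementary.iff₂ hl d₁ _).1 hd₁
  rw [H.j_param] at hj
  have hO := (isOrd_sub H.transM _).1 hd₁.1
  refine ⟨d₁, hO, ?_, hj⟩
  rcases H.zf.ord_trichotomy hO ((isOrd_sub H.transN _).1 hj.1) with hlt | h | hlt
  · exfalso
    obtain ⟨lam, hlam⟩ := exists_sat_formula₂ (E := E) hl
    -- By uniqueness of least ordinals, the only `d` satisfying `lam` in `N` is `j(d₁)`, and `d₁` is
    -- below it and satisfies `lam` in `M`.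
    refine H.not_descending lam (j d₁) ((hlam _ _ _).2 hj) fun d hd => ⟨d₁, ?_, (hlam _ _ _).2 hd₁⟩
    rwa [H.leastOrd_unique H.transN ((hlam _ _ _).1 hd) hj]
  · exact h.symm
  · exact (H.not_j_mem d₁ hO hlt).elim

end DefinableEmbedding

end

/-! ### Goedel operations and codes of tuples -/

section Operations

variable {X : Type v} {E : X → X → Prop}

/-- `t` belongs to the result of the `k`-th operation on sets, applied to `x` and `y`. -/
def Op (E : X → X → Prop) : ℕ → X → X → X → Prop
  | 0, x, y, t => E t x ∧ ¬ E t y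
  | 1, x, y, t => ∃ u v, E u x ∧ E v y ∧ IsPair E t u v
  | 2, x, y, t => ∃ u v, E u x ∧ E v y ∧ E u v ∧ IsPair E t u v
  | 3, x, _, t => ∃ p, E p x ∧ ∃ u, IsPair E p u t
  | 4, x, _, t => ∃ p, E p x ∧ ∃ u v, IsPair E p v u ∧ IsPair E t u v
  | 5, x, _, t => ∃ p, E p x ∧ ∃ u v w q r, IsPair E r u v ∧ IsPair E p r w ∧
      IsPair E q v w ∧ IsPair E t u q
  | 6, x, _, t => ∃ p, E p x ∧ ∃ u v w q r, IsPair E r u w ∧ IsPair E p r v ∧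
      IsPair E q v w ∧ IsPair E t u q
  | _, x, _, t => ∃ y, E y x ∧ E t y

/-- `q` codes the tuple `v`. -/
def Code (E : X → X → Prop) : ∀ {n : ℕ}, (Fin n → X) → X → Prop
  | 0, _, q => ∀ z, ¬ E z q
  | n + 1, v, q => ∃ c, Code E (Fin.init v) c ∧ IsPair E q (v (Fin.last n)) c

theorem code_snoc {n : ℕ} (v : Fin n → X) (x q : X) :
    Code E (Fin.snoc v x : Fin (n + 1) → X) q ↔ ∃ c, Code E v c ∧ IsPair E q x c := by
  simp [Code]

theorem exists_snoc {n : ℕ} {P : (Fin (n + 1) → X) → Prop} :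
    (∃ v, P v) ↔ ∃ (v : Fin n → X) (x : X), P (Fin.snoc v x) :=
  ⟨fun ⟨v, h⟩ => ⟨Fin.init v, v (Fin.last n), by simpa using h⟩, fun ⟨_, _, h⟩ => ⟨_, h⟩⟩

theorem forall_snoc_mem {n : ℕ} (v : Fin n → X) (x : X) (P : X → Prop) :
    (∀ i, P ((Fin.snoc v x : Fin (n + 1) → X) i)) ↔ (∀ i, P (v i)) ∧ P x := by
  constructor
  · exact fun h => ⟨fun i => by simpa using h i.castSucc, by simpa using h (Fin.last n)⟩
  · rintro ⟨h, hx⟩ i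
    refine Fin.lastCases ?_ (fun i => ?_) i
    · simpa using hx
    · simpa using h i

end Operations

section

variable {ι : Type u} {X : ι → Type v} {E : ∀ i, X i → X i → Prop} {D : DefSystem E}
variable {s t r q : ∀ i, (ℕ → X i) → X i}

theorem isDef_op_base (k : ℕ) : IsDef D (fun i v => Op (E i) k (v 0) (v 1) (v 2)) := by
  rcases k with _ | _ | _ | _ | _ | _ | _ | k
  all_goals try (unfold Op; infer_instance)
  exact (inferInstance : IsDef D fun i v => ∃ y, E i y (v 0) ∧ E i (v 2) y)

instance (k : ℕ) [hs : IsTm D s] [ht : IsTm D t] [hr : IsTm D r] :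
    IsDef D (fun i v => Op (E i) k (s i v) (t i v) (r i v)) :=
  (isDef_op_base k).subst₃ hs ht hr

end

namespace ZFModel

variable {X : Type v} {E : X → X → Prop} {D : DefSystem (fun _ : Unit => E)} [HasParams D]

theorem exists_op (Z : ZFModel E D) (k : ℕ) (x y : X) : ∃ r, ∀ t, E t r ↔ Op E k x y t := by
  have hu := @pair_unique _ _ _ _ Z
  have hi := @pair_inj _ _ _ _ Z
  match k with
  | 0 => exact Z.separation (fun t => ¬ E t y) inferInstance x
  | 1 =>
    obtain ⟨c, hc⟩ := Z.exists_product x y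
    exact ⟨c, hc⟩
  | 2 =>
    obtain ⟨c, hc⟩ := Z.exists_product x y
    obtain ⟨d, hd⟩ := Z.separation (fun t => ∃ u v, E u v ∧ IsPair E t u v) inferInstance c
    refine ⟨d, fun t => (hd t).trans ⟨?_, ?_⟩⟩
    · rintro ⟨h, u, v, huv, ht⟩
      obtain ⟨u', v', hu', hv', ht'⟩ := (hc t).1 h
      obtain ⟨rfl, rfl⟩ := hi ht ht'
      exact ⟨_, _, hu', hv', huv, ht⟩
    · rintro ⟨u, v, hu, hv, huv, ht⟩
      exact ⟨(hc t).2 ⟨u, v, hu, hv, ht⟩, u, v, huv, ht⟩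
  | 3 =>
    refine Z.replacement (fun p t => ∃ u, IsPair E p u t) inferInstance ?_ x
    rintro p t t' ⟨u, h⟩ ⟨u', h'⟩
    exact (hi h h').2
  | 4 =>
    refine Z.replacement (fun p t => ∃ u v, IsPair E p v u ∧ IsPair E t u v) inferInstance ?_ x
    rintro p t t' ⟨u, v, h, ht⟩ ⟨u', v', h', ht'⟩
    obtain ⟨rfl, rfl⟩ := hi h h'
    exact hu ht ht'
  | 5 =>
    refine Z.replacement (fun p t => ∃ u v w q r, IsPair E r u v ∧ IsPair E p r w ∧
      IsPair E q v w ∧ IsPair E t u q) inferInstance ?_ x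
    rintro p t t' ⟨u, v, w, q, r, h1, h2, h3, h4⟩ ⟨u', v', w', q', r', h1', h2', h3', h4'⟩
    obtain ⟨rfl, rfl⟩ := hi h2 h2'
    obtain ⟨rfl, rfl⟩ := hi h1 h1'
    obtain rfl := hu h3 h3'
    exact hu h4 h4'
  | 6 =>
    refine Z.replacement (fun p t => ∃ u v w q r, IsPair E r u w ∧ IsPair E p r v ∧
      IsPair E q v w ∧ IsPair E t u q) inferInstance ?_ x
    rintro p t t' ⟨u, v, w, q, r, h1, h2, h3, h4⟩ ⟨u', v', w', q', r', h1', h2', h3', h4'⟩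
    obtain ⟨rfl, rfl⟩ := hi h2 h2'
    obtain ⟨rfl, rfl⟩ := hi h1 h1'
    obtain rfl := hu h3 h3'
    exact hu h4 h4'
  | _ + 7 => exact Z.union x

theorem code_inj (Z : ZFModel E D) {n : ℕ} : ∀ {v v' : Fin n → X} {q : X}, Code E v q →
    Code E v' q → v = v' := by
  induction n with
  | zero => intros; exact Subsingleton.elim _ _
  | succ n ih =>
    rintro v v' q ⟨c, hc, hq⟩ ⟨c', hc', hq'⟩
    obtain ⟨h, rfl⟩ := Z.pair_inj hq hq'
    rw [← Fin.snoc_init_self v, ← Fin.snoc_init_self v', ih hc hc', h]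

theorem exists_code (Z : ZFModel E D) {n : ℕ} : ∀ v : Fin n → X, ∃ q, Code E v q := by
  induction n with
  | zero => exact fun _ => Z.exists_empty
  | succ n ih =>
    intro v
    obtain ⟨c, hc⟩ := ih (Fin.init v)
    exact (Z.exists_pair (v (Fin.last n)) c).imp fun q hq => ⟨c, hc, hq⟩

end ZFModel

/-! ### Separation from closure under Goedel operations -/

section Separation

variable {X : Type v} {E : X → X → Prop} {D : DefSystem (fun _ : Unit => E)} [HasParams D]

/-- `W` is a cofinal subclass of the transitive class `C` that is closed under the operations. -/
structure OpClosed (D : DefSystem (fun _ : Unit => E)) (C W : X → Prop) : Prop where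
  isDef : IsDef D fun _ v => C (v 0)
  trans : ∀ x, C x → ∀ y, E y x → C y
  sub : ∀ x, W x → C x
  op : ∀ k x y r, W x → W y → (∀ t, E t r ↔ Op E k x y t) → W r
  empty : ∀ r, (∀ z, E z r ↔ ∀ t, ¬ E t z) → W r
  cofinal : ∀ s, (∀ z, E z s → C z) → ∃ y, W y ∧ ∀ z, E z s → E z y

/-- `P` is definable and the codes of the tuples from any `a` that satisfy `P` form an element
of `W`. -/
def Separable (E : X → X → Prop) (D : DefSystem (fun _ : Unit => E)) (W : X → Prop) (n : ℕ)
    (P : (Fin n → X) → Prop) : Prop :=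
  IsDef D (fun _ w => P fun i => w i) ∧
  ∀ a, W a → ∃ r, W r ∧ ∀ q, E q r ↔ ∃ v : Fin n → X, (∀ i, E (v i) a) ∧ Code E v q ∧ P v

variable {C W : X → Prop} (Z : ZFModel E D) (G : OpClosed D C W)
include Z G

namespace OpClosed

theorem exists_op (k : ℕ) {x y : X} (hx : W x) (hy : W y) :
    ∃ r, W r ∧ ∀ t, E t r ↔ Op E k x y t :=
  (Z.exists_op k x y).imp fun r hr => ⟨G.op k x y r hx hy hr, hr⟩

theorem exists_power (n : ℕ) {a : X} (ha : W a) :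
    ∃ r, W r ∧ ∀ q, E q r ↔ ∃ v : Fin n → X, (∀ i, E (v i) a) ∧ Code E v q := by
  induction n with
  | zero =>
    obtain ⟨e, he⟩ := Z.exists_empty
    obtain ⟨r, hr⟩ := Z.exists_singleton e
    have hr' : ∀ z, E z r ↔ ∀ t, ¬ E t z := fun z => (hr z).trans
      ⟨fun h => h ▸ he, fun h => Z.ext _ _ fun t => ⟨fun k => (h t k).elim, fun k => (he t k).elim⟩⟩
    refine ⟨r, G.empty r hr', fun q => (hr' q).trans
      ⟨fun h => ⟨Fin.elim0, fun i => i.elim0, h⟩, fun ⟨_, _, h⟩ => h⟩⟩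
  | succ n ih =>
    obtain ⟨r, hr, h⟩ := ih
    obtain ⟨r', hr', h'⟩ := G.exists_op Z 1 ha hr
    refine ⟨r', hr', fun q => (h' q).trans ?_⟩
    simp only [exists_snoc, forall_snoc_mem _ _ (E · a), code_snoc]
    constructor
    · rintro ⟨x, c, hx, hc, hq⟩
      obtain ⟨v, hv, hvc⟩ := (h c).1 hc
      exact ⟨v, x, ⟨hv, hx⟩, c, hvc, hq⟩
    · rintro ⟨v, x, ⟨hv, hx⟩, c, hvc, hq⟩
      exact ⟨x, c, hx, (h c).2 ⟨v, hv, hvc⟩, hq⟩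

theorem separable_falsum (n : ℕ) : Separable E D W n fun _ => False := by
  refine ⟨inferInstance, fun a ha => ?_⟩
  obtain ⟨r, hr, h⟩ := G.exists_op Z 0 ha ha
  exact ⟨r, hr, fun q => (h q).trans ⟨fun k => (k.2 k.1).elim, fun ⟨_, _, _, k⟩ => k.elim⟩⟩

/-- The codes for the implication are `a^n` minus the difference of the code sets of `P` and `Q`;
uniqueness of decoding makes the difference meaningful. -/
theorem separable_imp {n : ℕ} {P Q : (Fin n → X) → Prop} (hP : Separable E D W n P)
    (hQ : Separable E D W n Q) : Separable E D W n fun v => P v → Q v := by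
  refine ⟨@isDef_imp _ _ _ _ _ _ hP.1 hQ.1, fun a ha => ?_⟩
  obtain ⟨p, hp, hp'⟩ := hP.2 a ha
  obtain ⟨q, hq, hq'⟩ := hQ.2 a ha
  obtain ⟨d, hd, hd'⟩ := G.exists_op Z 0 hp hq
  obtain ⟨A, hA, hA'⟩ := G.exists_power Z n ha
  obtain ⟨r, hr, hr'⟩ := G.exists_op Z 0 hA hd
  refine ⟨r, hr, fun c => (hr' c).trans ?_⟩
  simp only [Op, hA', hd', hp', hq']
  constructor
  · rintro ⟨⟨v, hv, hc⟩, h⟩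
    refine ⟨v, hv, hc, fun hPv => ?_⟩
    by_contra hQv
    refine h ⟨⟨v, hv, hc, hPv⟩, ?_⟩
    rintro ⟨v', -, hc', hQ'⟩
    exact hQv (Z.code_inj hc hc' ▸ hQ')
  · rintro ⟨v, hv, hc, h⟩
    refine ⟨⟨v, hv, hc⟩, ?_⟩
    rintro ⟨⟨v', -, hc', hP'⟩, h'⟩
    obtain rfl := Z.code_inj hc hc'
    exact h' ⟨v, hv, hc, h hP'⟩

/-- Collection and cofinality of `W` yield `a' ∈ W` that includes `a` and contains a counterexample
for each tuple from `a` that has one in `C`. The failing tuples are obtained by projecting the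
complement of `P` in the power of `a'`. Since a code is the pair of its last entry and the code of
the rest, operation `3` is this projection. -/
theorem separable_all {n : ℕ} {P : (Fin (n + 1) → X) → Prop} (hP : Separable E D W (n + 1) P) :
    Separable E D W n fun v => ∀ x, C x → P (Fin.snoc v x) := by
  have hC := G.isDef
  have hC' : ∀ {s : Unit → (ℕ → X) → X} [IsTm D s], IsDef D fun i v => C (s i v) :=
    hC.subst₁ (R := fun _ => C) ‹_›
  have hP' : IsDef D fun _ w => P (Fin.snoc (fun i : Fin n => w (i + 1)) (w 0)) := by
    refine (IsDef.mk (D.subst (t := fun k _ w => if k < n then w (k + 1) else w 0) hP.1.out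
      fun k => ?_)).congr fun _ w => ?_
    · by_cases hk : k < n
      · simp only [hk, if_true]; exact D.var _
      · simp only [hk, if_false]; exact D.var _
    · rw [iff_iff_eq]
      congr 1
  constructor
  · refine @isDef_all _ _ _ _ _ ?_
    exact @isDef_imp _ _ _ _ _ _ hC' hP'
  intro a ha
  obtain ⟨c, hc⟩ := Z.collection_tuple a n (fun v x => C x ∧ ¬ P (Fin.snoc v x)) inferInstance
  obtain ⟨c', hc'⟩ := Z.exists_union₂ c a
  obtain ⟨s, hs⟩ := Z.separation C inferInstance c'
  obtain ⟨a', ha', hsa⟩ := G.cofinal s fun z hz => ((hs z).1 hz).2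
  have haa (z : X) (hz : E z a) : E z a' :=
    hsa z ((hs z).2 ⟨(hc' z).2 (Or.inr hz), G.trans a (G.sub a ha) z hz⟩)
  obtain ⟨p, hp, hp'⟩ := hP.2 a' ha'
  obtain ⟨B, hB, hB'⟩ := G.exists_power Z (n + 1) ha'
  obtain ⟨d, hd, hd'⟩ := G.exists_op Z 0 hB hp
  obtain ⟨e, he, he'⟩ := G.exists_op Z 3 hd hd
  obtain ⟨A, hA, hA'⟩ := G.exists_power Z n ha
  obtain ⟨r, hr, hr'⟩ := G.exists_op Z 0 hA he
  refine ⟨r, hr, fun q => (hr' q).trans ?_⟩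
  simp only [Op, hA', he', hd', hp', hB']
  constructor
  · rintro ⟨⟨v, hv, hq⟩, h⟩
    refine ⟨v, hv, hq, fun x hx => ?_⟩
    by_contra hPx
    obtain ⟨y, hy, hyC, hyP⟩ := hc v hv ⟨x, hx, hPx⟩
    have hya : E y a' := hsa y ((hs y).2 ⟨(hc' y).2 (Or.inl hy), hyC⟩)
    obtain ⟨t, ht⟩ := Z.exists_pair y q
    have htc := (code_snoc v y t).2 ⟨q, hq, ht⟩
    refine h ⟨t, ⟨⟨Fin.snoc v y, (forall_snoc_mem _ _ (E · a')).2 ⟨fun i => haa _ (hv i), hya⟩,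
      htc⟩, ?_⟩, y, ht⟩
    rintro ⟨v', -, hc', h'⟩
    exact hyP (Z.code_inj htc hc' ▸ h')
  · rintro ⟨v, hv, hq, h⟩
    refine ⟨⟨v, hv, hq⟩, ?_⟩
    rintro ⟨t, ⟨⟨v', hv', ht'⟩, h'⟩, y, ht⟩
    refine h' ⟨v', hv', ht', ?_⟩
    obtain ⟨q', hq', hq''⟩ := ht'
    obtain ⟨rfl, rfl⟩ := Z.pair_inj ht hq''
    obtain rfl := Z.code_inj hq hq'
    have := h (v' (Fin.last n)) (G.trans _ (G.sub _ ha') _ (hv' _))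
    rwa [Fin.snoc_init_self] at this

/-- Pairing a binary relation with a coordinate of a tuple. -/
theorem exists_pairs {B : X → X → Prop}
    (hB : ∀ a, W a → ∃ r, W r ∧ ∀ q, E q r ↔ ∃ x y, E x a ∧ E y a ∧ B x y ∧ IsPair E q x y)
    {a : X} (ha : W a) {n : ℕ} : ∀ j : Fin n, ∃ r, W r ∧ ∀ q, E q r ↔
      ∃ (v : Fin n → X) (x : X), (∀ i, E (v i) a) ∧ E x a ∧ B x (v j) ∧
        ∃ c, Code E v c ∧ IsPair E q x c := by
  induction n with
  | zero => exact fun j => j.elim0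
  | succ n ih =>
    intro j
    simp only [exists_snoc, forall_snoc_mem _ _ (E · a), code_snoc]
    refine Fin.lastCases ?_ (fun j => ?_) j
    · obtain ⟨r, hr, hr'⟩ := hB a ha
      obtain ⟨A, hA, hA'⟩ := G.exists_power Z n ha
      obtain ⟨p, hp, hp'⟩ := G.exists_op Z 1 hr hA
      -- Operation `5` regroups `((x, y), c)` as `(x, (y, c))`, which is the shape of a code.
      obtain ⟨d, hd, hd'⟩ := G.exists_op Z 5 hp hp
      refine ⟨d, hd, fun q => (hd' q).trans ?_⟩
      simp only [Op, hp', hr', hA', Fin.snoc_last]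
      constructor
      · rintro ⟨t, ⟨r', c, ⟨x, y, hx, hy, hxy, hr'⟩, ⟨v, hv, hc⟩, ht⟩, x', y', c', k, r'', h1, h2, h3, h4⟩
        obtain ⟨rfl, rfl⟩ := Z.pair_inj ht h2
        obtain ⟨rfl, rfl⟩ := Z.pair_inj hr' h1
        exact ⟨v, y, x, ⟨hv, hy⟩, hx, hxy, k, ⟨c, hc, h3⟩, h4⟩
      · rintro ⟨v, y, x, ⟨hv, hy⟩, hx, hxy, k, ⟨c, hc, h3⟩, h4⟩
        obtain ⟨r', hr'⟩ := Z.exists_pair x y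
        obtain ⟨t, ht⟩ := Z.exists_pair r' c
        exact ⟨t, ⟨r', c, ⟨x, y, hx, hy, hxy, hr'⟩, ⟨v, hv, hc⟩, ht⟩, x, y, c, k, r', hr', ht, h3, h4⟩
    · obtain ⟨r, hr, hr'⟩ := ih j
      obtain ⟨p, hp, hp'⟩ := G.exists_op Z 1 hr ha
      -- Operation `6` inserts the new last coordinate: `((x, c), y)` becomes `(x, (y, c))`.
      obtain ⟨d, hd, hd'⟩ := G.exists_op Z 6 hp hp
      refine ⟨d, hd, fun q => (hd' q).trans ?_⟩
      simp only [Op, hp', hr', Fin.snoc_castSucc]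
      constructor
      · rintro ⟨t, ⟨r', y, ⟨v, x, hv, hx, hxy, c, hc, hr'⟩, hy, ht⟩, x', y', c', k, r'', h1, h2, h3, h4⟩
        obtain ⟨rfl, rfl⟩ := Z.pair_inj ht h2
        obtain ⟨rfl, rfl⟩ := Z.pair_inj hr' h1
        exact ⟨v, y, x, ⟨hv, hy⟩, hx, hxy, k, ⟨c, hc, h3⟩, h4⟩
      · rintro ⟨v, y, x, ⟨hv, hy⟩, hx, hxy, k, ⟨c, hc, h3⟩, h4⟩
        obtain ⟨r', hr'⟩ := Z.exists_pair x c
        obtain ⟨t, ht⟩ := Z.exists_pair r' y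
        exact ⟨t, ⟨r', y, ⟨v, x, hv, hx, hxy, c, hc, hr'⟩, hy, ht⟩, x, y, c, k, r', hr', ht, h3, h4⟩

theorem exists_mem_rel {a : X} (ha : W a) :
    ∃ r, W r ∧ ∀ q, E q r ↔ ∃ x y, E x a ∧ E y a ∧ E x y ∧ IsPair E q x y :=
  G.exists_op Z 2 ha ha

theorem exists_swap_mem_rel {a : X} (ha : W a) :
    ∃ r, W r ∧ ∀ q, E q r ↔ ∃ x y, E x a ∧ E y a ∧ E y x ∧ IsPair E q x y := by
  obtain ⟨r, hr, hr'⟩ := G.exists_op Z 2 ha ha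
  obtain ⟨d, hd, hd'⟩ := G.exists_op Z 4 hr hr
  refine ⟨d, hd, fun q => (hd' q).trans ?_⟩
  simp only [Op, hr']
  constructor
  · rintro ⟨p, ⟨x, y, hx, hy, hxy, hp⟩, u, v, hp', hq⟩
    obtain ⟨rfl, rfl⟩ := Z.pair_inj hp hp'
    exact ⟨_, _, hy, hx, hxy, hq⟩
  · rintro ⟨x, y, hx, hy, hyx, hq⟩
    obtain ⟨p, hp⟩ := Z.exists_pair y x
    exact ⟨p, ⟨y, x, hy, hx, hyx, hp⟩, x, y, hp, hq⟩

/-- Induction on the length of the tuple. If neither index is the last one, a product with `a` adds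
a coordinate; if exactly one is, `exists_pairs` applies to membership or its converse; if both are,
nothing qualifies. -/
theorem separable_mem {n : ℕ} : ∀ i j : Fin n, Separable E D W n fun v => E (v i) (v j) := by
  intro i j
  refine ⟨inferInstance, fun a ha => ?_⟩
  induction n with
  | zero => exact i.elim0
  | succ n ih =>
    simp only [exists_snoc, forall_snoc_mem _ _ (E · a), code_snoc]
    refine Fin.lastCases ?_ (fun i => ?_) i <;> refine Fin.lastCases ?_ (fun j => ?_) j
    · obtain ⟨r, hr, h⟩ := G.exists_op Z 0 ha ha
      exact ⟨r, hr, fun q => (h q).trans ⟨fun k => (k.2 k.1).elim,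
        fun ⟨_, _, _, _, k⟩ => (Z.irrefl _ k).elim⟩⟩
    · obtain ⟨r, hr, h⟩ := G.exists_pairs Z (fun a => G.exists_mem_rel Z) ha j
      refine ⟨r, hr, fun q => (h q).trans ?_⟩
      simp only [Fin.snoc_last, Fin.snoc_castSucc]
      exact ⟨fun ⟨v, x, h1, h2, h3, h4⟩ => ⟨v, x, ⟨h1, h2⟩, h4, h3⟩,
        fun ⟨v, x, ⟨h1, h2⟩, h4, h3⟩ => ⟨v, x, h1, h2, h3, h4⟩⟩
    · obtain ⟨r, hr, h⟩ := G.exists_pairs Z (fun a => G.exists_swap_mem_rel Z) ha i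
      refine ⟨r, hr, fun q => (h q).trans ?_⟩
      simp only [Fin.snoc_last, Fin.snoc_castSucc]
      exact ⟨fun ⟨v, x, h1, h2, h3, h4⟩ => ⟨v, x, ⟨h1, h2⟩, h4, h3⟩,
        fun ⟨v, x, ⟨h1, h2⟩, h4, h3⟩ => ⟨v, x, h1, h2, h3, h4⟩⟩
    · obtain ⟨r, hr, h⟩ := ih i j
      obtain ⟨p, hp, hp'⟩ := G.exists_op Z 1 ha hr
      refine ⟨p, hp, fun q => (hp' q).trans ?_⟩
      simp only [Op, h, Fin.snoc_castSucc]
      exact ⟨fun ⟨x, c, hx, ⟨v, hv, hc, hij⟩, hq⟩ => ⟨v, x, ⟨hv, hx⟩, ⟨c, hc, hq⟩, hij⟩,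
        fun ⟨v, x, ⟨hv, hx⟩, ⟨c, hc, hq⟩, hij⟩ => ⟨x, c, hx, ⟨v, hv, hc, hij⟩, hq⟩⟩

/-- Equality reduces to membership by extensionality. The quantifier may range over `C` alone, since
the coordinates and their elements lie in the transitive class `C`. -/
theorem separable_eq {n : ℕ} (i j : Fin n) : Separable E D W n fun v => v i = v j := by
  have h1 := G.separable_all Z (G.separable_imp Z (G.separable_mem Z (Fin.last n) i.castSucc)
    (G.separable_mem Z (Fin.last n) j.castSucc))
  have h2 := G.separable_all Z (G.separable_imp Z (G.separable_mem Z (Fin.last n) j.castSucc)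
    (G.separable_mem Z (Fin.last n) i.castSucc))
  have h := G.separable_imp Z h1 (G.separable_imp Z h2 (G.separable_falsum Z n))
  have h := G.separable_imp Z h (G.separable_falsum Z n)
  refine ⟨inferInstance, fun a ha => ?_⟩
  obtain ⟨r, hr, hr'⟩ := h.2 a ha
  refine ⟨r, hr, fun q => (hr' q).trans (exists_congr fun v => and_congr_right fun hv =>
    and_congr_right fun _ => ?_)⟩
  simp only [Fin.snoc_last, Fin.snoc_castSucc]
  constructor
  · intro k
    by_contra hne
    refine k fun k1 k2 => hne (Z.ext _ _ fun z => ⟨fun hz => ?_, fun hz => ?_⟩)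
    · exact k1 z (G.trans _ (G.trans a (G.sub a ha) _ (hv i)) z hz) hz
    · exact k2 z (G.trans _ (G.trans a (G.sub a ha) _ (hv j)) z hz) hz
  · intro k
    rw [k]
    exact fun k' => k' (fun _ _ h => h) (fun _ _ h => h)

theorem separable_relSat {α : Type w} {m : ℕ} (e : α → Fin m) {n : ℕ}
    (φ : setLang.BoundedFormula α n) :
    Separable E D W (m + n) fun v =>
      RelSat E C φ (fun a => v (Fin.castAdd n (e a))) (fun i => v (Fin.natAdd m i)) := by
  have hsum : ∀ {n : ℕ} (x : α ⊕ Fin n), ∃ k : Fin (m + n), ∀ v : Fin (m + n) → X,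
      Sum.elim (fun a => v (Fin.castAdd n (e a))) (fun i => v (Fin.natAdd m i)) x = v k := by
    rintro n (x | x)
    exacts [⟨_, fun _ => rfl⟩, ⟨_, fun _ => rfl⟩]
  induction φ with
  | falsum => exact G.separable_falsum Z _
  | equal t₁ t₂ =>
    obtain ⟨k₁, h₁⟩ := hsum (termVar t₁)
    obtain ⟨k₂, h₂⟩ := hsum (termVar t₂)
    simp only [RelSat, h₁, h₂]
    exact G.separable_eq Z k₁ k₂
  | rel R ts =>
    cases R with
    | mem =>
      obtain ⟨k₁, h₁⟩ := hsum (termVar (ts 0))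
      obtain ⟨k₂, h₂⟩ := hsum (termVar (ts 1))
      simp only [RelSat, RelHolds, h₁, h₂]
      exact G.separable_mem Z k₁ k₂
    | cls k => exact k.elim
  | imp φ χ h₁ h₂ => exact G.separable_imp Z h₁ h₂
  | @all n φ h =>
    have := G.separable_all Z (n := m + n) h
    simp only [RelSat]
    convert this using 5 with v x
    · funext a
      exact (Fin.snoc_castSucc (α := fun _ => X) x v (Fin.castAdd n (e a))).symm
    · funext i
      refine Fin.lastCases ?_ (fun i => ?_) i
      · exact (Fin.snoc_last _ _).trans (Fin.snoc_last (α := fun _ => X) x v).symm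
      · exact (Fin.snoc_castSucc _ _ _).trans
          (Fin.snoc_castSucc (α := fun _ => X) x v (Fin.natAdd m i)).symm

end OpClosed

end Separation

theorem relSat_congr {X : Type v} {α : Type w} [DecidableEq α] {E : X → X → Prop} {C : X → Prop}
    {n : ℕ} {φ : setLang.BoundedFormula α n} {u u' : α → X} {xs : Fin n → X}
    (h : ∀ a ∈ φ.freeVarFinset, u a = u' a) : RelSat E C φ u xs ↔ RelSat E C φ u' xs := by
  have hvar : ∀ {n : ℕ} (t : setLang.Term (α ⊕ Fin n)) (xs : Fin n → X),
      (∀ a ∈ t.varFinsetLeft, u a = u' a) →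
      Sum.elim u xs (termVar t) = Sum.elim u' xs (termVar t) := by
    rintro n (x | ⟨f, _⟩) xs h
    · rcases x with a | i
      · exact h a (by simp [Term.varFinsetLeft])
      · rfl
    · exact (f : Empty).elim
  induction φ with
  | falsum => exact Iff.rfl
  | equal t₁ t₂ =>
    simp only [BoundedFormula.freeVarFinset, Finset.mem_union] at h
    simp only [RelSat]
    rw [hvar t₁ xs fun a ha => h a (Or.inl ha), hvar t₂ xs fun a ha => h a (Or.inr ha)]
  | rel R ts =>
    simp only [BoundedFormula.freeVarFinset, Finset.mem_biUnion] at h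
    simp only [RelSat]
    rw [show (fun k => Sum.elim u xs (termVar (ts k))) = fun k => Sum.elim u' xs (termVar (ts k))
      from funext fun k => hvar (ts k) xs fun a ha => h a ⟨k, Finset.mem_univ _, ha⟩]
  | imp φ χ h₁ h₂ =>
    simp only [BoundedFormula.freeVarFinset, Finset.mem_union] at h
    exact imp_congr (h₁ fun a ha => h a (Or.inl ha)) (h₂ fun a ha => h a (Or.inr ha))
  | all φ ih =>
    exact forall_congr' fun x => imp_congr Iff.rfl (ih h)

section Separation

variable {X : Type v} {E : X → X → Prop} {D : DefSystem (fun _ : Unit => E)} [HasParams D]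

theorem ZFModel.exists_insert_tuple (Z : ZFModel E D) (a : X) {m : ℕ} : ∀ p : Fin m → X,
    ∃ s, ∀ z, E z s ↔ E z a ∨ ∃ k, z = p k := by
  induction m with
  | zero => exact fun p => ⟨a, fun z => by simp⟩
  | succ m ih =>
    intro p
    obtain ⟨s, hs⟩ := ih (Fin.init p)
    obtain ⟨s', hs'⟩ := Z.exists_insert s (p (Fin.last m))
    refine ⟨s', fun z => ?_⟩
    rw [hs', hs, Fin.exists_fin_succ', or_assoc]
    rfl

namespace OpClosed

variable {C W : X → Prop} (Z : ZFModel E D) (G : OpClosed D C W)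
include Z G

/-- Parameters enter only through their singletons, which is all that the generators of the
enumeration provide directly. -/
theorem exists_singleton_code {m : ℕ} : ∀ p : Fin m → X,
    (∀ k s, (∀ z, E z s ↔ z = p k) → W s) → ∃ r, W r ∧ ∀ q, E q r ↔ Code E p q := by
  induction m with
  | zero =>
    intro p _
    obtain ⟨r, hr, h⟩ := G.exists_power Z 0 (a := (Z.exists_singleton Z.exists_empty.choose).choose)
      (G.empty _ fun z => by
        rw [(Z.exists_singleton Z.exists_empty.choose).choose_spec]
        have := Z.exists_empty.choose_spec
        exact ⟨fun h => h ▸ this, fun h => Z.ext _ _ fun t =>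
          ⟨fun k => (h t k).elim, fun k => (this t k).elim⟩⟩)
    exact ⟨r, hr, fun q => (h q).trans ⟨fun ⟨_, _, h⟩ => h, fun h => ⟨p, fun i => i.elim0, h⟩⟩⟩
  | succ m ih =>
    intro p hp
    obtain ⟨r, hr, h⟩ := ih (Fin.init p) fun k => hp _
    obtain ⟨s, hs⟩ := Z.exists_singleton (p (Fin.last m))
    obtain ⟨t, ht, h'⟩ := G.exists_op Z 1 (hp _ s hs) hr
    refine ⟨t, ht, fun q => (h' q).trans ?_⟩
    simp only [Op, hs, h, Code]
    exact ⟨fun ⟨_, c, rfl, hc, hq⟩ => ⟨c, hc, hq⟩, fun ⟨c, hc, hq⟩ => ⟨_, c, rfl, hc, hq⟩⟩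

/-- Intersect the code set of `P` with the product of `a` and the singleton of the code of `p`, and
read off the first coordinates. The intersection is a double difference, and the first projection is
a swap followed by the range. -/
theorem exists_fiber {m : ℕ} {P : (Fin (m + 1) → X) → Prop} (hP : Separable E D W (m + 1) P)
    (p : Fin m → X) (hp : ∀ k s, (∀ z, E z s ↔ z = p k) → W s) {a : X} (ha : W a) :
    ∃ r, W r ∧ ∀ x, E x r ↔ E x a ∧ P (Fin.snoc p x) := by
  obtain ⟨s, hs⟩ := Z.exists_insert_tuple a p
  obtain ⟨a', ha', hsa⟩ := G.cofinal s fun z hz => by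
    rcases (hs z).1 hz with h | ⟨k, rfl⟩
    · exact G.trans a (G.sub a ha) z h
    · obtain ⟨s, hs⟩ := Z.exists_singleton (p k)
      exact G.trans s (G.sub s (hp k s hs)) _ ((hs _).2 rfl)
  obtain ⟨R, hR, hR'⟩ := hP.2 a' ha'
  obtain ⟨c, hc, hc'⟩ := G.exists_singleton_code Z p hp
  obtain ⟨B, hB, hB'⟩ := G.exists_op Z 1 ha hc
  obtain ⟨d, hd, hd'⟩ := G.exists_op Z 0 hB hR
  obtain ⟨i, hi, hi'⟩ := G.exists_op Z 0 hB hd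
  obtain ⟨w, hw, hw'⟩ := G.exists_op Z 4 hi hi
  obtain ⟨r, hr, hr'⟩ := G.exists_op Z 3 hw hw
  refine ⟨r, hr, fun x => (hr' x).trans ?_⟩
  simp only [Op, hw', hi', hd', hB', hR', hc']
  constructor
  · rintro ⟨t, ⟨t', ⟨h1, h2⟩, u, v, h3, h4⟩, u', h5⟩
    obtain ⟨rfl, rfl⟩ := Z.pair_inj h4 h5
    have h2 := not_not.1 (not_and.1 h2 h1)
    obtain ⟨x, q, hx, hq, hxq⟩ := h1
    obtain ⟨rfl, rfl⟩ := Z.pair_inj hxq h3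
    refine ⟨hx, ?_⟩
    obtain ⟨v, -, hv, hP⟩ := h2
    rwa [Z.code_inj ((code_snoc p _ t').2 ⟨_, hq, hxq⟩) hv]
  · rintro ⟨hx, hPx⟩
    obtain ⟨q, hq⟩ := Z.exists_code p
    obtain ⟨t', ht'⟩ := Z.exists_pair x q
    obtain ⟨t, ht⟩ := Z.exists_pair q x
    refine ⟨t, ⟨t', ⟨⟨x, q, hx, hq, ht'⟩, fun h => h.2 ?_⟩, q, x, ht', ht⟩, q, ht⟩
    exact ⟨Fin.snoc p x, (forall_snoc_mem p x (E · a')).2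
      ⟨fun k => hsa _ ((hs _).2 (Or.inr ⟨k, rfl⟩)), hsa x ((hs x).2 (Or.inl hx))⟩,
      (code_snoc p x t').2 ⟨q, hq, ht'⟩, hPx⟩

/-- Separation in `W` for formulas over `C`, with parameters whose singletons are in `W`. -/
theorem exists_separation {α : Type w} (φ : setLang.Formula α) (val : α → Option X)
    (hval : ∀ a q, val a = some q → ∀ s, (∀ z, E z s ↔ z = q) → W s) {a : X} (ha : W a) :
    ∃ r, W r ∧ ∀ x, E x r ↔ E x a ∧ RelSatF E C φ fun i => (val i).getD x := by
  classical
  obtain ⟨e₀, he₀⟩ := Z.exists_empty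
  let s := φ.freeVarFinset
  -- Only the finitely many free variables count. Those without a parameter are read as the
  -- separated variable, placed last; the slots they leave unused among the first `s.card` are
  -- filled with the empty set.
  let f : α → Fin (s.card + 1) := fun i =>
    if h : i ∈ s then
      match val i with
      | none => Fin.last _
      | some _ => (s.equivFin ⟨i, h⟩).castSucc
    else Fin.last _
  let p : Fin s.card → X := fun k => (val (s.equivFin.symm k)).getD e₀
  have hp : ∀ k s, (∀ z, E z s ↔ z = p k) → W s := by
    intro k t ht
    rcases h : val (s.equivFin.symm k) with _ | q
    · refine G.empty t fun z => (ht z).trans ?_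
      simp only [p, h, Option.getD_none]
      exact ⟨fun h => h ▸ he₀, fun h => Z.ext _ _ fun t =>
          ⟨fun k => (h t k).elim, fun k => (he₀ t k).elim⟩⟩
    · refine hval _ q h t fun z => (ht z).trans ?_
      simp only [p, h, Option.getD_some]
  obtain ⟨r, hr, h⟩ := G.exists_fiber Z (m := s.card) (G.separable_relSat Z f φ) p hp ha
  refine ⟨r, hr, fun x => (h x).trans (and_congr_right fun _ => ?_)⟩
  unfold RelSatF
  refine Iff.trans ?_ (relSat_congr (u := fun i => (Fin.snoc p x : Fin (s.card + 1) → X) (f i)) ?_)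
  · rw [iff_iff_eq]
    congr 1
    exact Subsingleton.elim _ _
  · intro i hi
    have hi' : i ∈ s := hi
    simp only [f, hi', dif_pos]
    rcases h : val i with _ | q
    · simp
    · simp [p, h]

end OpClosed

end Separation

section

variable {ι : Type u} {X : ι → Type v} {E : ∀ i, X i → X i → Prop} {D : DefSystem E}
variable {s t r q : ∀ i, (ℕ → X i) → X i}

theorem isDef_triple_base : IsDef D (fun i v => IsTriple (E i) (v 0) (v 1) (v 2) (v 3)) := by
  unfold IsTriple; infer_instance

instance [hs : IsTm D s] [ht : IsTm D t] [hr : IsTm D r] [hq : IsTm D q] :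
    IsDef D (fun i v => IsTriple (E i) (s i v) (t i v) (r i v) (q i v)) :=
  isDef_triple_base.subst₄ hs ht hr hq

end

/-- Definability with parameters in a structure for the language of set theory. -/
abbrev elemSystem {X : Type v} (E : X → X → Prop) : DefSystem (fun _ : Unit => E) :=
  paramSystem E (fun k : Empty => k.elim)

namespace ZFModel

variable {X : Type v} {E : X → X → Prop} {D : DefSystem (fun _ : Unit => E)} [HasParams D]

theorem triple_inj (Z : ZFModel E D) {t x y z x' y' z' : X} (h : IsTriple E t x y z)
    (h' : IsTriple E t x' y' z') : x = x' ∧ y = y' ∧ z = z' := by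
  obtain ⟨p, hp, ht⟩ := h
  obtain ⟨p', hp', ht'⟩ := h'
  obtain ⟨rfl, rfl⟩ := Z.pair_inj ht ht'
  obtain ⟨rfl, rfl⟩ := Z.pair_inj hp hp'
  exact ⟨rfl, rfl, rfl⟩

theorem triple_unique (Z : ZFModel E D) {t t' x y z : X} (h : IsTriple E t x y z)
    (h' : IsTriple E t' x y z) : t = t' := by
  obtain ⟨p, hp, ht⟩ := h
  obtain ⟨p', hp', ht'⟩ := h'
  obtain rfl := Z.pair_unique hp hp'
  exact Z.pair_unique ht ht'

theorem exists_triple (Z : ZFModel E D) (x y z : X) : ∃ t, IsTriple E t x y z := by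
  obtain ⟨p, hp⟩ := Z.exists_pair x y
  exact (Z.exists_pair p z).imp fun t ht => ⟨p, hp, ht⟩

theorem exists_rotate (Z : ZFModel E D) (x : X) : ∃ r, ∀ t, E t r ↔
    ∃ u v w p, E p x ∧ IsTriple E p v w u ∧ IsTriple E t u v w := by
  obtain ⟨r, hr⟩ := Z.replacement (fun p t => ∃ u v w, IsTriple E p v w u ∧ IsTriple E t u v w)
    inferInstance (by
      rintro p t t' ⟨u, v, w, h, ht⟩ ⟨u', v', w', h', ht'⟩
      obtain ⟨rfl, rfl, rfl⟩ := Z.triple_inj h h'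
      exact Z.triple_unique ht ht') x
  exact ⟨r, fun t => (hr t).trans ⟨fun ⟨p, hp, u, v, w, h⟩ => ⟨u, v, w, p, hp, h⟩,
    fun ⟨u, v, w, p, hp, h⟩ => ⟨p, hp, u, v, w, h⟩⟩⟩

theorem exists_swapLast (Z : ZFModel E D) (x : X) : ∃ r, ∀ t, E t r ↔
    ∃ u v w p, E p x ∧ IsTriple E p u w v ∧ IsTriple E t u v w := by
  obtain ⟨r, hr⟩ := Z.replacement (fun p t => ∃ u v w, IsTriple E p u w v ∧ IsTriple E t u v w)
    inferInstance (by
      rintro p t t' ⟨u, v, w, h, ht⟩ ⟨u', v', w', h', ht'⟩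
      obtain ⟨rfl, rfl, rfl⟩ := Z.triple_inj h h'
      exact Z.triple_unique ht ht') x
  exact ⟨r, fun t => (hr t).trans ⟨fun ⟨p, hp, u, v, w, h⟩ => ⟨u, v, w, p, hp, h⟩,
    fun ⟨u, v, w, p, hp, h⟩ => ⟨p, hp, u, v, w, h⟩⟩⟩

end ZFModel

/-! ### Inner models satisfy ZF -/

section InnerModel

variable {S : Type u} {E : S → S → Prop} {𝒞 : Set (Set S)} {N : Set S}

section

variable (Z : ZFModel E (classSystem E 𝒞)) (hG : GodelClosed E N)
include Z hG

theorem GodelClosed.swap_mem {x r : S} (hx : x ∈ N) (hr : ∀ t, E t r ↔ Op E 4 x x t) : r ∈ N := by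
  refine hG.swap x hx r fun t => (hr t).trans ⟨?_, ?_⟩
  · rintro ⟨p, hp, u, v, h⟩
    exact ⟨u, v, p, hp, h⟩
  · rintro ⟨u, v, p, hp, h⟩
    exact ⟨p, hp, u, v, h⟩

theorem GodelClosed.range_mem {x r : S} (hx : x ∈ N) (hr : ∀ t, E t r ↔ Op E 3 x x t) : r ∈ N := by
  obtain ⟨w, hw⟩ := Z.exists_op 4 x x
  refine hG.dom w (GodelClosed.swap_mem Z hG hx hw) r fun t => (hr t).trans ⟨?_, ?_⟩
  · rintro ⟨p, hp, u, h⟩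
    obtain ⟨q, hq⟩ := Z.exists_pair t u
    exact ⟨u, q, (hw q).2 ⟨p, hp, t, u, h, hq⟩, hq⟩
  · rintro ⟨v, q, hq, h⟩
    obtain ⟨p, hp, a, c, h1, h2⟩ := (hw q).1 hq
    obtain ⟨rfl, rfl⟩ := Z.pair_inj h h2
    exact ⟨p, hp, _, h1⟩

/-- Rotating `((u, v), w)` twice gives `((v, w), u)`, and a swap gives `(u, (v, w))`. -/
theorem GodelClosed.assoc_mem {x r : S} (hx : x ∈ N) (hr : ∀ t, E t r ↔ Op E 5 x x t) : r ∈ N := by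
  obtain ⟨y, hy⟩ := Z.exists_rotate x
  obtain ⟨z, hz⟩ := Z.exists_rotate y
  have hyN := hG.rotate x hx y hy
  have hzN := hG.rotate y hyN z hz
  refine GodelClosed.swap_mem Z hG hzN fun t => (hr t).trans ⟨?_, ?_⟩
  · rintro ⟨p, hp, u, v, w, q, k, h1, h2, h3, h4⟩
    obtain ⟨a, ha⟩ := Z.exists_triple w u v
    obtain ⟨c, hc⟩ := Z.exists_pair q u
    have hay := (hy a).2 ⟨w, u, v, p, hp, ⟨k, h1, h2⟩, ha⟩
    exact ⟨c, (hz c).2 ⟨v, w, u, a, hay, ha, q, h3, hc⟩, u, q, hc, h4⟩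
  · rintro ⟨c, hc, u, q, hc', ht⟩
    obtain ⟨v, w, u', a, ha, ha', q', hq', hcq⟩ := (hz c).1 hc
    obtain ⟨rfl, rfl⟩ := Z.pair_inj hc' hcq
    obtain ⟨w', u'', v', p, hp, ⟨k, hk, hpk⟩, ha''⟩ := (hy a).1 ha
    obtain ⟨rfl, rfl, rfl⟩ := Z.triple_inj ha' ha''
    exact ⟨p, hp, _, _, _, q, k, hk, hpk, hq', ht⟩

theorem GodelClosed.perm_mem {x r : S} (hx : x ∈ N) (hr : ∀ t, E t r ↔ Op E 6 x x t) : r ∈ N := by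
  obtain ⟨y, hy⟩ := Z.exists_swapLast x
  have hyN := hG.swapLast x hx y hy
  refine GodelClosed.assoc_mem Z hG hyN fun t => (hr t).trans ⟨?_, ?_⟩
  · rintro ⟨p, hp, u, v, w, q, k, h1, h2, h3, h4⟩
    obtain ⟨k', hk'⟩ := Z.exists_pair u v
    obtain ⟨p', hp'⟩ := Z.exists_pair k' w
    exact ⟨p', (hy p').2 ⟨u, v, w, p, hp, ⟨k, h1, h2⟩, ⟨k', hk', hp'⟩⟩, u, v, w, q, k', hk', hp', h3, h4⟩
  · rintro ⟨p', hp', u, v, w, q, k', h1, h2, h3, h4⟩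
    obtain ⟨u', v', w', p, hp, ⟨k, hk, hpk⟩, hp''⟩ := (hy p').1 hp'
    obtain ⟨rfl, rfl, rfl⟩ := Z.triple_inj ⟨k', h1, h2⟩ hp''
    exact ⟨p, hp, _, _, _, q, k, hk, hpk, h3, h4⟩

end

theorem IsInnerModel.nonempty (hN : IsInnerModel E 𝒞 N) (h : IsNGB E 𝒞) : N.Nonempty := by
  obtain ⟨e, he⟩ := h.zfModel.exists_empty
  refine Set.nonempty_iff_ne_empty.2 fun h0 => hN.proper ⟨e, ?_⟩
  rw [h0]
  ext x
  simp [he x]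

theorem IsInnerModel.exists_empty (hN : IsInnerModel E 𝒞 N) (h : IsNGB E 𝒞) :
    ∃ e ∈ N, ∀ z, ¬ E z e := by
  obtain ⟨x, hx⟩ := hN.nonempty h
  obtain ⟨e, he⟩ := h.zfModel.exists_empty
  exact ⟨e, hN.godel.diff x hx x hx e fun t => ⟨fun k => (he t k).elim, fun k => (k.2 k.1).elim⟩, he⟩

theorem IsInnerModel.opClosed (hN : IsInnerModel E 𝒞 N) (h : IsNGB E 𝒞) :
    OpClosed (classSystem E 𝒞) (· ∈ N) (· ∈ N) where
  isDef := isDef_mem_class hN.isClass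
  trans := hN.trans
  sub _ h := h
  op k x y r hx hy hr := by
    match k with
    | 0 => exact hN.godel.diff x hx y hy r hr
    | 1 => exact hN.godel.prod x hx y hy r hr
    | 2 => exact hN.godel.eps x hx y hy r hr
    | 3 => exact GodelClosed.range_mem h.zfModel hN.godel hx hr
    | 4 => exact GodelClosed.swap_mem h.zfModel hN.godel hx hr
    | 5 => exact GodelClosed.assoc_mem h.zfModel hN.godel hx hr
    | 6 => exact GodelClosed.perm_mem h.zfModel hN.godel hx hr
    | _ + 7 => exact hN.godel.sUnion x hx r hr
  empty r hr := by
    obtain ⟨e, heN, he⟩ := hN.exists_empty h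
    refine hN.godel.pair e heN e heN r fun z => (hr z).trans ?_
    rw [or_self]
    exact ⟨fun k => h.extensionality _ _ fun t => ⟨fun k' => (k t k').elim, fun k' => (he t k').elim⟩,
      fun k => k ▸ he⟩
  cofinal := hN.almostUniversal

theorem IsInnerModel.separation (hN : IsInnerModel E 𝒞 N) (h : IsNGB E 𝒞) {P : N → Prop}
    (hP : IsDef (elemSystem (sub E N)) fun _ v => P (v 0)) (a : N) :
    ∃ r : N, ∀ x : N, E x r ↔ E x a ∧ P x := by
  obtain ⟨φ, hφ⟩ := hP.out
  obtain ⟨r, hr, hr'⟩ := (hN.opClosed h).exists_separation h.zfModel φ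
    (Sum.elim (fun c : N => some (c : S)) fun _ => none) (by
      rintro (c | c) q hq s hs
      · obtain rfl := Option.some.inj hq
        exact hN.godel.pair c c.2 c c.2 s fun z => by rw [hs, or_self]
      · simp at hq) a.2
  refine ⟨⟨r, hr⟩, fun x => (hr' x).trans (and_congr_right fun _ => ?_)⟩
  refine Iff.trans ?_ ((sat_iff_relSatF E N φ _).symm.trans (hφ () fun _ => x))
  rw [iff_iff_eq]
  congr 1
  funext i
  rcases i with c | c <;> rfl

/-- Definability in an inner model is inherited by the class system. -/
theorem exists_isDef_of_sub (hN : N ∈ 𝒞) {P : (ℕ → N) → Prop}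
    (hP : IsDef (elemSystem (sub E N)) fun _ v => P v) :
    ∃ Q : (ℕ → S) → Prop, IsDef (classSystem E 𝒞) (fun _ v => Q v) ∧
      ∀ v : ℕ → N, Q (fun n => v n) ↔ P v := by
  obtain ⟨φ, hφ⟩ := hP.out
  have hC := @isDef_mem_class S E 𝒞 N hN
  refine ⟨fun v => RelSatF E (· ∈ N) φ (fun i => Sum.elim (fun c : N => (c : S)) v i),
    isDef_relSatF (C := fun _ _ x => x ∈ N) hC φ (fun _ v => v 0)
      (fun i _ v => Sum.elim (fun c : N => (c : S)) v i) ?_, fun v => ?_⟩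
  · rintro (c | c)
    · exact isTm_const (c : S)
    · exact isTm_var c
  · refine Iff.trans ?_ ((sat_iff_relSatF E N φ _).symm.trans (hφ () v))
    refine iff_of_eq (congrArg (RelSatF E (· ∈ N) φ) (funext fun i => ?_))
    rcases i with c | c <;> rfl

theorem exists_isDef_of_sub₁ (hN : N ∈ 𝒞) {P : N → Prop}
    (hP : IsDef (elemSystem (sub E N)) fun _ v => P (v 0)) :
    ∃ Q : S → Prop, IsDef (classSystem E 𝒞) (fun _ v => Q (v 0)) ∧ ∀ x : N, Q x ↔ P x := by
  obtain ⟨Q, hQ, hQP⟩ := exists_isDef_of_sub (P := fun v => P (v 0)) hN hP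
  exact ⟨fun x => Q fun _ => x, ⟨DefSystem.subst _ hQ.out fun _ => DefSystem.var _ 0⟩,
    fun x => hQP fun _ => x⟩

theorem exists_isDef_of_sub₂ (hN : N ∈ 𝒞) {R : N → N → Prop}
    (hR : IsDef (elemSystem (sub E N)) fun _ v => R (v 0) (v 1)) :
    ∃ Q : S → S → Prop, IsDef (classSystem E 𝒞) (fun _ v => Q (v 0) (v 1)) ∧
      ∀ x y : N, Q x y ↔ R x y := by
  obtain ⟨Q, hQ, hQR⟩ := exists_isDef_of_sub (P := fun v => R (v 0) (v 1)) hN hR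
  let f : S → S → ℕ → S := fun x y n => if n = 0 then x else y
  refine ⟨fun x y => Q (f x y), ⟨DefSystem.subst _ (t := fun n _ v => f (v 0) (v 1) n) hQ.out
    fun n => ?_⟩, fun x y => ?_⟩
  · by_cases hn : n = 0
    · simp only [f, hn, if_true]; exact DefSystem.var _ 0
    · simp only [f, hn, if_false]; exact DefSystem.var _ 1
  · have := hQR fun n => if n = 0 then x else y
    simp only [if_true, one_ne_zero, if_false] at this
    refine Iff.trans (iff_of_eq (congrArg Q (funext fun n => ?_))) this
    by_cases hn : n = 0 <;> simp [f, hn]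

/-- For power sets and replacement, the required set exists in the universe, is covered by an
element of `N` by almost universality, and is cut out by separation in `N`. Foundation is inherited
because classes definable over `N` are classes. -/
theorem IsInnerModel.zfModel (hN : IsInnerModel E 𝒞 N) (h : IsNGB E 𝒞) :
    ZFModel (sub E N) (elemSystem (sub E N)) where
  inhabited := (hN.nonempty h).to_subtype
  ext x y hxy := Subtype.ext (h.extensionality _ _ fun z =>
    ⟨fun hz => (hxy ⟨z, hN.trans x x.2 z hz⟩).1 hz, fun hz => (hxy ⟨z, hN.trans y y.2 z hz⟩).2 hz⟩)
  pairing x y := by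
    obtain ⟨p, hp⟩ := h.pairing x y
    refine ⟨⟨p, hN.godel.pair x x.2 y y.2 p hp⟩, fun z => (hp z).trans ?_⟩
    rw [Subtype.ext_iff, Subtype.ext_iff]
  union x := by
    obtain ⟨u, hu⟩ := h.union x
    refine ⟨⟨u, hN.godel.sUnion x x.2 u hu⟩, fun z => (hu z).trans ⟨?_, ?_⟩⟩
    · rintro ⟨y, hy, hz⟩
      exact ⟨⟨y, hN.trans x x.2 y hy⟩, hy, hz⟩
    · rintro ⟨y, hy, hz⟩
      exact ⟨y, hy, hz⟩
  powerset x := by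
    have hC := @isDef_mem_class S E 𝒞 N hN.isClass
    obtain ⟨p, hp⟩ := h.powerset x
    obtain ⟨s, hs⟩ := h.zfModel.separation (· ∈ N) inferInstance p
    obtain ⟨y, hy, hsy⟩ := hN.almostUniversal s fun z hz => ((hs z).1 hz).2
    obtain ⟨r, hr⟩ := hN.separation h (P := fun z => ∀ t, sub E N t z → sub E N t x) inferInstance ⟨y, hy⟩
    refine ⟨r, fun z => (hr z).trans ⟨fun k => k.2, fun k => ⟨hsy z ((hs z).2 ⟨(hp z).2 fun t ht => ?_, z.2⟩), k⟩⟩⟩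
    exact k ⟨t, hN.trans z z.2 t ht⟩ ht
  foundation P hP hne := by
    have hC := @isDef_mem_class S E 𝒞 N hN.isClass
    obtain ⟨Q, hQ, hQP⟩ := exists_isDef_of_sub₁ hN.isClass hP
    obtain ⟨x₀, hx₀⟩ := hne
    obtain ⟨x, ⟨hx, hxQ⟩, hmin⟩ := h.zfModel.foundation (fun x => x ∈ N ∧ Q x) inferInstance
      ⟨x₀, x₀.2, (hQP x₀).2 hx₀⟩
    exact ⟨⟨x, hx⟩, (hQP ⟨x, hx⟩).1 hxQ, fun y hy hyP => hmin y hy ⟨y.2, (hQP y).2 hyP⟩⟩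
  replacement R hR hfun a := by
    have hC := @isDef_mem_class S E 𝒞 N hN.isClass
    obtain ⟨Q, hQ, hQR⟩ := exists_isDef_of_sub₂ hN.isClass hR
    have hR' : ∀ {s t : Unit → (ℕ → N) → N} [IsTm (elemSystem (sub E N)) s]
        [IsTm (elemSystem (sub E N)) t], IsDef (elemSystem (sub E N)) fun i v => R (s i v) (t i v) :=
      hR.subst₂ (R := fun _ => R) ‹_› ‹_›
    obtain ⟨c, hc⟩ := h.zfModel.replacement (fun x y => x ∈ N ∧ y ∈ N ∧ Q x y) inferInstance
      (by
        rintro x y y' ⟨hx, hy, k⟩ ⟨-, hy', k'⟩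
        exact congrArg Subtype.val (hfun ⟨x, hx⟩ ⟨y, hy⟩ ⟨y', hy'⟩ ((hQR _ _).1 k) ((hQR _ _).1 k'))) a
    obtain ⟨y, hy, hcy⟩ := hN.almostUniversal c fun z hz => by
      obtain ⟨x, -, -, hz, -⟩ := (hc z).1 hz
      exact hz
    obtain ⟨r, hr⟩ := hN.separation h (P := fun z => ∃ x, sub E N x a ∧ R x z) inferInstance ⟨y, hy⟩
    refine ⟨r, fun z => (hr z).trans ⟨fun k => k.2, fun k => ⟨hcy z ((hc z).2 ?_), k⟩⟩⟩
    obtain ⟨x, hx, hxz⟩ := k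
    exact ⟨x, hx, x.2, z.2, (hQR x z).2 hxz⟩

end InnerModel

/-! ### Enumeration of the sets definable from `b` and ordinals -/

section

variable {X : Type v}

/-- `x` is the standard natural number `n`. -/
def Num (E : X → X → Prop) : ℕ → X → Prop
  | 0, x => ∀ z, ¬ E z x
  | n + 1, x => ∃ y, Num E n y ∧ IsSucc E x y

/-- The ordinal `ξ` codes the triple `(i, α, β)` of smaller ordinals. -/
def Decodes (E : X → X → Prop) (ξ i α β : X) : Prop :=
  ∃ γ p q, E i γ ∧ E α γ ∧ E β γ ∧ OrdCode E γ i p ∧ OrdCode E p α q ∧ OrdCode E q β ξ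

/-- The operations by which the sets that are definable from `b` and ordinals are generated. -/
def Gen (E : X → X → Prop) (b : X) : ℕ → X → X → X → X → Prop
  | 0, α, _, _, t => ∃ v, IsV E α v ∧ E t v
  | 1, α, _, _, t => t = α
  | 2, _, _, _, t => t = b
  | k + 3, _, x, y, t => Op E k x y t

/-- The recursive rule of the enumeration of a class of sets definable from `b` and ordinals. -/
def EnumRule (E : X → X → Prop) (b ξ f t : X) : Prop :=
  ∃ k : Fin 11, ∃ i α β x y, Num E k i ∧ Decodes E ξ i α β ∧ App E f α x ∧ App E f β y ∧
    Gen E b k α x y t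

/-- `y` is the `ξ`-th set in the enumeration. -/
def Enum (E : X → X → Prop) (b ξ y : X) : Prop :=
  IsOrd E ξ ∧ Rec E (OrdLt E) (EnumRule E b) ξ y

end

section

variable {ι : Type u} {X : ι → Type v} {E : ∀ i, X i → X i → Prop} {D : DefSystem E}
variable {s t r q p o : ∀ i, (ℕ → X i) → X i}

theorem isDef_num_base : ∀ k : ℕ, IsDef D (fun i v => Num (E i) k (v 0))
  | 0 => by unfold Num; infer_instance
  | k + 1 => by
    have h : ∀ {s : ∀ i, (ℕ → X i) → X i} [IsTm D s], IsDef D (fun i v => Num (E i) k (s i v)) :=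
      (isDef_num_base k).subst₁ ‹_›
    unfold Num
    infer_instance

instance (k : ℕ) [hs : IsTm D s] : IsDef D (fun i v => Num (E i) k (s i v)) :=
  (isDef_num_base k).subst₁ hs

theorem isDef_decodes_base : IsDef D (fun i v => Decodes (E i) (v 0) (v 1) (v 2) (v 3)) := by
  unfold Decodes; infer_instance

instance [hs : IsTm D s] [ht : IsTm D t] [hr : IsTm D r] [hq : IsTm D q] :
    IsDef D (fun i v => Decodes (E i) (s i v) (t i v) (r i v) (q i v)) :=
  isDef_decodes_base.subst₄ hs ht hr hq

instance (k : ℕ) [hp : IsTm D p] [hs : IsTm D s] [ht : IsTm D t] [hr : IsTm D r] [hq : IsTm D q] :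
    IsDef D (fun i v => Gen (E i) (p i v) k (s i v) (t i v) (r i v) (q i v)) := by
  rcases k with _ | _ | _ | k
  · have := IsDef.subst₂ (D := D) (R := fun i x y => ∃ v, IsV (E i) x v ∧ E i y v) inferInstance hs hq
    exact this
  · exact (inferInstance : IsDef D fun i v => q i v = s i v)
  · exact (inferInstance : IsDef D fun i v => q i v = p i v)
  · exact (inferInstance : IsDef D fun i v => Op (E i) k (t i v) (r i v) (q i v))

theorem isDef_exists_fin {n : ℕ} {P : Fin n → ∀ i, (ℕ → X i) → Prop} (h : ∀ k, IsDef D (P k)) :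
    IsDef D (fun i v => ∃ k, P k i v) :=
  (@isDef_not _ _ _ _ _ (isDef_forall_fin fun k => @isDef_not _ _ _ _ _ (h k))).congr
    fun i v => by push Not; rfl

theorem isDef_enumRule_base :
    IsDef D (fun i v => EnumRule (E i) (v 0) (v 1) (v 2) (v 3)) := by
  unfold EnumRule
  exact isDef_exists_fin fun k => inferInstance

theorem isDef_enum_base : IsDef D (fun i v => Enum (E i) (v 0) (v 1) (v 2)) := by
  have := isDef_rec (D := D) (R := fun i _ => OrdLt (E i)) (Φ := fun i => EnumRule (E i))
    (s := fun _ v => v 0) (t := fun _ v => v 1) (r := fun _ v => v 2) inferInstance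
    isDef_enumRule_base
  unfold Enum
  infer_instance

instance [hs : IsTm D s] [ht : IsTm D t] [hr : IsTm D r] :
    IsDef D (fun i v => Enum (E i) (s i v) (t i v) (r i v)) :=
  isDef_enum_base.subst₃ hs ht hr

end

namespace ZFModel

variable {X : Type v} {E : X → X → Prop} {D : DefSystem (fun _ : Unit => E)} [HasParams D]

theorem num_inj (Z : ZFModel E D) : ∀ {k l : ℕ} {x : X}, Num E k x → Num E l x → k = l
  | 0, 0, _, _, _ => rfl
  | 0, _ + 1, _, h, ⟨y, _, h'⟩ => (h y ((h' y).2 (Or.inr rfl))).elim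
  | _ + 1, 0, _, ⟨y, _, h⟩, h' => (h' y ((h y).2 (Or.inr rfl))).elim
  | k + 1, l + 1, _, ⟨y, hy, h⟩, ⟨y', hy', h'⟩ => by
    obtain rfl := Z.succ_inj h h'
    rw [Z.num_inj hy hy']

theorem exists_num (Z : ZFModel E D) : ∀ k : ℕ, ∃ x, IsOrd E x ∧ Num E k x
  | 0 => Z.exists_empty.imp fun _ h => ⟨ord_empty h, h⟩
  | k + 1 => by
    obtain ⟨y, hy, hk⟩ := Z.exists_num k
    obtain ⟨x, hx, h⟩ := Z.ord_succ hy
    exact ⟨x, hx, y, hk, h⟩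

theorem decodes_unique (Z : ZFModel E D) {ξ i α β i' α' β' : X} (h : Decodes E ξ i α β)
    (h' : Decodes E ξ i' α' β') : i = i' ∧ α = α' ∧ β = β' := by
  obtain ⟨γ, p, q, -, -, -, h1, h2, h3⟩ := h
  obtain ⟨γ', p', q', -, -, -, h1', h2', h3'⟩ := h'
  obtain ⟨rfl, rfl⟩ := Z.ordCode_inj h3 h3'
  obtain ⟨rfl, rfl⟩ := Z.ordCode_inj h2 h2'
  obtain ⟨rfl, rfl⟩ := Z.ordCode_inj h1 h1'
  exact ⟨rfl, rfl, rfl⟩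

/-- The components lie below the common bound `γ`, and codes do not fall below their first
component. Thus the recursion refers only to earlier indices. -/
theorem isOrd_of_decodes (Z : ZFModel E D) {ξ i α β : X} (h : Decodes E ξ i α β) :
    IsOrd E ξ ∧ E α ξ ∧ E β ξ := by
  obtain ⟨γ, p, q, -, hα, hβ, h1, h2, h3⟩ := h
  have hξ := Z.isOrd_ordCode h3
  have hγ : E γ ξ ∨ γ = ξ := by
    have a1 := Z.le_ordCode h1
    have a2 := Z.le_ordCode h2
    have a3 := Z.le_ordCode h3
    have hq := Z.isOrd_ordCode h2
    rcases a1 with a1 | rfl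
    · rcases a2 with a2 | rfl
      · have := ord_trans hq a2 a1
        rcases a3 with a3 | rfl
        exacts [Or.inl (ord_trans hξ a3 this), Or.inl this]
      · rcases a3 with a3 | rfl
        exacts [Or.inl (ord_trans hξ a3 a1), Or.inl a1]
    · rcases a2 with a2 | rfl
      · rcases a3 with a3 | rfl
        exacts [Or.inl (ord_trans hξ a3 a2), Or.inl a2]
      · exact a3
  rcases hγ with hγ | rfl
  · exact ⟨hξ, ord_trans hξ hγ hα, ord_trans hξ hγ hβ⟩
  · exact ⟨hξ, hα, hβ⟩

/-- Choose `γ` above all three components. By `le_ordCode` the successive codes are at least `γ`, so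
each pair to be coded has its smaller entry second. -/
theorem exists_decodes (Z : ZFModel E D) {i α β : X} (hi : IsOrd E i) (hα : IsOrd E α)
    (hβ : IsOrd E β) : ∃ ξ, Decodes E ξ i α β := by
  obtain ⟨σ, hσ, h1, h2⟩ := Z.ord_sup₂ hi hα
  obtain ⟨γ, hγ, h3, h4⟩ := Z.ord_sup₂ hσ hβ
  have hiγ := ord_trans hγ h3 h1
  have hαγ := ord_trans hγ h3 h2
  obtain ⟨p, hp⟩ := Z.exists_ordCode hγ hi (Or.inl hiγ)
  have hpo := Z.isOrd_ordCode hp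
  have hle : ∀ {x y : X}, IsOrd E y → (E γ y ∨ γ = y) → E x γ → E x y := by
    rintro x y hy (h | rfl) hx
    exacts [ord_trans hy h hx, hx]
  have hpγ := Z.le_ordCode hp
  obtain ⟨q, hq⟩ := Z.exists_ordCode hpo hα (Or.inl (hle hpo hpγ hαγ))
  have hqo := Z.isOrd_ordCode hq
  have hqγ : E γ q ∨ γ = q := by
    rcases Z.le_ordCode hq with h | rfl
    · rcases hpγ with h' | rfl
      exacts [Or.inl (ord_trans hqo h h'), Or.inl h]
    · exact hpγ
  obtain ⟨ξ, hξ⟩ := Z.exists_ordCode hqo hβ (Or.inl (hle hqo hqγ h4))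
  exact ⟨ξ, γ, p, q, hiγ, hαγ, h4, hp, hq, hξ⟩

theorem exists_gen (Z : ZFModel E D) (b : X) (k : ℕ) {α : X} (hα : IsOrd E α) (x y : X) :
    ∃ r, ∀ t, E t r ↔ Gen E b k α x y t := by
  match k with
  | 0 =>
    obtain ⟨v, hv⟩ := Z.exists_isV hα
    exact ⟨v, fun t => ⟨fun h => ⟨v, hv, h⟩, fun ⟨v', hv', h⟩ => Z.isV_unique hv hv' ▸ h⟩⟩
  | 1 => exact Z.exists_singleton α
  | 2 => exact Z.exists_singleton b
  | k + 3 => exact Z.exists_op k x y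

theorem enumRule_iff (Z : ZFModel E D) {b ξ f : X}
    (hf : ∀ z y y', App E f z y → App E f z y' → y = y') {k : Fin 11} {i α β x y : X}
    (hk : Num E k i) (hd : Decodes E ξ i α β) (hx : App E f α x) (hy : App E f β y) (t : X) :
    EnumRule E b ξ f t ↔ Gen E b k α x y t := by
  constructor
  · rintro ⟨k', i', α', β', x', y', hk', hd', hx', hy', h⟩
    obtain ⟨rfl, rfl, rfl⟩ := Z.decodes_unique hd hd'
    obtain rfl := Fin.ext (Z.num_inj hk hk')
    rwa [hf _ _ _ hx hx', hf _ _ _ hy hy']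
  · exact fun h => ⟨k, i, α, β, x, y, hk, hd, hx, hy, h⟩

theorem goodRule_enumRule (Z : ZFModel E D) (b : X) : GoodRule D (OrdLt E) (EnumRule E b) where
  isDef := IsDef.subst₄ (R := fun _ => EnumRule E) isDef_enumRule_base (isTm_const b) (isTm_var 0)
    (isTm_var 1) (isTm_var 2)
  total ξ f hdom htot huniq := by
    by_cases h : ∃ k : Fin 11, ∃ i α β x y, Num E k i ∧ Decodes E ξ i α β ∧ App E f α x ∧ App E f β y
    · obtain ⟨k, i, α, β, x, y, hk, hd, hx, hy⟩ := h
      obtain ⟨hξ, hα, hβ⟩ := Z.isOrd_of_decodes hd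
      obtain ⟨r, hr⟩ := Z.exists_gen b k (ord_of_mem hξ hα) x y
      exact ⟨r, fun t => (hr t).trans (Z.enumRule_iff huniq hk hd hx hy t).symm⟩
    · obtain ⟨e, he⟩ := Z.exists_empty
      refine ⟨e, fun t => ⟨fun h => (he t h).elim, ?_⟩⟩
      rintro ⟨k, i, α, β, x, y, h1, h2, h3, h4, -⟩
      exact (h ⟨k, i, α, β, x, y, h1, h2, h3, h4⟩).elim

theorem enum_unique (Z : ZFModel E D) {b ξ y y' : X} (h : Enum E b ξ y) (h' : Enum E b ξ y') :
    y = y' := Z.rec_unique Z.goodRel_ordLt (Z.goodRule_enumRule b) h.2 h'.2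

theorem exists_enum (Z : ZFModel E D) (b : X) {ξ : X} (hξ : IsOrd E ξ) : ∃ y, Enum E b ξ y :=
  (Z.rec_exists Z.goodRel_ordLt (Z.goodRule_enumRule b) ξ).imp fun _ h => ⟨hξ, h⟩

theorem mem_enum (Z : ZFModel E D) {b ξ i α β x y z : X} {k : Fin 11} (h : Enum E b ξ z)
    (hk : Num E k i) (hd : Decodes E ξ i α β) (hx : Enum E b α x) (hy : Enum E b β y) (t : X) :
    E t z ↔ Gen E b k α x y t := by
  obtain ⟨hξ, hα, hβ⟩ := Z.isOrd_of_decodes hd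
  obtain ⟨f, hf, hz⟩ := Z.rec_eq Z.goodRel_ordLt (Z.goodRule_enumRule b) h.2
  refine (hz t).trans (Z.enumRule_iff (fun a c d k k' => ?_) hk hd ((hf α x).2 ⟨⟨hξ, hα⟩, hx.2⟩)
    ((hf β y).2 ⟨⟨hξ, hβ⟩, hy.2⟩) t)
  exact Z.rec_unique Z.goodRel_ordLt (Z.goodRule_enumRule b) ((hf a c).1 k).2 ((hf a d).1 k').2

/-- The range of the enumeration. -/
def _root_.ClassTheory.Enumerated (E : X → X → Prop) (b y : X) : Prop := ∃ ξ, Enum E b ξ y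

theorem enumerated_gen (Z : ZFModel E D) {b : X} {k : ℕ} (hk : k < 11) {α β x y r : X}
    (hx : Enum E b α x) (hy : Enum E b β y) (hr : ∀ t, E t r ↔ Gen E b k α x y t) :
    Enumerated E b r := by
  obtain ⟨i, hi, hki⟩ := Z.exists_num k
  obtain ⟨ξ, hξ⟩ := Z.exists_decodes hi hx.1 hy.1
  obtain ⟨z, hz⟩ := Z.exists_enum b (Z.isOrd_of_decodes hξ).1
  have : r = z := Z.ext _ _ fun t =>
    (hr t).trans (Z.mem_enum (k := ⟨k, hk⟩) hz hki hξ hx hy t).symm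
  exact ⟨ξ, this ▸ hz⟩

theorem enumerated_singleton_ord (Z : ZFModel E D) (b : X) {α r : X} (hα : IsOrd E α)
    (hr : ∀ z, E z r ↔ z = α) : Enumerated E b r := by
  obtain ⟨x, hx⟩ := Z.exists_enum b hα
  exact Z.enumerated_gen (k := 1) (by norm_num) hx hx hr

theorem enumerated_singleton_param (Z : ZFModel E D) {b r : X} (hr : ∀ z, E z r ↔ z = b) :
    Enumerated E b r := by
  obtain ⟨e, he⟩ := Z.exists_empty
  obtain ⟨x, hx⟩ := Z.exists_enum b (ord_empty he)
  exact Z.enumerated_gen (k := 2) (by norm_num) hx hx hr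

theorem enumerated_isV (Z : ZFModel E D) (b : X) {α v : X} (hv : IsV E α v) : Enumerated E b v := by
  obtain ⟨x, hx⟩ := Z.exists_enum b hv.1
  exact Z.enumerated_gen (k := 0) (by norm_num) hx hx fun t =>
    ⟨fun h => ⟨v, hv, h⟩, fun ⟨v', hv', h⟩ => Z.isV_unique hv hv' ▸ h⟩

theorem opClosed_enumerated (Z : ZFModel E D) (b : X) :
    OpClosed D (fun _ => True) (Enumerated E b) where
  isDef := inferInstance
  trans _ _ _ _ := trivial
  sub _ _ := trivial
  op k x y r hx hy hr := by
    obtain ⟨α, hx⟩ := hx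
    obtain ⟨β, hy⟩ := hy
    by_cases hk : k < 8
    -- The eleven rules are three generators and eight operations; all operation indices from `7` on
    -- denote the union.
    · exact Z.enumerated_gen (k := k + 3) (by omega) hx hy hr
    · obtain ⟨l, rfl⟩ : ∃ l, k = l + 7 := ⟨k - 7, by omega⟩
      exact Z.enumerated_gen (k := 7 + 3) (by norm_num) hx hy hr
  empty r hr := by
    obtain ⟨e, he⟩ := Z.exists_empty
    refine Z.enumerated_singleton_ord b (ord_empty he) fun z => (hr z).trans
      ⟨fun h => Z.ext _ _ fun t => ⟨fun k => (h t k).elim, fun k => (he t k).elim⟩, fun h => h ▸ he⟩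
  cofinal s _ := by
    obtain ⟨σ, v, hv, h⟩ := Z.exists_isV_superset s
    exact ⟨v, Z.enumerated_isV b hv, h⟩

/-- Sets that are definable from `b` and ordinals are enumerated. -/
theorem enumerated_of_definable (Z : ZFModel E D) {b x : X} {α : Type w} (φ : setLang.Formula α)
    (val : α → Option X) (hval : ∀ a q, val a = some q → q = b ∨ IsOrd E q)
    (h : ∀ y, RelSatF E (fun _ => True) φ (fun i => (val i).getD y) ↔ y = x) :
    Enumerated E b x := by
  obtain ⟨σ, v, hv, hxv⟩ := Z.exists_isV_mem x
  have G := Z.opClosed_enumerated b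
  -- Separation inside the class of enumerated sets cuts `{x}` out of `V_σ`, and `x` is the union of
  -- this singleton. No reflection argument is needed.
  obtain ⟨s, hs, hs'⟩ := G.exists_separation Z φ val (fun a q hq s hs => by
    rcases hval a q hq with rfl | hq
    · exact Z.enumerated_singleton_param hs
    · exact Z.enumerated_singleton_ord b hq hs) (Z.enumerated_isV b hv)
  have hs' (y : X) : E y s ↔ y = x := by
    rw [hs', h]
    exact ⟨fun h => h.2, fun h => ⟨h ▸ hxv, h⟩⟩
  refine G.op 7 s s x hs hs fun t => ⟨fun ht => ⟨x, (hs' x).2 rfl, ht⟩, ?_⟩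
  rintro ⟨y, hy, ht⟩
  rwa [(hs' y).1 hy] at ht

end ZFModel

instance isDef_enumerated {ι : Type u} {X : ι → Type v} {E : ∀ i, X i → X i → Prop}
    {D : DefSystem E} {s t : ∀ i, (ℕ → X i) → X i} [hs : IsTm D s] [ht : IsTm D t] :
    IsDef D fun i v => Enumerated (E i) (s i v) (t i v) :=
  IsDef.subst₂ (D := D) (R := fun i b y => ∃ ξ, Enum (E i) b ξ y) inferInstance hs ht

/-! ### Definable well-orderings -/

section

variable {X : Type v}

/-- `x` belongs to the transitive closure of the class defined by `φ` from `b`. -/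
def InClosure (E : X → X → Prop) (φ : setLang.Formula (Fin 2)) (b x : X) : Prop :=
  ∃ a t, RelSatF E (fun _ => True) φ ![a, b] ∧ IsTC E a t ∧ E x t

/-- `α` is the least ordinal with `x ∈ V_α`. -/
def IsRank (E : X → X → Prop) (x α : X) : Prop :=
  IsOrd E α ∧ (∃ v, IsV E α v ∧ E x v) ∧ ∀ β, E β α → ¬ ∃ v, IsV E β v ∧ E x v

/-- The relation that `χ` defines on the transitive closure of the class defined by `φ`, refined
to a set-like relation by comparing ranks first. -/
def RankLess (E : X → X → Prop) (φ : setLang.Formula (Fin 2)) (χ : setLang.Formula (Fin 3))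
    (b x y : X) : Prop :=
  InClosure E φ b x ∧ InClosure E φ b y ∧ ∃ α β, IsRank E x α ∧ IsRank E y β ∧
    (E α β ∨ α = β ∧ RelSatF E (fun _ => True) χ ![x, y, b])

/-- The first index of `x` in the enumeration is less than that of `y`. -/
def IndexLess (E : X → X → Prop) (x y b : X) : Prop :=
  ∃ ξ, Enum E b ξ x ∧ ∀ η, (E η ξ ∨ η = ξ) → ¬ Enum E b η y

end

section

variable {ι : Type u} {X : ι → Type v} {E : ∀ i, X i → X i → Prop} {D : DefSystem E}
variable {s t r q p o : ∀ i, (ℕ → X i) → X i}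

theorem isDef_inClosure_base (φ : setLang.Formula (Fin 2)) :
    IsDef D (fun i v => InClosure (E i) φ (v 0) (v 1)) := by
  unfold InClosure; infer_instance

instance (φ : setLang.Formula (Fin 2)) [hs : IsTm D s] [ht : IsTm D t] :
    IsDef D (fun i v => InClosure (E i) φ (s i v) (t i v)) :=
  (isDef_inClosure_base φ).subst₂ hs ht

theorem isDef_isRank_base : IsDef D (fun i v => IsRank (E i) (v 0) (v 1)) := by
  unfold IsRank; infer_instance

instance [hs : IsTm D s] [ht : IsTm D t] : IsDef D (fun i v => IsRank (E i) (s i v) (t i v)) :=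
  isDef_isRank_base.subst₂ hs ht

theorem isDef_rankLess_base (φ : setLang.Formula (Fin 2)) (χ : setLang.Formula (Fin 3)) :
    IsDef D (fun i v => RankLess (E i) φ χ (v 0) (v 1) (v 2)) := by
  unfold RankLess; infer_instance

instance (φ : setLang.Formula (Fin 2)) (χ : setLang.Formula (Fin 3)) [hs : IsTm D s]
    [ht : IsTm D t] [hr : IsTm D r] :
    IsDef D (fun i v => RankLess (E i) φ χ (s i v) (t i v) (r i v)) :=
  (isDef_rankLess_base φ χ).subst₃ hs ht hr

theorem isDef_indexLess_base : IsDef D (fun i v => IndexLess (E i) (v 0) (v 1) (v 2)) := by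
  unfold IndexLess; infer_instance

end

namespace ZFModel

variable {X : Type v} {E : X → X → Prop} {D : DefSystem (fun _ : Unit => E)} [HasParams D]

theorem exists_isRank (Z : ZFModel E D) (x : X) : ∃ α, IsRank E x α := by
  obtain ⟨α, v, hv, hx⟩ := Z.exists_isV_mem x
  exact Z.ord_min (fun α => ∃ v, IsV E α v ∧ E x v) inferInstance ⟨α, hv.1, v, hv, hx⟩

theorem isRank_unique (Z : ZFModel E D) {x α β : X} (h : IsRank E x α) (h' : IsRank E x β) :
    α = β := by
  rcases Z.ord_trichotomy h.1 h'.1 with k | k | k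
  exacts [(h'.2.2 α k h.2.1).elim, k, (h.2.2 β k h'.2.1).elim]

/-- A definable well-ordering of the transitive closure of a definable class, refined by ranks, is
a good relation. -/
theorem goodRel_rankLess (Z : ZFModel E D) {φ : setLang.Formula (Fin 2)}
    {χ : setLang.Formula (Fin 3)} {b : X}
    (hirr : ∀ x, InClosure E φ b x → ¬ RelSatF E (fun _ => True) χ ![x, x, b])
    (htr : ∀ x y z, InClosure E φ b x → InClosure E φ b y → InClosure E φ b z →
      RelSatF E (fun _ => True) χ ![x, y, b] → RelSatF E (fun _ => True) χ ![y, z, b] →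
      RelSatF E (fun _ => True) χ ![x, z, b])
    (hleast : ∀ s, (∃ x, E x s) → (∀ x, E x s → InClosure E φ b x) →
      ∃ m, E m s ∧ ∀ x, E x s → x ≠ m → RelSatF E (fun _ => True) χ ![m, x, b]) :
    GoodRel D (RankLess E φ χ b) where
  isDef := inferInstance
  trans := by
    rintro x y z ⟨hx, hy, α, β, hα, hβ, h⟩ ⟨-, hz, β', γ, hβ', hγ, h'⟩
    obtain rfl := Z.isRank_unique hβ hβ'
    refine ⟨hx, hz, α, γ, hα, hγ, ?_⟩
    rcases h with h | ⟨rfl, h⟩ <;> rcases h' with h' | ⟨rfl, h'⟩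
    · exact Or.inl (ord_trans hγ.1 h' h)
    · exact Or.inl h
    · exact Or.inl h'
    · exact Or.inr ⟨rfl, htr x y z hx hy hz h h'⟩
  setLike x := by
    obtain ⟨α, hα⟩ := Z.exists_isRank x
    obtain ⟨v, hv, -⟩ := hα.2.1
    obtain ⟨s, hs⟩ := Z.separation (fun z => RankLess E φ χ b z x) inferInstance v
    refine ⟨s, fun z => (hs z).trans ⟨fun h => h.2, fun h => ⟨?_, h⟩⟩⟩
    obtain ⟨-, -, β, α', hβ, hα', h⟩ := h
    obtain rfl := Z.isRank_unique hα hα'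
    obtain ⟨w, hw, hz⟩ := hβ.2.1
    rcases h with h | ⟨rfl, -⟩
    · exact Z.isV_mono hw hv h hz
    · rwa [Z.isV_unique hv hw]
  wf P hP h := by
    have hP' : ∀ {s : Unit → (ℕ → X) → X} [IsTm D s], IsDef D fun i v => P (s i v) :=
      hP.subst₁ (R := fun _ => P) ‹_›
    by_cases hPT : ∃ x, P x ∧ InClosure E φ b x
    · obtain ⟨x₀, hx₀, hx₀T⟩ := hPT
      obtain ⟨α₀, hα₀⟩ := Z.exists_isRank x₀
      -- The well-ordering has least elements only for sets, while `P` may define a proper class.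
      -- The elements of least rank form a set.
      obtain ⟨α, -, ⟨x, hx, hxT, hxα⟩, hmin⟩ := Z.ord_min
        (fun α => ∃ x, P x ∧ InClosure E φ b x ∧ IsRank E x α) inferInstance
        ⟨α₀, hα₀.1, x₀, hx₀, hx₀T, hα₀⟩
      have hV : ∀ y, IsRank E y α → E y hxα.2.1.choose := by
        intro y hy
        obtain ⟨w, hw, hyw⟩ := hy.2.1
        rwa [Z.isV_unique hxα.2.1.choose_spec.1 hw]
      obtain ⟨s, hs⟩ := Z.separation (fun x => P x ∧ InClosure E φ b x ∧ IsRank E x α) inferInstance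
        hxα.2.1.choose
      obtain ⟨m, hm, hleast⟩ := hleast s ⟨x, (hs x).2 ⟨hV x hxα, hx, hxT, hxα⟩⟩
        fun y hy => ((hs y).1 hy).2.2.1
      obtain ⟨-, hmP, hmT, hmα⟩ := (hs m).1 hm
      refine ⟨m, hmP, fun y ⟨hyT, _, β, α', hβ, hα', h⟩ hyP => ?_⟩
      obtain rfl := Z.isRank_unique hmα hα'
      rcases h with h | ⟨rfl, h⟩
      · exact hmin β h ⟨y, hyP, hyT, hβ⟩
      · by_cases hym : y = m
        · exact hirr m hmT (hym ▸ h)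
        · exact hirr m hmT (htr m y m hmT hyT hmT
            (hleast y ((hs y).2 ⟨hV y hβ, hyP, hyT, hβ⟩) hym) h)
    · obtain ⟨x, hx⟩ := h
      exact ⟨x, hx, fun y hy hyP => hPT ⟨y, hyP, hy.1⟩⟩

theorem exists_first_index (Z : ZFModel E D) {b x : X} (h : Enumerated E b x) :
    ∃ ξ, Enum E b ξ x ∧ ∀ η, E η ξ → ¬ Enum E b η x := by
  obtain ⟨ξ, hξ⟩ := h
  obtain ⟨ξ, -, h⟩ := Z.ord_min (fun ξ => Enum E b ξ x) inferInstance ⟨ξ, hξ.1, hξ⟩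
  exact ⟨ξ, h⟩

theorem indexLess_irrefl (b x : X) : ¬ IndexLess E x x b :=
  fun ⟨ξ, h, h'⟩ => h' ξ (Or.inr rfl) h

theorem indexLess_trans (Z : ZFModel E D) {b x y z : X} (h : IndexLess E x y b)
    (h' : IndexLess E y z b) : IndexLess E x z b := by
  obtain ⟨ξ, hξ, h⟩ := h
  obtain ⟨η, hη, h'⟩ := h'
  have hlt : E ξ η := by
    rcases Z.ord_trichotomy hξ.1 hη.1 with k | k | k
    exacts [k, (h η (Or.inr k.symm) hη).elim, (h η (Or.inl k) hη).elim]
  refine ⟨ξ, hξ, fun ζ hζ => h' ζ (Or.inl ?_)⟩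
  rcases hζ with hζ | rfl
  exacts [ord_trans hη.1 hlt hζ, hlt]

theorem indexLess_total (Z : ZFModel E D) {b x y : X} (hx : Enumerated E b x)
    (hy : Enumerated E b y) (hne : x ≠ y) : IndexLess E x y b ∨ IndexLess E y x b := by
  obtain ⟨ξ, hξ, hξm⟩ := Z.exists_first_index hx
  obtain ⟨η, hη, hηm⟩ := Z.exists_first_index hy
  rcases Z.ord_trichotomy hξ.1 hη.1 with k | rfl | k
  · refine Or.inl ⟨ξ, hξ, fun ζ hζ => hηm ζ ?_⟩
    rcases hζ with hζ | rfl
    exacts [ord_trans hη.1 k hζ, k]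
  · exact (hne (Z.enum_unique hξ hη)).elim
  · refine Or.inr ⟨η, hη, fun ζ hζ => hξm ζ ?_⟩
    rcases hζ with hζ | rfl
    exacts [ord_trans hξ.1 k hζ, k]

theorem exists_indexLess_least (Z : ZFModel E D) {b s : X} (hs : ∃ x, E x s)
    (h : ∀ x, E x s → Enumerated E b x) :
    ∃ m, E m s ∧ ∀ x, E x s → x ≠ m → IndexLess E m x b := by
  obtain ⟨x, hx⟩ := hs
  obtain ⟨ξ, hξ⟩ := h x hx
  obtain ⟨ξ, -, ⟨m, hm, hmξ⟩, hmin⟩ := Z.ord_min (fun ξ => ∃ x, E x s ∧ Enum E b ξ x) inferInstance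
    ⟨ξ, hξ.1, x, hx, hξ⟩
  refine ⟨m, hm, fun y hy hne => ⟨ξ, hmξ, ?_⟩⟩
  rintro η (hη | rfl) hyη
  · exact hmin η hη ⟨y, hy, hyη⟩
  · exact hne (Z.enum_unique hyη hmξ)

end ZFModel

/-! ### Definability from ordinals and the transitive closure of a class -/

section InnerModel

variable {S : Type u} {E : S → S → Prop} {𝒞 : Set (Set S)} {N : Set S}

/-- Definability from `b` and ordinals. -/
abbrev odSystem (E : S → S → Prop) (N : Set S) (b : N) : DefSystem (fun _ : Unit => sub E N) :=
  formulaSystem (K := Empty) (κ := ({a : N | IsOrd E a} ∪ {b} : Set N)) _ (fun _ k => k.elim)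
    (fun _ a => a)

theorem mem_OD_of_isDef {b : N} {P : N → Prop}
    (hP : IsDef (odSystem E N b) fun _ v => P (v 0)) {x : N} (hx : ∀ y, P y ↔ y = x) :
    (x : S) ∈ OD E N b := by
  obtain ⟨φ, hφ⟩ := hP.out
  let _ := inStructure E N
  refine ⟨x.2, Set.definable_iff_exists_formula_sum.2 ⟨φ.relabel (Sum.map id fun _ => 0), ?_⟩⟩
  ext v
  have h1 := (hφ () fun _ => v 0).trans (hx (v 0))
  refine Iff.trans h1.symm ?_
  change _ ↔ Formula.Realize _ _
  rw [Formula.realize_relabel, iff_iff_eq]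
  congr 1
  funext i
  rcases i with i | i <;> rfl

theorem enumerated_of_mem_OD (Z : ZFModel (sub E N) (elemSystem (sub E N)))
    (hN : IsTransClass E N) {b x : N} (hx : (x : S) ∈ OD E N b) : Enumerated (sub E N) b x := by
  obtain ⟨_, hx⟩ := hx
  let _ := inStructure E N
  obtain ⟨φ, hφ⟩ := Set.definable_iff_exists_formula_sum.1 hx
  refine Z.enumerated_of_definable φ (Sum.elim (fun a => some (a : N)) fun _ => none) ?_ fun y => ?_
  · rintro (a | a) q hq
    · obtain rfl := Option.some.inj hq
      rcases a.2 with h | h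
      exacts [Or.inr ((isOrd_sub hN _).2 h), Or.inl h]
    · simp at hq
  · have h1 := Set.ext_iff.1 hφ fun _ => y
    refine Iff.trans ?_ (h1.symm.trans Iff.rfl)
    refine Iff.trans ?_ (sat_iff_true E N φ _).symm
    refine iff_of_eq (congrArg (RelSatF _ _ φ) (funext fun i => ?_))
    rcases i with c | c <;> rfl

section

variable (hN : IsInnerModel E 𝒞 N) (h : IsNGB E 𝒞)
include hN h

/-- Minimality of `t` holds in `N` only, and `T` need not be definable there, so the proof is by
`∈`-induction in the universe, with the recursive description of closures. -/
theorem mem_of_isTC {T : Set S} (hT : T ∈ 𝒞) (hTt : IsTransClass E T) {a t x : N}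
    (ha : (a : S) ∈ T) (ht : IsTC (sub E N) a t) (hx : E x t) : (x : S) ∈ T := by
  have hTd := @isDef_mem_class S E 𝒞 T hT
  have hNd := @isDef_mem_class S E 𝒞 N hN.isClass
  have Z := hN.zfModel h
  obtain ⟨Q, hQ, hQR⟩ := exists_isDef_of_sub₂ (E := E) (R := fun a t => IsTC (sub E N) a t) hN.isClass
    inferInstance
  have hQ' : ∀ {s t : Unit → (ℕ → S) → S} [IsTm (classSystem E 𝒞) s] [IsTm (classSystem E 𝒞) t],
      IsDef (classSystem E 𝒞) fun i v => Q (s i v) (t i v) := hQ.subst₂ (R := fun _ => Q) ‹_› ‹_›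
  have key := h.zfModel.induction (fun a => a ∈ N → a ∈ T → ∀ t, t ∈ N → Q a t →
    ∀ x, E x t → x ∈ T) inferInstance (by
      intro a ih haN haT t htN hat x hx
      have hat := (hQR ⟨a, haN⟩ ⟨t, htN⟩).1 hat
      rcases (Z.isTC_iff hat ⟨x, hN.trans t htN x hx⟩).1 hx with hxa | ⟨z, s, hz, hs, hxs⟩
      · obtain rfl : x = a := congrArg Subtype.val hxa
        exact haT
      · exact ih z hz z.2 (hTt a haT z hz) s s.2 ((hQR z s).2 hs) x hxs)
  exact key a a.2 ha t t.2 ((hQR a t).2 ht) x hx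

/-- The closure of a definable class is the union of the closures that `N` computes for its
elements; in particular it is definable in `N`. -/
theorem mem_tcl_iff (φ : setLang.Formula (Fin 2)) (b : N) (x : S) :
    x ∈ tcl E 𝒞 (definedClass E N φ b) ↔ ∃ hx : x ∈ N, InClosure (sub E N) φ b ⟨x, hx⟩ := by
  have hNd := @isDef_mem_class S E 𝒞 N hN.isClass
  have Z := hN.zfModel h
  constructor
  · intro hx
    obtain ⟨Q, hQ, hQP⟩ := exists_isDef_of_sub₁ (E := E) (P := fun x => InClosure (sub E N) φ b x) hN.isClass
      inferInstance
    have hmem : {x | x ∈ N ∧ Q x} ∈ 𝒞 := h.mem_of_isDef inferInstance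
    obtain ⟨hxN, hxQ⟩ := hx _ hmem (by
      rintro x ⟨hx, hxQ⟩ y hy
      have hyN := hN.trans x hx y hy
      refine ⟨hyN, (hQP ⟨y, hyN⟩).2 ?_⟩
      obtain ⟨a, t, ha, ht, hxt⟩ := (hQP ⟨x, hx⟩).1 hxQ
      exact ⟨a, t, ha, ht, ht.1 ⟨x, hx⟩ hxt ⟨y, hyN⟩ hy⟩) (by
      rintro x ⟨hx, hxφ⟩
      obtain ⟨t, ht⟩ := Z.exists_isTC ⟨x, hx⟩
      exact ⟨hx, (hQP ⟨x, hx⟩).2 ⟨⟨x, hx⟩, t, (sat_iff_true E N φ _).1 hxφ, ht, ht.2.1⟩⟩)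
    exact ⟨hxN, (hQP ⟨x, hxN⟩).1 hxQ⟩
  · rintro ⟨hx, a, t, ha, ht, hxt⟩ T hT hTt hAT
    exact mem_of_isTC hN h hT hTt (hAT ⟨a.2, (sat_iff_true E N φ _).2 ha⟩) ht hxt

/-- The closure of `A` is made up of the closures of its elements, so both sides ask for the
definability of the same sets. -/
theorem subset_HOD_iff (φ : setLang.Formula (Fin 2)) (b : N) :
    definedClass E N φ b ⊆ HOD E 𝒞 N b ↔ tcl E 𝒞 (definedClass E N φ b) ⊆ OD E N b := by
  constructor
  · intro hA x hx
    obtain ⟨hxN, a, t, ha, ht, hxt⟩ := (mem_tcl_iff hN h φ b x).1 hx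
    exact hA (a := a) ⟨a.2, (sat_iff_true E N φ _).2 ha⟩ fun T hT hTt haT =>
      mem_of_isTC hN h hT hTt (haT rfl) ht hxt
  · intro hA a ha x hx
    exact hA fun T hT hTt hAT => hx T hT hTt fun y hy => by
      obtain rfl : y = a := hy
      exact hAT ha

theorem exists_wellOrder (φ : setLang.Formula (Fin 2)) (b : N)
    (hA : tcl E 𝒞 (definedClass E N φ b) ⊆ OD E N b) :
    ∃ χ, WellOrdersIn E N (tcl E 𝒞 (definedClass E N φ b)) χ b := by
  have Z := hN.zfModel h
  obtain ⟨χ, hχ⟩ := exists_sat_formula₃ (E := E) (P := fun i => IndexLess i.rel) isDef_indexLess_base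
  have hen (x : N) (hx : (x : S) ∈ tcl E 𝒞 (definedClass E N φ b)) : Enumerated (sub E N) b x :=
    enumerated_of_mem_OD Z hN.trans (hA hx)
  refine ⟨χ, ⟨fun x _ => ?_, fun x y z _ _ _ => ?_, fun x y hx hy => ?_, fun s hs hsT => ?_⟩⟩
  · rw [hχ]
    exact ZFModel.indexLess_irrefl b x
  · rw [hχ, hχ, hχ]
    exact Z.indexLess_trans
  · rw [hχ, hχ]
    exact Z.indexLess_total (hen x hx) (hen y hy)
  · obtain ⟨x, hx⟩ := hs
    simp only [hχ]
    exact Z.exists_indexLess_least ⟨⟨x, hN.trans s s.2 x hx⟩, hx⟩ fun y hy => hen y (hsT y hy)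

/-- The order refined by ranks is linear on the closure, so its collapse is injective there. An
element `x` is thus the unique member of the closure with collapse `ξ`, a definition from `b` and
the ordinal `ξ`. -/
theorem tcl_subset_OD (φ : setLang.Formula (Fin 2)) (b : N) (χ : setLang.Formula (Fin 3))
    (hχ : WellOrdersIn E N (tcl E 𝒞 (definedClass E N φ b)) χ b) :
    tcl E 𝒞 (definedClass E N φ b) ⊆ OD E N b := by
  have Z := hN.zfModel h
  have hT (x : N) : (x : S) ∈ tcl E 𝒞 (definedClass E N φ b) ↔ InClosure (sub E N) φ b x :=
    (mem_tcl_iff hN h φ b x).trans ⟨fun ⟨_, h⟩ => h, fun h => ⟨x.2, h⟩⟩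
  obtain ⟨h1, h2, h3, h4⟩ := hχ
  simp only [hT, sat_iff_true] at h1 h2 h3
  have hgood : ZFModel.GoodRel (elemSystem (sub E N)) (RankLess (sub E N) φ χ b) := by
    refine Z.goodRel_rankLess h1 h2 fun s hs hsT => ?_
    obtain ⟨x, hx⟩ := hs
    obtain ⟨m, hm, hm'⟩ := h4 s ⟨x, hx⟩ fun y hy => (hT ⟨y, hN.trans s s.2 y hy⟩).2 (hsT _ hy)
    exact ⟨m, hm, fun x hx hne => (sat_iff_true E N χ _).1 (hm' x hx hne)⟩
  intro x hx
  obtain ⟨hxN, hx'⟩ := (mem_tcl_iff hN h φ b x).1 hx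
  obtain ⟨ξ, hξ⟩ := Z.rec_exists hgood (Z.goodRule_colRule hgood) ⟨x, hxN⟩
  have hξO : IsOrd E (ξ : S) := (isOrd_sub hN.trans ξ).1 (Z.isOrd_col hgood hξ)
  have hb : IsTm (odSystem E N b) fun _ _ => b := ⟨Sum.inl ⟨b, Or.inr rfl⟩, fun _ _ => rfl⟩
  have hξt : IsTm (odSystem E N b) fun _ _ => ξ := ⟨Sum.inl ⟨ξ, Or.inl hξO⟩, fun _ _ => rfl⟩
  have hrec : IsDef (odSystem E N b) fun _ v =>
      Rec (sub E N) (RankLess (sub E N) φ χ b) (ColRule (sub E N)) (v 0) ξ :=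
    isDef_rec (D := odSystem E N b) (R := fun _ => RankLess (sub E N) φ χ)
      (Φ := fun _ _ => ColRule (sub E N)) (s := fun _ _ => b) (t := fun _ v => v 0)
      (r := fun _ _ => ξ) inferInstance inferInstance
  refine mem_OD_of_isDef (b := b) (x := ⟨x, hxN⟩) (P := fun y => InClosure (sub E N) φ b y ∧
    Rec (sub E N) (RankLess (sub E N) φ χ b) (ColRule (sub E N)) y ξ) inferInstance fun y => ?_
  constructor
  · rintro ⟨hy, hyξ⟩
    refine Z.col_inj hgood ?_ hyξ hξ
    obtain ⟨α, hα⟩ := Z.exists_isRank y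
    obtain ⟨β, hβ⟩ := Z.exists_isRank ⟨x, hxN⟩
    by_cases hne : y = ⟨x, hxN⟩
    · exact Or.inr (Or.inl hne)
    rcases Z.ord_trichotomy hα.1 hβ.1 with k | rfl | k
    · exact Or.inl ⟨hy, hx', α, β, hα, hβ, Or.inl k⟩
    · rcases h3 y ⟨x, hxN⟩ hy hx' hne with k | k
      · exact Or.inl ⟨hy, hx', α, α, hα, hβ, Or.inr ⟨rfl, k⟩⟩
      · exact Or.inr (Or.inr ⟨hx', hy, α, α, hβ, hα, Or.inr ⟨rfl, k⟩⟩)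
    · exact Or.inr (Or.inr ⟨hx', hy, β, α, hβ, hα, Or.inl k⟩)
  · rintro rfl
    exact ⟨hx', hξ⟩

end

end InnerModel

/-! ### Formulas in `N` for disagreements between `M` and `N` -/

section

/-- `x` belongs to a transitive set of enumerated sets. -/
def HerEnumerated (i : BinRel.{u}) (b x : i.carrier) : Prop :=
  ∃ t, IsTransSet i.rel t ∧ i.rel x t ∧ ∀ z, i.rel z t → Enumerated i.rel b z

/-- `θ(b, ξ, x)` holds in the class defined by `ψ` from `b`. -/
def HoldsIn (θ : setLang.Formula (Fin 3)) (ψ : setLang.Formula (Fin 2)) (i : BinRel.{u})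
    (b ξ x : i.carrier) : Prop :=
  Holds ψ i ξ b ∧ Holds ψ i x b ∧
    RelSatF i.rel (fun y => RelSatF i.rel (fun _ => True) ψ ![y, b]) θ ![b, ξ, x]

/-- `φ(x, b)` holds in the class defined by `ψ` from `b`. -/
def HoldsIn₂ (φ ψ : setLang.Formula (Fin 2)) (i : BinRel.{u}) (x b : i.carrier) : Prop :=
  Holds ψ i x b ∧ RelSatF i.rel (fun y => RelSatF i.rel (fun _ => True) ψ ![y, b]) φ ![x, b]

/-- The hereditarily enumerated set `x` has an index at which it does not satisfy `θ` in the class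
defined by `ψ`. -/
def Bad (θ : setLang.Formula (Fin 3)) (ψ : setLang.Formula (Fin 2)) (i : BinRel.{u})
    (b x : i.carrier) : Prop :=
  HerEnumerated i b x ∧ ∃ ξ, Enum i.rel b ξ x ∧ ¬ HoldsIn θ ψ i b ξ x

/-- `ξ` is an index that witnesses that an `∈`-minimal bad set is bad. -/
def BadIndex (θ : setLang.Formula (Fin 3)) (ψ : setLang.Formula (Fin 2)) (i : BinRel.{u})
    (ξ b : i.carrier) : Prop :=
  ∃ y, Enum i.rel b ξ y ∧ HerEnumerated i b y ∧ ¬ HoldsIn θ ψ i b ξ y ∧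
    ∀ z, i.rel z y → ¬ Bad θ ψ i b z

/-- `y` is enumerated at the least bad index, where the class defined by `ψ` has `x`. -/
def BadPair (θ : setLang.Formula (Fin 3)) (ψ : setLang.Formula (Fin 2)) (i : BinRel.{u})
    (b y x : i.carrier) : Prop :=
  ∃ ξ, LeastOrd (BadIndex θ ψ) i ξ b ∧ Enum i.rel b ξ y ∧ HoldsIn θ ψ i b ξ x

variable {s t r q : ∀ i : BinRel.{u}, (ℕ → i.carrier) → i.carrier}

instance [hs : IsTm uniformSystem s] [ht : IsTm uniformSystem t] :
    IsDef uniformSystem fun i v => HerEnumerated i (s i v) (t i v) := by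
  refine IsDef.subst₂ (R := HerEnumerated) ?_ hs ht
  unfold HerEnumerated
  infer_instance

instance (θ : setLang.Formula (Fin 3)) (ψ : setLang.Formula (Fin 2)) [hs : IsTm uniformSystem s]
    [ht : IsTm uniformSystem t] [hr : IsTm uniformSystem r] :
    IsDef uniformSystem fun i v => HoldsIn θ ψ i (s i v) (t i v) (r i v) := by
  unfold HoldsIn
  infer_instance

instance (φ ψ : setLang.Formula (Fin 2)) [hs : IsTm uniformSystem s] [ht : IsTm uniformSystem t] :
    IsDef uniformSystem fun i v => HoldsIn₂ φ ψ i (s i v) (t i v) := by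
  unfold HoldsIn₂
  infer_instance

instance (θ : setLang.Formula (Fin 3)) (ψ : setLang.Formula (Fin 2)) [hs : IsTm uniformSystem s]
    [ht : IsTm uniformSystem t] : IsDef uniformSystem fun i v => Bad θ ψ i (s i v) (t i v) := by
  refine IsDef.subst₂ (R := Bad θ ψ) ?_ hs ht
  unfold Bad
  infer_instance

theorem isDef_badIndex (θ : setLang.Formula (Fin 3)) (ψ : setLang.Formula (Fin 2)) :
    IsDef uniformSystem fun i v => BadIndex θ ψ i (v 0) (v 1) := by
  unfold BadIndex
  infer_instance

instance (θ : setLang.Formula (Fin 3)) (ψ : setLang.Formula (Fin 2)) [hs : IsTm uniformSystem s]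
    [ht : IsTm uniformSystem t] [hr : IsTm uniformSystem r] :
    IsDef uniformSystem fun i v => BadPair θ ψ i (s i v) (t i v) (r i v) := by
  refine IsDef.subst₃ (R := BadPair θ ψ) ?_ hs ht hr
  have : ∀ {s t : ∀ i : BinRel.{u}, (ℕ → i.carrier) → i.carrier} [IsTm uniformSystem s]
      [IsTm uniformSystem t], IsDef uniformSystem fun i v =>
        LeastOrd (BadIndex θ ψ) i (s i v) (t i v) :=
    (isDef_leastOrd (isDef_badIndex θ ψ)).subst₂ ‹_› ‹_›
  unfold BadPair
  infer_instance

end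

/-! ### Agreement of `M` and `N` on hereditarily enumerated sets -/

section

variable {S : Type u} {E : S → S → Prop} {𝒞 : Set (Set S)}

namespace DefinableEmbedding

variable {M N : Set S} {j : M → N} {b : S} {ψ : setLang.Formula (Fin 2)}
  (H : DefinableEmbedding E 𝒞 M N j b ψ)
include H

theorem holds_iff (x : N) : Holds ψ (inRel E N) x ⟨b, H.subset H.param⟩ ↔ (x : S) ∈ M := by
  rw [← sat_iff_holds, ← H.defined]

theorem holdsIn_iff {θ : setLang.Formula (Fin 3)} (ξ x : N) :
    HoldsIn θ ψ (inRel E N) ⟨b, H.subset H.param⟩ ξ x ↔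
      ∃ (hξ : (ξ : S) ∈ M) (hx : (x : S) ∈ M), Sat E M θ ![⟨b, H.param⟩, ⟨ξ, hξ⟩, ⟨x, hx⟩] := by
  have key (hξ : (ξ : S) ∈ M) (hx : (x : S) ∈ M) := sat_iff_relSatF_sub E H.subset
    (fun y => Holds ψ (inRel E N) y ⟨b, H.subset H.param⟩) H.holds_iff θ
    ![⟨b, H.param⟩, ⟨ξ, hξ⟩, ⟨x, hx⟩]
  simp only [comp_vec₃ (fun y : M => (⟨y, H.subset y.2⟩ : N))] at key
  constructor
  · rintro ⟨h1, h2, h3⟩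
    exact ⟨(H.holds_iff ξ).1 h1, (H.holds_iff x).1 h2, (key _ _).2 h3⟩
  · rintro ⟨h1, h2, h3⟩
    exact ⟨(H.holds_iff ξ).2 h1, (H.holds_iff x).2 h2, (key _ _).1 h3⟩

theorem holdsIn₂_iff {φ : setLang.Formula (Fin 2)} (x : N) :
    HoldsIn₂ φ ψ (inRel E N) x ⟨b, H.subset H.param⟩ ↔
      ∃ hx : (x : S) ∈ M, Sat E M φ ![⟨x, hx⟩, ⟨b, H.param⟩] := by
  have key (hx : (x : S) ∈ M) := sat_iff_relSatF_sub E H.subset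
    (fun y => Holds ψ (inRel E N) y ⟨b, H.subset H.param⟩) H.holds_iff φ
    ![⟨x, hx⟩, ⟨b, H.param⟩]
  simp only [comp_vec₂ (fun y : M => (⟨y, H.subset y.2⟩ : N))] at key
  constructor
  · rintro ⟨h2, h3⟩
    exact ⟨(H.holds_iff x).1 h2, (key _).2 h3⟩
  · rintro ⟨h2, h3⟩
    exact ⟨(H.holds_iff x).2 h2, (key _).1 h3⟩

/-- The embedding maps the `ξ`-th set of `M` to the `j(ξ)`-th set of `N`. -/
theorem enum_iff (ξ x : M) : Enum (sub E M) ⟨b, H.param⟩ ξ x ↔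
    Enum (sub E N) ⟨b, H.subset H.param⟩ (j ξ) (j x) := by
  rw [← H.j_param]
  exact H.elementary.iff₃ (P := fun i => Enum i.rel) isDef_enum_base _ ξ x

variable (hM : IsInnerModel E 𝒞 M) (hN : IsInnerModel E 𝒞 N) {θ : setLang.Formula (Fin 3)}
  (hθ : ∀ (K : Set S) (c ξ x : K), Sat E K θ ![c, ξ, x] ↔ Enum (sub E K) c ξ x)
include hM hN hθ

/-- Hereditarily enumerated sets have the same indices in `M` and in `N`. -/
theorem not_bad (x : N) : ¬ Bad θ ψ (inRel E N) ⟨b, H.subset H.param⟩ x := by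
  have ZM := hM.zfModel H.ngb
  have ZN := hN.zfModel H.ngb
  set c : N := ⟨b, H.subset H.param⟩ with hc
  intro hx
  have hbad : ∀ {s : Unit → (ℕ → N) → N} [IsTm (elemSystem (sub E N)) s],
      IsDef (elemSystem (sub E N)) fun i v => Bad θ ψ (inRel E N) c (s i v) := by
    have : IsDef (elemSystem (sub E N)) fun _ v => Bad θ ψ (inRel E N) c (v 0) := by
      unfold Bad HerEnumerated HoldsIn Holds
      infer_instance
    exact @fun s hs => this.subst₁ (R := fun _ x => Bad θ ψ (inRel E N) c x) (t₀ := s) hs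
  -- An `∈`-minimal bad set has only elements on whose indices `M` agrees. Such sets need not be
  -- unique, but the least index witnessing badness of one of them is definable from `b`, hence
  -- fixed.
  obtain ⟨y₀, ⟨hy₀, ξ₀, hξ₀, hn₀⟩, hmin⟩ := ZN.foundation (Bad θ ψ (inRel E N) c) hbad ⟨x, hx⟩
  obtain ⟨ξ, hξO, hjξ, hlξ⟩ := H.exists_fixed (isDef_badIndex θ ψ)
    ⟨ξ₀, (isOrd_sub hN.trans _).1 hξ₀.1, y₀, hξ₀, hy₀, hn₀, hmin⟩
  obtain ⟨y, hξy, hyT, hny, hymin⟩ := id hlξ.2.1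
  obtain ⟨x, hξx⟩ := ZM.exists_enum ⟨b, H.param⟩ ((isOrd_sub hM.trans ξ).2 hξO)
  obtain rfl : j x = y := ZN.enum_unique ((H.enum_iff ξ x).1 hξx) hξy
  have hin : ∀ {η z : M}, Enum (sub E M) ⟨b, H.param⟩ η z →
      HoldsIn θ ψ (inRel E N) c ⟨η, H.subset η.2⟩ ⟨z, H.subset z.2⟩ := fun {η z} h =>
    (H.holdsIn_iff _ _).2 ⟨η.2, z.2, (hθ _ _ _ _).2 h⟩
  have hjξ' : j ξ = ⟨ξ, H.subset ξ.2⟩ := Subtype.ext hjξ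
  -- This names `j x` and `x` by a formula in `b` alone, so that both may occur in the properties to
  -- which `exists_fixed` is applied.
  have hpair : BadPair θ ψ (inRel E N) c (j x) ⟨x, H.subset x.2⟩ :=
    ⟨j ξ, hlξ, hξy, hjξ' ▸ hin hξx⟩
  have huniq : ∀ {y x' : N}, BadPair θ ψ (inRel E N) c y x' → y = j x ∧ (x' : S) = x := by
    rintro y x' ⟨ξ', hξ', hy, hx'⟩
    obtain rfl := H.leastOrd_unique hN.trans hξ' hlξ
    refine ⟨ZN.enum_unique hy hξy, ?_⟩
    obtain ⟨h1, h2, h3⟩ := (H.holdsIn_iff _ _).1 hx'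
    have h3 := (hθ _ _ _ _).1 h3
    rw [show (⟨j ξ, h1⟩ : M) = ξ from Subtype.ext hjξ] at h3
    exact congrArg Subtype.val (ZM.enum_unique h3 hξx)
  have hyel : ∀ z, sub E N z (j x) → ∃ η, Enum (sub E N) c η z := by
    obtain ⟨t, ht, hyt, hen⟩ := hyT
    exact fun z hz => hen z (ht _ hyt z hz)
  have hyin : ∀ {z η}, sub E N z (j x) → Enum (sub E N) c η z →
      HoldsIn θ ψ (inRel E N) c η z := by
    intro z η hz hη
    by_contra hne
    refine hymin z hz ⟨?_, η, hη, hne⟩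
    obtain ⟨t, ht, hyt, hen⟩ := hyT
    exact ⟨t, ht, ht _ hyt z hz, hen⟩
  have hxT : HerEnumerated (inRel E M) ⟨b, H.param⟩ x := by
    rw [H.elementary.iff₂ (P := HerEnumerated) inferInstance, H.j_param]
    exact hyT
  have hyx : ∀ z : N, E z (j x) → E z x := by
    intro z hz
    by_contra hzx
    obtain ⟨η, hη⟩ := hyel z hz
    -- The least index `η` of a set `z'` in `j x` but not in `x` is fixed by `j`. As `z'` is the
    -- `η`-th set in both `M` and `N`, it is fixed too, and `z' ∈ j x` pulls back to `z' ∈ x`.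
    obtain ⟨η, hηO, hjη, hl⟩ := H.exists_fixed (δ := fun i η b => ∃ y x z, BadPair θ ψ i b y x ∧
      Enum i.rel b η z ∧ HoldsIn θ ψ i b η z ∧ i.rel z y ∧ ¬ i.rel z x) inferInstance
      ⟨η, (isOrd_sub hN.trans _).1 hη.1, j x, ⟨x, H.subset x.2⟩, z, hpair, hη, hyin hz hη, hz, hzx⟩
    obtain ⟨y', x', z', hp, h1, h2, h3, h4⟩ := hl.2.1
    obtain ⟨rfl, hx'⟩ := huniq hp
    obtain ⟨k1, k2, k3⟩ := (H.holdsIn_iff _ _).1 h2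
    have k3 := (hθ _ _ _ _).1 k3
    rw [show (⟨j η, k1⟩ : M) = η from Subtype.ext hjη] at k3
    have hjz : j ⟨z', k2⟩ = z' := ZN.enum_unique ((H.enum_iff _ _).1 k3) h1
    refine h4 ?_
    have := (H.delta0.mem_iff ⟨z', k2⟩ x).2 (hjz.symm ▸ h3)
    change E (z' : S) x'
    rwa [hx']
  have hxy : ∀ z : M, E z x → E z (j x) := by
    intro z hz
    by_contra hzy
    obtain ⟨t, ht, hxt, hen⟩ := hxT
    obtain ⟨η, hη⟩ := hen z (ht _ hxt z hz)
    -- Here `η` is the least index in `M` of a set `z'` in `x` but not in `j x`. Its image `j z' ∈ j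
    -- x` is the `η`-th set of `N`, so by minimality of `j x` also the `η`-th set of `M`, which is
    -- `z'`.
    obtain ⟨η, hηO, hjη, hl⟩ := H.exists_fixed (δ := fun i η b => ∃ y x z, BadPair θ ψ i b y x ∧
      HoldsIn θ ψ i b η z ∧ i.rel z x ∧ ¬ i.rel z y) inferInstance
      ⟨⟨η, H.subset η.2⟩, (isOrd_sub hM.trans _).1 hη.1, j x, ⟨x, H.subset x.2⟩,
        ⟨z, H.subset z.2⟩, hpair, hin hη, hz, hzy⟩
    obtain ⟨y', x', z', hp, h2, h3, h4⟩ := hl.2.1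
    obtain ⟨rfl, hx'⟩ := huniq hp
    obtain ⟨k1, k2, k3⟩ := (H.holdsIn_iff _ _).1 h2
    have k3 := (hθ _ _ _ _).1 k3
    rw [show (⟨j η, k1⟩ : M) = η from Subtype.ext hjη] at k3
    have hzx : E z' x := by
      have h3 : E (z' : S) x' := h3
      rwa [hx'] at h3
    have hjzy := (H.delta0.mem_iff ⟨z', k2⟩ x).1 hzx
    obtain ⟨l1, l2, l3⟩ := (H.holdsIn_iff _ _).1 (hyin hjzy ((H.enum_iff _ _).1 k3))
    have l3 := (hθ _ _ _ _).1 l3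
    rw [show (⟨j η, l1⟩ : M) = η from Subtype.ext hjη] at l3
    have hjz : (j ⟨z', k2⟩ : S) = z' := congrArg (fun y : M => (y : S)) (ZM.enum_unique l3 k3)
    refine h4 ?_
    have hjzy : E (j ⟨z', k2⟩ : S) (j x) := hjzy
    rwa [hjz] at hjzy
  refine hny ?_
  have hjx : j x = ⟨x, H.subset x.2⟩ := ZN.ext _ _ fun z =>
    ⟨hyx z, fun hz => hxy ⟨z, hM.trans x x.2 z hz⟩ hz⟩
  have := hin hξx
  rwa [← hjξ', ← hjx] at this

/-- Classes of hereditarily enumerated sets are the same in `M` and in `N`. -/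
theorem definedClass_eq (φ : setLang.Formula (Fin 2))
    (hφ : ∀ x : N, Holds φ (inRel E N) x ⟨b, H.subset H.param⟩ →
      HerEnumerated (inRel E N) ⟨b, H.subset H.param⟩ x) :
    definedClass E M φ ⟨b, H.param⟩ = definedClass E N φ ⟨b, H.subset H.param⟩ := by
  have ZM := hM.zfModel H.ngb
  have ZN := hN.zfModel H.ngb
  set c : N := ⟨b, H.subset H.param⟩ with hc
  have hin : ∀ {x η : N}, Holds φ (inRel E N) x c → Enum (sub E N) c η x →
      HoldsIn θ ψ (inRel E N) c η x := by
    intro x η hx hη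
    by_contra hne
    exact H.not_bad hM hN hθ x ⟨hφ x hx, η, hη, hne⟩
  have hen : ∀ {i : BinRel.{u}} {b x : i.carrier}, HerEnumerated i b x → ∃ η, Enum i.rel b η x :=
    fun ⟨t, _, hxt, h⟩ => h _ hxt
  have hφj (z : M) : Sat E M φ ![z, ⟨b, H.param⟩] ↔ Sat E N φ ![j z, c] := by
    have := H.elementary 2 φ ![z, ⟨b, H.param⟩]
    rwa [comp_vec₂, H.j_param] at this
  refine Set.Subset.antisymm (fun z hz => ?_) (fun z hz => ?_)
  · obtain ⟨hzM, hz⟩ := hz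
    refine ⟨H.subset hzM, ?_⟩
    by_contra hnz
    have hφM : HerEnumerated (inRel E M) ⟨b, H.param⟩ ⟨z, hzM⟩ := by
      rw [H.elementary.iff₂ (P := HerEnumerated) inferInstance, H.j_param]
      exact hφ _ ((sat_iff_holds _ _ _).1 ((hφj _).1 hz))
    obtain ⟨η, hη⟩ := hen hφM
    -- Consider the least index in `M` of a set `z` in `A^M` but not in `A^N`. Then `j z ∈ A^N` is
    -- the `η`-th set of `N`, hence of `M`, so `j z = z`.
    obtain ⟨η, hηO, hjη, hl⟩ := H.exists_fixed (δ := fun i η b => ∃ z, HoldsIn θ ψ i b η z ∧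
      HoldsIn₂ φ ψ i z b ∧ ¬ Holds φ i z b) inferInstance
      ⟨⟨η, H.subset η.2⟩, (isOrd_sub hM.trans _).1 hη.1, ⟨z, H.subset hzM⟩,
        (H.holdsIn_iff _ _).2 ⟨η.2, hzM, (hθ _ _ _ _).2 hη⟩, (H.holdsIn₂_iff _).2 ⟨hzM, hz⟩,
        fun h => hnz ((sat_iff_holds _ _ _).2 h)⟩
    obtain ⟨z, h1, h2, h3⟩ := hl.2.1
    obtain ⟨k1, k2, k3⟩ := (H.holdsIn_iff _ _).1 h1
    obtain ⟨_, hz⟩ := (H.holdsIn₂_iff _).1 h2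
    have k3 := (hθ _ _ _ _).1 k3
    rw [show (⟨j η, k1⟩ : M) = η from Subtype.ext hjη] at k3
    have hjz := (hφj _).1 hz
    obtain ⟨l1, l2, l3⟩ := (H.holdsIn_iff _ _).1
      (hin ((sat_iff_holds _ _ _).1 hjz) ((H.enum_iff _ _).1 k3))
    have l3 := (hθ _ _ _ _).1 l3
    rw [show (⟨j η, l1⟩ : M) = η from Subtype.ext hjη] at l3
    have e : j ⟨z, k2⟩ = z := Subtype.ext (congrArg (fun y : M => (y : S)) (ZM.enum_unique l3 k3))
    exact h3 ((sat_iff_holds _ _ _).1 (e ▸ hjz))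
  · obtain ⟨hzN, hz⟩ := hz
    by_contra hnz
    have hz := (sat_iff_holds _ _ _).1 hz
    obtain ⟨η, hη⟩ := hen (hφ _ hz)
    -- For the other inclusion, `z` is the `η`-th set of `N` and, by agreement, of `M`. So `j z =
    -- z`, and elementarity puts `z` into `A^M`.
    obtain ⟨η, hηO, hjη, hl⟩ := H.exists_fixed (δ := fun i η b => ∃ z, Enum i.rel b η z ∧
      Holds φ i z b ∧ ¬ HoldsIn₂ φ ψ i z b) inferInstance
      ⟨η, (isOrd_sub hN.trans _).1 hη.1, ⟨z, hzN⟩, hη, hz, fun h => hnz ((H.holdsIn₂_iff _).1 h)⟩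
    obtain ⟨z, h1, h2, h3⟩ := hl.2.1
    obtain ⟨k1, k2, k3⟩ := (H.holdsIn_iff _ _).1 (hin h2 h1)
    have k3 := (hθ _ _ _ _).1 k3
    rw [show (⟨j η, k1⟩ : M) = η from Subtype.ext hjη] at k3
    have hjz : j ⟨z, k2⟩ = z := ZN.enum_unique ((H.enum_iff _ _).1 k3) h1
    refine h3 ((H.holdsIn₂_iff _).2 ⟨k2, (hφj _).2 ?_⟩)
    rw [hjz]
    exact (sat_iff_holds _ _ _).2 h2

end DefinableEmbedding

end

end ClassTheory

theorem theorem6p4 {S : Type*} (E : S → S → Prop) (𝒞 : Set (Set S)) (hNGB : IsNGB E 𝒞)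
    (M N : Set S) (hM : IsInnerModel E 𝒞 M) (hN : IsInnerModel E 𝒞 N) (hMN : M ⊆ N)
    (j : M → N) (hj : IsElementaryEmbedding E 𝒞 j)
    (b : S) (hb : b ∈ M) (hjb : (j ⟨b, hb⟩ : S) = b)
    (ψ : setLang.Formula (Fin 2)) (hψ : M = definedClass E N ψ ⟨b, hMN hb⟩)
    (φ : setLang.Formula (Fin 2)) :
    ((∃ χ : setLang.Formula (Fin 3),
        WellOrdersIn E N (tcl E 𝒞 (definedClass E N φ ⟨b, hMN hb⟩)) χ ⟨b, hMN hb⟩) ↔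
      definedClass E N φ ⟨b, hMN hb⟩ ⊆ HOD E 𝒞 N ⟨b, hMN hb⟩) ∧
    (definedClass E N φ ⟨b, hMN hb⟩ ⊆ HOD E 𝒞 N ⟨b, hMN hb⟩ →
      definedClass E M φ ⟨b, hb⟩ = definedClass E N φ ⟨b, hMN hb⟩) := by
  have H : DefinableEmbedding E 𝒞 M N j b ψ :=
    { ngb := hNGB
      classM := hM.isClass
      classN := hN.isClass
      transM := hM.trans
      transN := hN.trans
      auM := hM.almostUniversal
      auN := hN.almostUniversal
      subset := hMN
      graph := hj.isClass
      delta0 := hj.delta0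
      cofinal := hj.cofinal
      param := hb
      fixed := ⟨hb, hjb⟩
      defined := fun x => by
        constructor
        · intro hx
          rw [hψ] at hx
          exact hx.2
        · intro hx
          rw [hψ]
          exact ⟨x.2, hx⟩ }
  refine ⟨⟨?_, fun hA => ?_⟩, fun hA => ?_⟩
  · rintro ⟨χ, hχ⟩
    exact (subset_HOD_iff hN hNGB φ _).2 (tcl_subset_OD hN hNGB φ _ χ hχ)
  · exact exists_wellOrder hN hNGB φ _ ((subset_HOD_iff hN hNGB φ _).1 hA)
  · obtain ⟨θ, hθ⟩ := exists_sat_formula₃ (E := E) (P := fun i => Enum i.rel) isDef_enum_base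
    have hOD := (subset_HOD_iff hN hNGB φ _).1 hA
    have ZN := hN.zfModel hNGB
    refine H.definedClass_eq hM hN hθ φ fun x hx => ?_
    obtain ⟨t, ht⟩ := ZN.exists_isTC x
    refine ⟨t, ht.1, ht.2.1, fun z hz => enumerated_of_mem_OD ZN hN.trans (hOD ?_)⟩
    exact (mem_tcl_iff hN hNGB φ _ z).2 ⟨z.2, x, t, hx, ht, hz⟩
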